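/- **Proposition 4.4.** Let $n\ge 1$ and let $\Omega\subset\mathbb R^n$ be a bounded open set with $C^{1,1}$ boundary, i.e. near each boundary point $\Omega$ is, after a rotation, the region above the graph of a $C^1$ function with Lipschitz gradient. Put $d(x)=\operatorname{dist}(x,\mathbb R^n\setminus\Omega)$ for $x\in\mathbb R^n$ and $\Omega_\rho=\{x\in\Omega: d(x)<\rho\}$. Then there is $\rho>0$, depending only on $\Omega$, such that the following holds. Let $s\in(0,1)$, and let $g:\mathbb R\to\mathbb R$ be odd, with $g(0)=0$, $g>0$ on $(0,\infty)$, $g$ right continuous on $[0,\infty)$, nondecreasing and convex on $(0,\infty)$, $\lim_{t\to\infty}g(t)=\infty$, $g$ absolutely continuous on bounded subintervals of $[0,\infty)$, and, for some constants $\lambda,\Lambda$, $$1<\lambda\le \frac{t g'(t)}{g(t)}\le\Lambda<\infty\qquad\text{for a.e. } t>0 .$$ Then there is $f\in L^\infty(\Omega_\rho)$ such that $$(-\Delta_g)^s d^s=f\quad\text{weakly in }\Omega_\rho .$$ Here the notions are as follows. Let $G(t)=\int_0^{|t|}g(\tau)\,d\tau$, $D_su(x,y)=\frac{u(x)-u(y)}{|x-y|^s}$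 and $d\mu=\frac{dx\,dy}{|x-y|^n}$. For a measure $\nu$, $L^G(\nu)$ is the set of measurable $v$ with $\int G(v)\,d\nu<\infty$, and $\|v\|_{G,\nu}=\inf\{c>0:\int G(v/c)\,d\nu\le1\}$. For $U\subset\mathbb R^n$ open, $W^{s,G}(U)$ is the set of $u\in L^G(U)$ with $D_su\in L^G(U\times U,\mu)$, and $\|u\|_{s,G,U}$ is the sum of the Luxemburg norms of $u$ in $L^G(U)$ and of $D_su$ in $L^G(U\times U,\mu)$. For a bounded open set $V$, $W^{s,G}_0(V)$ is the set of $\varphi\in W^{s,G}(\mathbb R^n)$ with $\varphi=0$ a.e. outside $V$, and $\widetilde W^{s,G}(V)$ is the set of $u\in L^G_{loc}(\mathbb R^n)$ such that, for some open $U$ containing the compact set $\overline V$, $$\|u\|_{s,G,U}+\int_{\mathbb R^n} g\Big(\frac{|u(x)|}{(1+|x|)^s}\Big)\frac{dx}{(1+|x|)^{n+s}}<\infty .$$ That $(-\Delta_g)^su=f$ weakly in $V$ means: $u\in\widetilde W^{s,G}(V)$; $\varphi\mapsto\int_V f\varphi\,dx$ is well defined and a bounded functional on $W^{s,G}_0(V)$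 with respect to $\|\cdot\|_{s,G,\mathbb R^n}$; and for every $\varphi\in W^{s,G}_0(V)$ $$\iint_{\mathbb R^n\times\mathbb R^n} g\big(D_su(x,y)\big)\,D_s\varphi(x,y)\,d\mu=\int_V f\varphi\,dx ,$$ the integral on the left being absolutely convergent. -/

import Mathlib

open MeasureTheory Set Filter Topology
open scoped ENNReal NNReal

noncomputable section

/-- Euclidean space `ℝⁿ`. -/
abbrev Eucl (n : ℕ) : Type := EuclideanSpace ℝ (Fin n)

/-! ### Young functions -/

/-- The standing assumptions on `g = G'`. The function `g` is given on `[0, ∞)`, extended to `ℝ` as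
an odd function. Since `g` is only absolutely continuous, the ellipticity condition
`1 < lam ≤ t g'(t) / g(t) ≤ Lam < ∞` is required at almost every `t > 0`. -/
structure IsAdmissible (g : ℝ → ℝ) (lam Lam : ℝ) : Prop where
  zero : g 0 = 0
  pos : ∀ t, 0 < t → 0 < g t
  odd : ∀ t, g (-t) = -g t
  rightContinuous : ∀ t, 0 ≤ t → ContinuousWithinAt g (Ici t) t
  monotone : MonotoneOn g (Ioi 0)
  tendsto : Tendsto g atTop atTop
  absolutelyContinuous : ∀ T, 0 < T → AbsolutelyContinuousOnInterval g 0 T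
  one_lt : 1 < lam
  ellipticity : ∀ᵐ t : ℝ, 0 < t → lam ≤ t * deriv g t / g t ∧ t * deriv g t / g t ≤ Lam
  convex : ConvexOn ℝ (Ioi 0) g

/-- The Young function `G(t) = ∫₀^{|t|} g(τ) dτ`, extended to `ℝ` as an even function. -/
def youngG (g : ℝ → ℝ) (t : ℝ) : ℝ := ∫ τ in (0 : ℝ)..|t|, g τ

/-! ### Orlicz spaces over a general measure -/

section Orlicz

variable {α : Type*} [MeasurableSpace α]

/-- The modular `∫ G(v) dν`. -/
def modular (g : ℝ → ℝ) (ν : Measure α) (v : α → ℝ) : ℝ≥0∞ :=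
  ∫⁻ a, ENNReal.ofReal (youngG g (v a)) ∂ν

/-- The Luxemburg norm `inf {c > 0 : ∫ G(v / c) dν ≤ 1}`, with `inf ∅ = ∞`. -/
def luxemburg (g : ℝ → ℝ) (ν : Measure α) (v : α → ℝ) : ℝ≥0∞ :=
  ⨅ (c : ℝ) (_ : 0 < c) (_ : modular g ν (fun a => v a / c) ≤ 1), ENNReal.ofReal c

/-- `v ∈ L^G(ν)`: `v` is measurable and `∫ G(v) dν < ∞`. -/
def MemLG (g : ℝ → ℝ) (ν : Measure α) (v : α → ℝ) : Prop :=
  AEMeasurable v ν ∧ modular g ν v < ⊤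

end Orlicz

/-! ### Fractional Orlicz-Sobolev spaces -/

/-- The measure `dμ = dx dy / |x - y|ⁿ` on `ℝⁿ × ℝⁿ`. -/
def muMeasure (n : ℕ) : Measure (Eucl n × Eucl n) :=
  (volume : Measure (Eucl n × Eucl n)).withDensity
    fun p => ENNReal.ofReal (1 / ‖p.1 - p.2‖ ^ n)

/-- The `s`-Hölder quotient `D_s u(x, y) = (u(x) - u(y)) / |x - y|^s`. -/
def holderQuot {n : ℕ} (s : ℝ) (u : Eucl n → ℝ) (p : Eucl n × Eucl n) : ℝ :=
  (u p.1 - u p.2) / ‖p.1 - p.2‖ ^ s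

/-- `u ∈ W^{s,G}(U)`. -/
def MemW {n : ℕ} (g : ℝ → ℝ) (s : ℝ) (U : Set (Eucl n)) (u : Eucl n → ℝ) : Prop :=
  MemLG g (volume.restrict U) u ∧ MemLG g ((muMeasure n).restrict (U ×ˢ U)) (holderQuot s u)

/-- The norm `‖u‖_{s,G,U} = ‖u‖_{G,U} + [u]_{s,G,U}`. -/
def normW {n : ℕ} (g : ℝ → ℝ) (s : ℝ) (U : Set (Eucl n)) (u : Eucl n → ℝ) : ℝ≥0∞ :=
  luxemburg g (volume.restrict U) u
    + luxemburg g ((muMeasure n).restrict (U ×ˢ U)) (holderQuot s u)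

/-- The tail integral `∫ g(|u(x)| / (1 + |x|)^s) dx / (1 + |x|)^{n+s}` over `ℝⁿ`. -/
def tailIntegral {n : ℕ} (g : ℝ → ℝ) (s : ℝ) (u : Eucl n → ℝ) : ℝ≥0∞ :=
  ∫⁻ x : Eucl n, ENNReal.ofReal (g (|u x| / (1 + ‖x‖) ^ s) / (1 + ‖x‖) ^ ((n : ℝ) + s))

/-- `u ∈ W̃^{s,G}(Ω)` for a bounded `Ω`: `u ∈ L^G_loc(ℝⁿ)`, and for some open `U ⊃⊃ Ω` the norm
`‖u‖_{s,G,U}` and the tail integral of `u` are finite. -/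
def MemWtilde {n : ℕ} (g : ℝ → ℝ) (s : ℝ) (Ω : Set (Eucl n)) (u : Eucl n → ℝ) : Prop :=
  (∀ K : Set (Eucl n), IsCompact K → MemLG g (volume.restrict K) u) ∧
  ∃ U : Set (Eucl n), IsOpen U ∧ IsCompact (closure Ω) ∧ closure Ω ⊆ U ∧
    normW g s U u + tailIntegral g s u < ⊤

/-- `φ ∈ W₀^{s,G}(Ω)`: `φ ∈ W^{s,G}(ℝⁿ)` and `φ = 0` almost everywhere outside `Ω`. -/
def MemW0 {n : ℕ} (g : ℝ → ℝ) (s : ℝ) (Ω : Set (Eucl n)) (φ : Eucl n → ℝ) : Prop :=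
  MemW g s univ φ ∧ ∀ᵐ x : Eucl n, x ∉ Ω → φ x = 0

/-- The function `f` belongs to the dual of `W₀^{s,G}(Ω)`: the functional `φ ↦ ∫_Ω f φ` is well
defined and bounded with respect to the norm of `W^{s,G}(ℝⁿ)`. -/
def MemDual {n : ℕ} (g : ℝ → ℝ) (s : ℝ) (Ω : Set (Eucl n)) (f : Eucl n → ℝ) : Prop :=
  (∀ φ : Eucl n → ℝ, MemW0 g s Ω φ → IntegrableOn (fun x => f x * φ x) Ω) ∧
  ∃ C : ℝ≥0, ∀ φ : Eucl n → ℝ, MemW0 g s Ω φ →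
    ENNReal.ofReal |∫ x in Ω, f x * φ x| ≤ C * normW g s univ φ

/-- `u` is a weak solution of `(-Δ_g)^s u = f` in the bounded open set `Ω`: `u ∈ W̃^{s,G}(Ω)`, `f` is
in the dual of `W₀^{s,G}(Ω)`, and for every test function `φ ∈ W₀^{s,G}(Ω)`
`∬ g(D_s u) D_s φ dμ = ∫_Ω f φ dx`, the double integral over `ℝⁿ × ℝⁿ` being absolutely convergent. -/
def IsWeakSolution {n : ℕ} (g : ℝ → ℝ) (s : ℝ) (Ω : Set (Eucl n)) (u f : Eucl n → ℝ) : Prop :=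
  MemWtilde g s Ω u ∧ MemDual g s Ω f ∧
  ∀ φ : Eucl n → ℝ, MemW0 g s Ω φ →
    Integrable (fun p => g (holderQuot s u p) * holderQuot s φ p) (muMeasure n) ∧
    ∫ p, g (holderQuot s u p) * holderQuot s φ p ∂(muMeasure n) = ∫ x in Ω, f x * φ x

/-! ### Domains with `C^{1,1}` boundary -/

/-- `Ω` has `C^{1,1}` boundary: near each boundary point, for some unit vector `e` (the direction of
the last coordinate axis after a rotation), `Ω` is the region above the graph of a function `γ` of the
component `x' = x - ⟨e, x⟩ e` of `x` orthogonal to `e`, where `γ` is of class `C¹` with Lipschitz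
gradient. (Only the values of `γ` on the hyperplane orthogonal to `e` matter; a `C^{1,1}` function of
`x'` is a `C^{1,1}` function on the whole space that does not depend on the component along `e`.) -/
def HasC11Boundary {n : ℕ} (Ω : Set (Eucl n)) : Prop :=
  ∀ x₀ ∈ frontier Ω, ∃ (e : Eucl n) (r : ℝ) (γ : Eucl n → ℝ) (K : ℝ≥0),
    ‖e‖ = 1 ∧ 0 < r ∧ ContDiff ℝ 1 γ ∧ LipschitzWith K (fderiv ℝ γ) ∧
    ∀ x ∈ Metric.ball x₀ r, x ∈ Ω ↔ γ (x - inner ℝ e x • e) < inner ℝ e x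

/-- `d(x) = dist(x, Ωᶜ)`. -/
def distCompl {n : ℕ} (Ω : Set (Eucl n)) (x : Eucl n) : ℝ := Metric.infDist x Ωᶜ

/-- `Ω_ρ = {x ∈ Ω : d(x) < ρ}`. -/
def collar {n : ℕ} (Ω : Set (Eucl n)) (ρ : ℝ) : Set (Eucl n) := {x ∈ Ω | distCompl Ω x < ρ}

end

/-! The distance `d` is 1-Lipschitz, so `d^s` is `s`-Hölder with constant one and every quotient
`D_s d^s` lies in `[-1, 1]`. Only the behaviour of `g` on `[-1, 1]` matters for `d^s`: there it is
bounded by `g 1`, and it is Lipschitz by convexity.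

The operator on `d^s` is compared at each `x` of the collar with a solution in a half-space. A
`C^{1,1}` domain has interior and exterior tangent balls of a uniform radius `R`; hence, with `δ =
d(x)` and the normal `ν` at the nearest boundary point, `d(x + z)` differs from `(δ + ν·z)₊` by at
most `‖z‖² / R`. For the powers this becomes `‖z‖² |δ + ν·z|^(s-1) / R`
(`abs_distCompl_rpow_sub_le`). The Lipschitz bound on `g` then reduces the difference of the two
operators near `z = 0` to the kernel `‖z‖^(2-2s-n) |δ + ν·z|^(s-1)`, whose integral over the unit
ball is bounded uniformly in `δ` and `ν` (`exists_lintegral_singular_le`).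

The model `(δ + ν·z)₊^s` is handled by polar coordinates and scaling, which reduce it to `x₊^s` at
`x = 1` on the line. There the substitution `τ = σ/(1-σ)` on the right-hand side makes the two sides
combine into the exact derivative of `G(W)/s`, where `W` is `halfLineQuot`. What survives a
truncation at `η` is `O(min(1, η^(1-s)))`, so in the half-space the truncated operator is `O(δ^(-s)
min(1, (ε/δ)^(1-s)))`: it tends to zero with `ε` and never exceeds a multiple of `δ^(-s)`.

Consequently the truncated operators on `d^s` converge pointwise in the collar to a bounded function
`F`, with the `ε`-uniform bound `C + C d^(-s)` (`exists_operator_limit`). Antisymmetry turns the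
truncated double integral against a test function `φ` into `2 ∫ φ T_ε`. As `ε → 0`, the left side
converges because the full integrand is absolutely integrable (Young's inequality and `D_s d^s ∈
L¹(μ)`), the right side because `φ d^(-s)` is integrable, a Hardy inequality that comes from `φ = 0`
in the exterior balls. Hence `f = 2F`. -/

noncomputable section

/-! ### Elementary properties of `g` and `G` -/

namespace IsAdmissible

variable {g : ℝ → ℝ} {lam Lam : ℝ}

theorem nonneg (hg : IsAdmissible g lam Lam) {t : ℝ} (ht : 0 ≤ t) : 0 ≤ g t := by
  rcases ht.eq_or_lt with rfl | h
  · exact hg.zero.ge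
  · exact (hg.pos t h).le

theorem mono (hg : IsAdmissible g lam Lam) : Monotone g := by
  have h0 : ∀ a b, 0 ≤ a → a ≤ b → g a ≤ g b := by
    intro a b ha hab
    rcases ha.eq_or_lt with rfl | h
    · rw [hg.zero]; exact hg.nonneg hab
    · exact hg.monotone h (h.trans_le hab) hab
  intro a b hab
  rcases le_total 0 a with ha | ha
  · exact h0 a b ha hab
  · rcases le_total 0 b with hb | hb
    · have h1 := hg.nonneg (neg_nonneg.2 ha)
      rw [hg.odd] at h1
      linarith [hg.nonneg hb]
    · have h1 := h0 (-b) (-a) (by linarith) (by linarith)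
      rw [hg.odd, hg.odd] at h1
      linarith

theorem continuous (hg : IsAdmissible g lam Lam) : Continuous g := by
  have hpos : ∀ t, 0 < t → ContinuousAt g t := fun t ht =>
    (hg.convex.continuousOn isOpen_Ioi).continuousAt (Ioi_mem_nhds ht)
  rw [continuous_iff_continuousAt]
  intro t
  rcases lt_trichotomy t 0 with h | h | h
  · have h1 : ContinuousAt (fun x => -g (-x)) t :=
      (ContinuousAt.comp (f := fun x : ℝ => -x) (hpos (-t) (by linarith))
        continuousAt_neg).neg
    refine h1.congr (Eventually.of_forall fun x => ?_)
    simp [hg.odd]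
  · subst h
    have hr := hg.rightContinuous 0 le_rfl
    have hl : ContinuousWithinAt g (Iic 0) 0 := by
      have h1 : ContinuousWithinAt (fun x => -g (-x)) (Iic 0) 0 := by
        refine (ContinuousWithinAt.comp (f := fun x : ℝ => -x) (t := Ici 0) (by simpa using hr)
          continuousWithinAt_neg ?_).neg
        intro x hx
        simpa using hx
      refine h1.congr (fun x _ => ?_) ?_ <;> simp [hg.odd, hg.zero]
    have := hl.union hr
    rwa [Iic_union_Ici, continuousWithinAt_univ] at this
  · exact hpos t h

theorem abs_le (hg : IsAdmissible g lam Lam) {a : ℝ} (ha : |a| ≤ 1) : |g a| ≤ g 1 := by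
  rw [_root_.abs_le] at ha ⊢
  refine ⟨?_, hg.mono ha.2⟩
  rw [← hg.odd]
  exact hg.mono ha.1

/-- Slopes of a convex function increase, so on `(0, 1]` they are at most the slope between 1 and 2.
Continuity adds the point 0 and oddness the negative half. -/
theorem exists_lipschitz (hg : IsAdmissible g lam Lam) :
    ∃ L : ℝ, 0 ≤ L ∧ ∀ a b, |a| ≤ 1 → |b| ≤ 1 → |g a - g b| ≤ L * |a - b| := by
  have hL : 0 ≤ g 2 - g 1 := by linarith [hg.mono (show (1 : ℝ) ≤ 2 by norm_num)]
  set L := g 2 - g 1 with hLdef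
  have h1 : ∀ a b, 0 < a → a ≤ b → b ≤ 1 → g b - g a ≤ L * (b - a) := by
    intro a b ha hab hb
    rcases hab.eq_or_lt with rfl | hab
    · simp
    have hb0 : 0 < b := ha.trans hab
    have s1 := hg.convex.slope_mono_adjacent (x := a) (y := b) (z := 2) ha
      (by norm_num : (0 : ℝ) < 2) hab (by linarith)
    have s2 : (g 2 - g b) / (2 - b) ≤ L := by
      rcases hb.eq_or_lt with rfl | hb'
      · rw [hLdef]; norm_num
      · have := hg.convex.secant_mono_aux3 (x := b) (y := 1) (z := 2) hb0
          (by norm_num : (0 : ℝ) < 2) hb' (by norm_num)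
        rw [hLdef]; norm_num at this ⊢; exact this
    have s3 := s1.trans s2
    rwa [div_le_iff₀ (by linarith)] at s3
  have h2 : ∀ a b, 0 ≤ a → a ≤ b → b ≤ 1 → g b - g a ≤ L * (b - a) := by
    intro a b ha hab hb
    rcases ha.eq_or_lt with rfl | ha
    · rcases hab.eq_or_lt with rfl | hab
      · simp
      have t1 : Tendsto (fun a => g b - g a) (𝓝[>] 0) (𝓝 (g b - g 0)) :=
        ((hg.continuous.tendsto 0).mono_left nhdsWithin_le_nhds).const_sub _
      have t2 : Tendsto (fun a : ℝ => L * (b - a)) (𝓝[>] 0) (𝓝 (L * (b - 0))) :=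
        ((tendsto_id.mono_left nhdsWithin_le_nhds).const_sub _).const_mul _
      refine le_of_tendsto_of_tendsto t1 t2 ?_
      filter_upwards [Ioo_mem_nhdsGT hab] with a ha using h1 a b ha.1 ha.2.le hb
    · exact h1 a b ha hab hb
  have h3 : ∀ a b, -1 ≤ a → a ≤ b → b ≤ 1 → g b - g a ≤ L * (b - a) := by
    intro a b ha hab hb
    rcases le_total 0 a with h | h
    · exact h2 a b h hab hb
    · rcases le_total 0 b with h' | h'
      · have e1 := h2 0 b le_rfl h' hb
        have e2 := h2 0 (-a) le_rfl (by linarith) (by linarith)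
        rw [hg.odd] at e2
        rw [hg.zero] at e1 e2
        nlinarith
      · have e2 := h2 (-b) (-a) (by linarith) (by linarith) (by linarith)
        rw [hg.odd, hg.odd] at e2
        linarith
  refine ⟨L, hL, fun a b ha hb => ?_⟩
  rw [_root_.abs_le] at ha hb
  rcases le_total a b with h | h
  · rw [abs_sub_comm, abs_of_nonneg (sub_nonneg.2 (hg.mono h)), abs_sub_comm,
      abs_of_nonneg (sub_nonneg.2 h)]
    exact h3 a b ha.1 h hb.2
  · rw [abs_of_nonneg (sub_nonneg.2 (hg.mono h)), abs_of_nonneg (sub_nonneg.2 h)]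
    exact h3 b a hb.1 h ha.2

end IsAdmissible

theorem youngG_abs (g : ℝ → ℝ) (t : ℝ) : youngG g |t| = youngG g t := by
  simp [youngG]

theorem youngG_zero (g : ℝ → ℝ) : youngG g 0 = 0 := by simp [youngG]

namespace IsAdmissible

variable {g : ℝ → ℝ} {lam Lam : ℝ}

/-- Convexity of `G` in tangent-line form, since `g` is its nondecreasing derivative. The
inequalities below for `G` follow by choosing the point of tangency. -/
theorem youngG_tangent (hg : IsAdmissible g lam Lam) {a b : ℝ} (ha : 0 ≤ a) (hb : 0 ≤ b) :
    youngG g a + g a * (b - a) ≤ youngG g b := by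
  have hi : ∀ x y, IntervalIntegrable g volume x y := fun x y => hg.continuous.intervalIntegrable x y
  rw [youngG, youngG, abs_of_nonneg ha, abs_of_nonneg hb,
    ← intervalIntegral.integral_add_adjacent_intervals (hi 0 a) (hi a b)]
  refine add_le_add_right ?_ _
  rcases le_total a b with h | h
  · have := intervalIntegral.integral_mono_on (f := fun _ => g a) h (by simp) (hi a b)
      (fun x hx => hg.mono hx.1)
    simpa [mul_comm] using this
  · rw [intervalIntegral.integral_symm]
    have := intervalIntegral.integral_mono_on (g := fun _ => g a) h (hi b a) (by simp)
      (fun x hx => hg.mono hx.2)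
    simp only [intervalIntegral.integral_const, smul_eq_mul] at this
    linarith

theorem youngG_nonneg (hg : IsAdmissible g lam Lam) (t : ℝ) : 0 ≤ youngG g t := by
  rw [← youngG_abs]
  simpa [youngG_zero, hg.zero] using hg.youngG_tangent le_rfl (abs_nonneg t)

theorem youngG_continuous (hg : IsAdmissible g lam Lam) : Continuous (youngG g) := by
  have : Continuous fun t => ∫ τ in (0 : ℝ)..t, g τ :=
    intervalIntegral.continuous_primitive (fun a b => hg.continuous.intervalIntegrable a b) 0
  exact this.comp continuous_abs

theorem youngG_mono (hg : IsAdmissible g lam Lam) {a b : ℝ} (h : |a| ≤ |b|) :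
    youngG g a ≤ youngG g b := by
  rw [← youngG_abs g a, ← youngG_abs g b]
  have := hg.youngG_tangent (abs_nonneg a) (abs_nonneg b)
  nlinarith [hg.nonneg (abs_nonneg a)]

theorem youngG_le_mul (hg : IsAdmissible g lam Lam) {a : ℝ} (ha : |a| ≤ 1) :
    youngG g a ≤ g 1 * |a| := by
  rw [← youngG_abs]
  have := hg.youngG_tangent (abs_nonneg a) le_rfl
  rw [youngG_zero] at this
  nlinarith [hg.mono ha, abs_nonneg a]

/-- Tangent at 1. This is what places `L^G` inside `L¹` on sets of finite measure. -/
theorem le_one_add_youngG (hg : IsAdmissible g lam Lam) (t : ℝ) :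
    |t| ≤ 1 + youngG g t / g 1 := by
  have h1 := hg.pos 1 one_pos
  have := hg.youngG_tangent (zero_le_one) (abs_nonneg t)
  rw [youngG_abs] at this
  have h2 : g 1 * (|t| - 1) ≤ youngG g t := by linarith [hg.youngG_nonneg 1]
  have h3 : |t| - 1 ≤ youngG g t / g 1 := by
    rw [le_div_iff₀ h1]; linarith
  linarith

/-- Tangent at `|a|`. No conjugate function is needed: because `|a| ≤ 1`, the remaining term `a
g(a)` is at most linear in `|a|`. -/
theorem young_inequality (hg : IsAdmissible g lam Lam) {a b : ℝ} (ha : |a| ≤ 1) :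
    |g a * b| ≤ youngG g b + g 1 * |a| := by
  have h := hg.youngG_tangent (abs_nonneg a) (abs_nonneg b)
  rw [youngG_abs, youngG_abs] at h
  have h1 : |g a| = g |a| := by
    rcases le_total 0 a with h0 | h0
    · rw [abs_of_nonneg h0, abs_of_nonneg (hg.nonneg h0)]
    · rw [abs_of_nonpos h0, hg.odd, abs_of_nonpos]
      simpa [hg.zero] using hg.mono h0
  rw [abs_mul, h1]
  nlinarith [hg.youngG_nonneg a, hg.mono ha, abs_nonneg a]

/-- Convexity together with `G(0) = 0`. Dividing by one plus the modular therefore brings the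
modular below 1, which gives a finite Luxemburg norm. -/
theorem youngG_div_le (hg : IsAdmissible g lam Lam) {c : ℝ} (hc : 1 ≤ c) (t : ℝ) :
    youngG g (t / c) ≤ youngG g t / c := by
  have hc0 : 0 < c := by linarith
  rw [← youngG_abs g (t / c), ← youngG_abs g t]
  set a := |t / c| with ha
  have hta : |t| = c * a := by
    rw [ha, abs_div, abs_of_pos hc0]; field_simp
  have ha0 : 0 ≤ a := abs_nonneg _
  rw [hta, le_div_iff₀ hc0]
  have h1 := hg.youngG_tangent ha0 (by positivity : 0 ≤ c * a)
  have h2 := hg.youngG_tangent ha0 le_rfl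
  rw [youngG_zero] at h2
  nlinarith

end IsAdmissible

theorem luxemburg_lt_top {α : Type*} [MeasurableSpace α] {g : ℝ → ℝ} {lam Lam : ℝ}
    (hg : IsAdmissible g lam Lam) {ν : Measure α} {v : α → ℝ} (h : modular g ν v < ⊤) :
    luxemburg g ν v < ⊤ := by
  set M := (modular g ν v).toReal with hM
  have hc : 1 ≤ 1 + M := by simp [hM]
  have hc0 : 0 < 1 + M := by linarith
  have key : modular g ν (fun a => v a / (1 + M)) ≤ 1 := by
    calc modular g ν (fun a => v a / (1 + M))
        ≤ ∫⁻ a, ENNReal.ofReal (1 / (1 + M)) * ENNReal.ofReal (youngG g (v a)) ∂ν := by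
          refine lintegral_mono fun a => ?_
          rw [← ENNReal.ofReal_mul (by positivity)]
          refine ENNReal.ofReal_le_ofReal ((hg.youngG_div_le hc _).trans (le_of_eq (by ring)))
      _ = ENNReal.ofReal (1 / (1 + M)) * modular g ν v := by
          rw [lintegral_const_mul' _ _ ENNReal.ofReal_ne_top]; rfl
      _ = ENNReal.ofReal (1 / (1 + M) * M) := by
          rw [← ENNReal.ofReal_toReal h.ne, ← hM, ENNReal.ofReal_mul (by positivity)]
      _ ≤ 1 := by
          rw [ENNReal.ofReal_le_one, div_mul_eq_mul_div, one_mul, div_le_one hc0]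
          linarith
  refine lt_of_le_of_lt ?_ (ENNReal.ofReal_lt_top (r := 1 + M))
  exact iInf_le_of_le (1 + M) (iInf_le_of_le hc0 (iInf_le_of_le key le_rfl))

/-! ### Geometry of `C^{1,1}` domains -/

theorem abs_sub_sub_fderiv_le {E : Type*} [NormedAddCommGroup E] [NormedSpace ℝ E] {γ : E → ℝ}
    {K : ℝ≥0} (hγ : ContDiff ℝ 1 γ) (hK : LipschitzWith K (fderiv ℝ γ)) (x y : E) :
    |γ y - γ x - fderiv ℝ γ x (y - x)| ≤ K * ‖y - x‖ ^ 2 := by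
  have h := (convex_closedBall x ‖y - x‖).norm_image_sub_le_of_norm_hasFDerivWithin_le'
    (f := γ) (f' := fderiv ℝ γ) (φ := fderiv ℝ γ x) (C := K * ‖y - x‖) (x := x) (y := y)
    (fun z _ => (hγ.differentiable one_ne_zero z).hasFDerivAt.hasFDerivWithinAt)
    (fun z hz => by
      have h1 := hK.dist_le_mul z x
      rw [dist_eq_norm] at h1
      exact h1.trans (mul_le_mul_of_nonneg_left (Metric.mem_closedBall.1 hz) K.2))
    (Metric.mem_closedBall_self (norm_nonneg _)) (by simp [dist_eq_norm])
  rw [Real.norm_eq_abs] at h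
  linarith [h, sq (‖y - x‖)]

/-- A local defining function of a `C^{1,1}` domain that increases with unit speed in the direction
`e`. -/
theorem HasC11Boundary.exists_defining {n : ℕ} {Ω : Set (Eucl n)} (hC : HasC11Boundary Ω)
    {x₀ : Eucl n} (hx₀ : x₀ ∈ frontier Ω) :
    ∃ (e : Eucl n) (r K : ℝ) (Φ : Eucl n → ℝ), ‖e‖ = 1 ∧ 0 < r ∧ 0 ≤ K ∧ ContDiff ℝ 1 Φ ∧
      (∀ x, ∃ w : Eucl n, inner ℝ w e = 1 ∧
        ∀ y, |Φ y - Φ x - inner ℝ w (y - x)| ≤ K * ‖y - x‖ ^ 2) ∧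
      (∀ x t, Φ (x + t • e) = Φ x + t) ∧
      ∀ x ∈ Metric.ball x₀ r, x ∈ Ω ↔ 0 < Φ x := by
  obtain ⟨e, r, γ, K, he, hr, hγ, hK, hΩ⟩ := hC x₀ hx₀
  have hee : inner ℝ e e = (1 : ℝ) := by rw [real_inner_self_eq_norm_sq, he, one_pow]
  let P : Eucl n →L[ℝ] Eucl n :=
    ContinuousLinearMap.id ℝ _ - (innerSL ℝ e).smulRight e
  have hP : ∀ x, P x = x - (inner ℝ e x : ℝ) • e := fun x => by simp [P]
  have hPe : P e = 0 := by rw [hP, hee]; simp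
  have hPn : ∀ x, ‖P x‖ ≤ ‖x‖ := by
    intro x
    have : ‖P x‖ ^ 2 ≤ ‖x‖ ^ 2 := by
      rw [hP, norm_sub_sq_real, inner_smul_right, norm_smul, he, real_inner_comm,
        Real.norm_eq_abs, mul_one, sq_abs]
      nlinarith [sq_nonneg (inner ℝ e x : ℝ)]
    exact le_of_sq_le_sq this (norm_nonneg _)
  refine ⟨e, r, K, fun x => inner ℝ e x - γ (P x), he, hr, K.2, ?_, ?_, ?_, ?_⟩
  · exact (contDiff_const.inner ℝ contDiff_id).sub (hγ.comp P.contDiff)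
  · intro x
    let N : Eucl n →L[ℝ] ℝ := innerSL ℝ e - (fderiv ℝ γ (P x)).comp P
    have hN : ∀ v, N v = inner ℝ e v - fderiv ℝ γ (P x) (P v) := fun v => by simp [N]
    -- The vector `w` is the gradient of the defining function; its component along `e` is 1 because
    -- `P e = 0`.
    refine ⟨(InnerProductSpace.toDual ℝ _).symm N, ?_, fun y => ?_⟩
    · rw [InnerProductSpace.toDual_symm_apply, hN, hPe, hee]; simp
    · rw [InnerProductSpace.toDual_symm_apply, hN]
      have h := abs_sub_sub_fderiv_le hγ hK (P x) (P y)
      rw [← map_sub] at h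
      have h2 : ‖P (y - x)‖ ^ 2 ≤ ‖y - x‖ ^ 2 := pow_le_pow_left₀ (norm_nonneg _) (hPn _) 2
      have h3 : inner ℝ e y - γ (P y) - (inner ℝ e x - γ (P x))
          - (inner ℝ e (y - x) - fderiv ℝ γ (P x) (P (y - x)))
          = -(γ (P y) - γ (P x) - fderiv ℝ γ (P x) (P (y - x))) := by
        rw [inner_sub_right]; ring
      rw [h3, abs_neg]
      exact h.trans (mul_le_mul_of_nonneg_left h2 K.2)
  · intro x t
    simp only [map_add, map_smul, hPe, smul_zero, add_zero, inner_add_right, inner_smul_right, hee,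
      mul_one]
    ring
  · intro x hx
    rw [hΩ x hx, ← hP, ← sub_pos]

/-- A negative value would persist in a neighbourhood, which would then contain no point of `Ω`; a
positive one would put the point in the open set `Ω`. -/
theorem eq_zero_of_mem_frontier {n : ℕ} {Ω : Set (Eucl n)} (hΩ : IsOpen Ω) {x₀ x : Eucl n} {r : ℝ}
    {Φ : Eucl n → ℝ} (hΦ : Continuous Φ) (h : ∀ x ∈ Metric.ball x₀ r, x ∈ Ω ↔ 0 < Φ x)
    (hx : x ∈ frontier Ω) (hxr : x ∈ Metric.ball x₀ r) : Φ x = 0 := by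
  have h1 : ¬ 0 < Φ x := by
    rw [← h x hxr]
    intro hx'
    exact hx.2 (hΩ.interior_eq.symm ▸ hx')
  refine le_antisymm (not_lt.1 h1) (not_lt.1 fun h2 => ?_)
  have hU : Metric.ball x₀ r ∩ {y | Φ y < 0} ∈ 𝓝 x :=
    inter_mem (Metric.isOpen_ball.mem_nhds hxr) ((isOpen_lt hΦ continuous_const).mem_nhds h2)
  obtain ⟨y, ⟨hy1, hy2⟩, hy3⟩ := mem_closure_iff_nhds.1 hx.1 _ hU
  have := (h y hy1).1 hy3
  exact lt_asymm this hy2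

/-- The uniform interior and exterior ball condition. -/
theorem HasC11Boundary.exists_balls {n : ℕ} {Ω : Set (Eucl n)} (hΩ : IsOpen Ω)
    (hbdd : Bornology.IsBounded Ω) (hC : HasC11Boundary Ω) :
    ∃ R : ℝ, 0 < R ∧ ∀ x ∈ frontier Ω, ∃ ν : Eucl n, ‖ν‖ = 1 ∧
      Metric.ball (x + R • ν) R ⊆ Ω ∧ Metric.ball (x - R • ν) R ⊆ Ωᶜ := by
  have hcomp : IsCompact (frontier Ω) :=
    Metric.isCompact_of_isClosed_isBounded isClosed_frontier
      (hbdd.closure.subset frontier_subset_closure)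
  -- Asking for all radii up to `R₀` makes the property stable under finite unions, as the
  -- compactness argument requires.
  suffices h : ∃ R₀ : ℝ, 0 < R₀ ∧ ∀ x ∈ frontier Ω, ∃ ν : Eucl n, ‖ν‖ = 1 ∧ ∀ R, 0 < R → R ≤ R₀ →
      Metric.ball (x + R • ν) R ⊆ Ω ∧ Metric.ball (x - R • ν) R ⊆ Ωᶜ by
    obtain ⟨R, hR, h⟩ := h
    refine ⟨R, hR, fun x hx => ?_⟩
    obtain ⟨ν, h1, h2⟩ := h x hx
    exact ⟨ν, h1, h2 R hR le_rfl⟩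
  refine hcomp.induction_on (p := fun S => ∃ R₀ : ℝ, 0 < R₀ ∧ ∀ x ∈ S, ∃ ν : Eucl n, ‖ν‖ = 1 ∧
    ∀ R, 0 < R → R ≤ R₀ → Metric.ball (x + R • ν) R ⊆ Ω ∧ Metric.ball (x - R • ν) R ⊆ Ωᶜ)
    ⟨1, one_pos, by simp⟩ ?_ ?_ ?_
  · rintro S T hST ⟨R, hR, h⟩
    exact ⟨R, hR, fun x hx => h x (hST hx)⟩
  · rintro S T ⟨R, hR, h⟩ ⟨R', hR', h'⟩
    refine ⟨min R R', lt_min hR hR', ?_⟩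
    rintro x (hx | hx)
    · obtain ⟨ν, h1, h2⟩ := h x hx
      exact ⟨ν, h1, fun ρ h3 h4 => h2 ρ h3 (h4.trans (min_le_left _ _))⟩
    · obtain ⟨ν, h1, h2⟩ := h' x hx
      exact ⟨ν, h1, fun ρ h3 h4 => h2 ρ h3 (h4.trans (min_le_right _ _))⟩
  · intro x₀ hx₀
    obtain ⟨e, r, K, Φ, he, hr, hK, hΦ, hT, -, hloc⟩ := hC.exists_defining hx₀
    refine ⟨frontier Ω ∩ Metric.ball x₀ (r / 2),
      inter_mem self_mem_nhdsWithin (mem_nhdsWithin_of_mem_nhds (Metric.ball_mem_nhds _ (by positivity))),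
      -- The first bound makes the quadratic remainder `K ‖z‖²` smaller than the linear term on the
      -- tangent balls; the second keeps these balls inside the chart, as their points are within
      -- `2R ≤ r/2` of `x`.
      min (1 / (2 * K + 1)) (r / 4), by positivity, ?_⟩
    rintro x ⟨hx, hxr⟩
    have hxr' : x ∈ Metric.ball x₀ r := Metric.ball_subset_ball (by linarith) hxr
    have hΦx := eq_zero_of_mem_frontier hΩ hΦ.continuous hloc hx hxr'
    obtain ⟨w, hw, hTw⟩ := hT x
    have hw1 : 1 ≤ ‖w‖ := by
      have := real_inner_le_norm w e
      rw [hw, he, mul_one] at this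
      exact this
    have hw0 : 0 < ‖w‖ := by linarith
    have hν : ‖(1 / ‖w‖) • w‖ = 1 := by
      rw [norm_smul, Real.norm_of_nonneg (by positivity)]; field_simp
    refine ⟨(1 / ‖w‖) • w, hν, fun R hR hR' => ?_⟩
    have hR1 : R * (2 * K + 1) ≤ 1 := by
      have := hR'.trans (min_le_left _ _)
      rwa [le_div_iff₀ (by positivity)] at this
    have hR2 : R ≤ r / 4 := hR'.trans (min_le_right _ _)
    -- The sign `σ` treats the interior and the exterior ball together.
    have key : ∀ σ : ℝ, (σ = 1 ∨ σ = -1) → ∀ y, dist y (x + (σ * R) • ((1 / ‖w‖) • w)) < R →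
        y ∈ Metric.ball x₀ r ∧ 0 < σ * Φ y := by
      intro σ hσ y hy
      set z := y - x with hz
      have hσ2 : σ ^ 2 = 1 := by rcases hσ with rfl | rfl <;> norm_num
      have hσa : |σ| = 1 := by rcases hσ with rfl | rfl <;> norm_num
      have h1 : ‖z - (σ * R) • ((1 / ‖w‖) • w)‖ < R := by
        rw [dist_eq_norm] at hy
        rwa [hz, sub_sub]
      have h2 : ‖z‖ < 2 * R := by
        calc ‖z‖ ≤ ‖z - (σ * R) • ((1 / ‖w‖) • w)‖ + ‖(σ * R) • ((1 / ‖w‖) • w)‖ :=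
              norm_le_norm_sub_add _ _
          _ < R + R := by
              refine add_lt_add_of_lt_of_le h1 ?_
              rw [norm_smul, hν, Real.norm_eq_abs, abs_mul, hσa, abs_of_pos hR]; linarith
          _ = 2 * R := by ring
      refine ⟨?_, ?_⟩
      · have : dist y x₀ ≤ dist y x + dist x x₀ := dist_triangle _ _ _
        rw [Metric.mem_ball] at hxr ⊢
        rw [dist_eq_norm y x] at this
        linarith
      -- Expanding `‖z - σRν‖² < R²` shows that `‖z‖²` is less than `2R` times the signed normal
      -- component of `z`.
      · have h3 : ‖z‖ ^ 2 < 2 * R * (σ * (1 / ‖w‖ * inner ℝ w z)) := by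
          have h4 := pow_lt_pow_left₀ h1 (norm_nonneg _) two_ne_zero
          rw [norm_sub_sq_real, norm_smul, hν, inner_smul_right, inner_smul_right,
            real_inner_comm, Real.norm_eq_abs, abs_mul, hσa, abs_of_pos hR] at h4
          nlinarith
        have h5 := hTw y
        rw [hΦx, sub_zero, ← hz, abs_le] at h5
        set I : ℝ := inner ℝ w z with hI
        have h6 : ‖w‖ * ‖z‖ ^ 2 < 2 * R * (σ * I) := by
          have := mul_lt_mul_of_pos_left h3 hw0
          calc ‖w‖ * ‖z‖ ^ 2 < _ := this
            _ = 2 * R * (σ * I) := by field_simp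
        have h7 : ‖z‖ ^ 2 ≤ ‖w‖ * ‖z‖ ^ 2 := le_mul_of_one_le_left (sq_nonneg _) hw1
        have h8 : K * ‖z‖ ^ 2 < σ * I := by
          have : 0 < 2 * R * (σ * I - K * ‖z‖ ^ 2) := by
            nlinarith [sq_nonneg ‖z‖]
          have := pos_of_mul_pos_right this (by positivity)
          linarith
        rcases hσ with rfl | rfl <;> linarith
    refine ⟨fun y hy => ?_, fun y hy => ?_⟩
    · have := key 1 (Or.inl rfl) y (by simpa using hy)
      exact (hloc y this.1).2 (by linarith [this.2])
    · have := key (-1) (Or.inr rfl) y (by simpa [sub_eq_add_neg] using hy)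
      intro hy'
      linarith [this.2, (hloc y this.1).1 hy']

theorem compl_nonempty_of_isBounded {n : ℕ} (hn : 1 ≤ n) {Ω : Set (Eucl n)}
    (hbdd : Bornology.IsBounded Ω) : Ωᶜ.Nonempty := by
  have : Nonempty (Fin n) := ⟨⟨0, hn⟩⟩
  rw [nonempty_compl]
  rintro rfl
  exact NormedSpace.unbounded_univ ℝ (Eucl n) hbdd

theorem distCompl_nonneg {n : ℕ} (Ω : Set (Eucl n)) (x : Eucl n) : 0 ≤ distCompl Ω x :=
  Metric.infDist_nonneg

theorem distCompl_pos {n : ℕ} (hn : 1 ≤ n) {Ω : Set (Eucl n)} (hΩ : IsOpen Ω)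
    (hbdd : Bornology.IsBounded Ω) {x : Eucl n} (hx : x ∈ Ω) : 0 < distCompl Ω x := by
  refine lt_of_le_of_ne (distCompl_nonneg _ _) fun h => ?_
  have := (hΩ.isClosed_compl.mem_iff_infDist_zero (compl_nonempty_of_isBounded hn hbdd)).2 h.symm
  exact this hx

theorem distCompl_eq_zero {n : ℕ} {Ω : Set (Eucl n)} {x : Eucl n} (hx : x ∉ Ω) :
    distCompl Ω x = 0 := Metric.infDist_zero_of_mem hx

/-- The tangent balls at the projection `x - d(x) ν` of a point `x ∈ Ω`. -/
theorem exists_normal {n : ℕ} (hn : 1 ≤ n) {Ω : Set (Eucl n)} (hΩ : IsOpen Ω)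
    (hbdd : Bornology.IsBounded Ω) {R : ℝ} (hR : 0 < R)
    (hballs : ∀ x ∈ frontier Ω, ∃ ν : Eucl n, ‖ν‖ = 1 ∧
      Metric.ball (x + R • ν) R ⊆ Ω ∧ Metric.ball (x - R • ν) R ⊆ Ωᶜ)
    {x : Eucl n} (hx : x ∈ Ω) :
    ∃ ν : Eucl n, ‖ν‖ = 1 ∧ Metric.ball (x + (R - distCompl Ω x) • ν) R ⊆ Ω ∧
      Metric.ball (x - (R + distCompl Ω x) • ν) R ⊆ Ωᶜ := by
  obtain ⟨p, hp, hpd⟩ := hΩ.isClosed_compl.exists_infDist_eq_dist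
    (compl_nonempty_of_isBounded hn hbdd) x
  set δ := distCompl Ω x with hδdef
  have hδ : 0 < δ := distCompl_pos hn hΩ hbdd hx
  have hpδ : dist x p = δ := hpd.symm
  have hball : Metric.ball x δ ⊆ Ω := by
    intro y hy
    by_contra hy'
    have : δ ≤ dist x y := Metric.infDist_le_dist_of_mem hy'
    rw [Metric.mem_ball, dist_comm] at hy
    linarith
  have hpf : p ∈ frontier Ω := by
    refine ⟨?_, ?_⟩
    · have h1 : p ∈ closure (Metric.ball x δ) := by
        rw [closure_ball _ hδ.ne', Metric.mem_closedBall, dist_comm, hpδ]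
      exact closure_mono hball h1
    · rw [hΩ.interior_eq]; exact hp
  obtain ⟨ν, hν, h1, h2⟩ := hballs p hpf
  have hdisj : Disjoint (Metric.ball x δ) (Metric.ball (p - R • ν) R) :=
    disjoint_left.2 fun y hy hy' => h2 hy' (hball hy)
  -- The ball about `x` inside `Ω` and the exterior ball at `p` are disjoint, so their centres are
  -- at least the sum of the radii apart. As `‖x - p‖ = δ`, this is the equality case of the
  -- triangle inequality and forces `x - p = δ ν`.
  have hdist : δ + R ≤ dist x (p - R • ν) := by
    by_contra! hlt
    have hne := (disjoint_ball_ball_iff hδ hR).1 hdisj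
    linarith
  set v := x - p with hv
  have hvn : ‖v‖ = δ := by rw [hv, ← dist_eq_norm, hpδ]
  have h3 : (δ + R) ^ 2 ≤ ‖v + R • ν‖ ^ 2 := by
    refine pow_le_pow_left₀ (by positivity) ?_ 2
    rw [dist_eq_norm] at hdist
    rwa [hv, sub_add]
  rw [norm_add_sq_real, hvn, norm_smul, hν, inner_smul_right, Real.norm_of_nonneg hR.le] at h3
  have h4 : δ ≤ inner ℝ v ν := by
    have : 0 ≤ 2 * R * (inner ℝ v ν - δ) := by nlinarith
    have := nonneg_of_mul_nonneg_right this (by positivity)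
    linarith
  have h5 : ‖v - δ • ν‖ ^ 2 ≤ 0 := by
    rw [norm_sub_sq_real, hvn, norm_smul, hν, inner_smul_right, Real.norm_of_nonneg hδ.le]
    nlinarith
  have h6 : v = δ • ν := by
    rw [← sub_eq_zero, ← norm_eq_zero]
    nlinarith [norm_nonneg (v - δ • ν)]
  have hpx : p = x - δ • ν := by rw [← h6, hv]; abel
  refine ⟨ν, hν, ?_, ?_⟩
  · convert h1 using 2
    rw [hpx, sub_smul]; abel
  · convert h2 using 2
    rw [hpx, add_smul]; abel

theorem sqrt_add_le_add_div {a X : ℝ} (ha : 0 < a) (hX : 0 ≤ a ^ 2 + X) :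
    Real.sqrt (a ^ 2 + X) ≤ a + X / (2 * a) := by
  have h : a + X / (2 * a) = (2 * a ^ 2 + X) / (2 * a) := by field_simp
  refine Real.sqrt_le_iff.2 ⟨?_, ?_⟩
  · rw [h]; apply div_nonneg <;> nlinarith
  · have : (a + X / (2 * a)) ^ 2 = a ^ 2 + X + (X / (2 * a)) ^ 2 := by field_simp; ring
    rw [this]; nlinarith [sq_nonneg (X / (2 * a))]

theorem norm_sub_smul_le {n : ℕ} {ν z : Eucl n} (hν : ‖ν‖ = 1) {a : ℝ} (ha : 0 < a) :
    ‖z - a • ν‖ ≤ a - inner ℝ ν z + ‖z‖ ^ 2 / (2 * a) := by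
  have h : ‖z - a • ν‖ ^ 2 = a ^ 2 + (‖z‖ ^ 2 - 2 * a * inner ℝ ν z) := by
    rw [norm_sub_sq_real, norm_smul, hν, inner_smul_right, real_inner_comm,
      Real.norm_of_nonneg ha.le]; ring
  have h1 := sqrt_add_le_add_div (X := ‖z‖ ^ 2 - 2 * a * inner ℝ ν z) ha (h ▸ sq_nonneg _)
  rw [← h, Real.sqrt_sq (norm_nonneg _)] at h1
  refine h1.trans (le_of_eq ?_)
  field_simp
  ring

/-- Two-sided comparison of the distance function with its first order expansion. -/
theorem distCompl_expansion {n : ℕ} (hn : 1 ≤ n) {Ω : Set (Eucl n)}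
    (hbdd : Bornology.IsBounded Ω) {R : ℝ} {x ν : Eucl n} (hν : ‖ν‖ = 1)
    (hδ : 0 < distCompl Ω x) (hδR : distCompl Ω x ≤ R / 2)
    (h1 : Metric.ball (x + (R - distCompl Ω x) • ν) R ⊆ Ω)
    (h2 : Metric.ball (x - (R + distCompl Ω x) • ν) R ⊆ Ωᶜ) (z : Eucl n) :
    distCompl Ω x + inner ℝ ν z - ‖z‖ ^ 2 / R ≤ distCompl Ω (x + z) ∧
      distCompl Ω (x + z) ≤ max 0 (distCompl Ω x + inner ℝ ν z + ‖z‖ ^ 2 / R) := by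
  set δ := distCompl Ω x
  have hR : 0 < R := by linarith
  constructor
  · have ha : 0 < R - δ := by linarith
    -- The complement lies outside the interior ball, so `d(x + z)` is at least the radius minus the
    -- distance to its centre.
    have h3 : R - ‖z - (R - δ) • ν‖ ≤ distCompl Ω (x + z) := by
      refine (Metric.le_infDist (compl_nonempty_of_isBounded hn hbdd)).2 fun w hw => ?_
      have h4 : R ≤ dist w (x + (R - δ) • ν) := by
        by_contra! h
        exact hw (h1 h)
      have h5 := dist_triangle w (x + z) (x + (R - δ) • ν)
      rw [dist_add_left, dist_comm w (x + z), dist_eq_norm z] at h5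
      linarith
    have h4 := norm_sub_smul_le (z := z) hν ha
    -- Here `δ ≤ R / 2` enters, giving `2(R - δ) ≥ R`.
    have h5 : ‖z‖ ^ 2 / (2 * (R - δ)) ≤ ‖z‖ ^ 2 / R := by
      apply div_le_div_of_nonneg_left (by positivity) hR; linarith
    linarith
  · have hb : 0 < R + δ := by linarith
    set c := x - (R + δ) • ν with hc
    have hcl : Metric.closedBall c R ⊆ closure Ωᶜ := by
      rw [← closure_ball c hR.ne']
      exact closure_mono h2
    by_cases hin : x + z ∈ Metric.closedBall c R
    · refine le_max_of_le_left ?_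
      have := Metric.infDist_zero_of_mem (hcl hin)
      rw [Metric.infDist_closure] at this
      exact this.le
    · refine le_max_of_le_right ?_
      rw [Metric.mem_closedBall, not_le, dist_eq_norm] at hin
      set v := x + z - c with hv
      have hv0 : 0 < ‖v‖ := hR.trans hin
      -- The radial projection of `x + z` onto the exterior sphere is a competitor for the distance
      -- to the complement.
      have hm : c + (R / ‖v‖) • v ∈ closure Ωᶜ := by
        apply hcl
        rw [Metric.mem_closedBall, dist_eq_norm, add_sub_cancel_left, norm_smul,
          Real.norm_of_nonneg (by positivity)]
        field_simp; exact le_rfl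
      have h3 := Metric.infDist_le_dist_of_mem (x := x + z) hm
      rw [Metric.infDist_closure] at h3
      have h4 : dist (x + z) (c + (R / ‖v‖) • v) = ‖v‖ - R := by
        have : x + z - (c + (R / ‖v‖) • v) = (1 - R / ‖v‖) • v := by
          rw [sub_smul, one_smul, hv]; abel
        rw [dist_eq_norm, this, norm_smul, Real.norm_of_nonneg, sub_mul, one_mul,
          div_mul_cancel₀ _ hv0.ne']
        rw [sub_nonneg, div_le_one hv0]; exact hin.le
      have h5 : ‖v‖ ≤ (R + δ) + inner ℝ ν z + ‖z‖ ^ 2 / (2 * (R + δ)) := by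
        have h6 := norm_sub_smul_le (ν := -ν) (z := z) (by simpa using hν) hb
        rw [inner_neg_left, smul_neg, sub_neg_eq_add, sub_neg_eq_add] at h6
        have h7 : v = z + (R + δ) • ν := by rw [hv, hc]; abel
        rwa [h7]
      have h6 : ‖z‖ ^ 2 / (2 * (R + δ)) ≤ ‖z‖ ^ 2 / R := by
        apply div_le_div_of_nonneg_left (by positivity) hR; linarith
      rw [h4] at h3
      change distCompl Ω (x + z) ≤ _ at h3
      linarith

/-! ### Elementary power inequalities and comparison with the half-space -/

/-- Writing `t^s = t · t^(s-1)` and using that `t^(s-1)` decreases gives a linear bound whose weight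
involves only `b`; `a` may even be zero. -/
theorem abs_rpow_sub_rpow_le {s a b : ℝ} (hs0 : 0 < s) (hs1 : s < 1) (ha : 0 ≤ a) (hb : 0 < b) :
    |a ^ s - b ^ s| ≤ |a - b| * b ^ (s - 1) := by
  have hbs : b ^ s = b * b ^ (s - 1) := by
    rw [← Real.rpow_one_add' hb.le (by linarith)]; congr 1; ring
  rcases le_total a b with h | h
  · have h1 : a ^ s ≤ b ^ s := Real.rpow_le_rpow ha h hs0.le
    rw [abs_of_nonpos (by linarith), abs_of_nonpos (by linarith)]
    have h2 : a * b ^ (s - 1) ≤ a ^ s := by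
      rcases ha.eq_or_lt with rfl | ha
      · simp [Real.zero_rpow hs0.ne']
      · have : a ^ s = a * a ^ (s - 1) := by
          rw [← Real.rpow_one_add' ha.le (by linarith)]; congr 1; ring
        rw [this]
        exact mul_le_mul_of_nonneg_left (Real.rpow_le_rpow_of_nonpos ha h (by linarith)) ha.le
    rw [hbs]; linarith
  · have h1 : b ^ s ≤ a ^ s := Real.rpow_le_rpow hb.le h hs0.le
    have ha' : 0 < a := hb.trans_le h
    rw [abs_of_nonneg (by linarith), abs_of_nonneg (by linarith)]
    have h2 : a ^ s ≤ a * b ^ (s - 1) := by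
      have : a ^ s = a * a ^ (s - 1) := by
        rw [← Real.rpow_one_add' ha (by linarith)]; congr 1; ring
      rw [this]
      exact mul_le_mul_of_nonneg_left (Real.rpow_le_rpow_of_nonpos hb h (by linarith)) ha'.le
    rw [hbs]; linarith

theorem abs_rpow_sub_rpow_le_rpow {s a b : ℝ} (hs0 : 0 < s) (hs1 : s < 1) (ha : 0 ≤ a)
    (hb : 0 ≤ b) : |a ^ s - b ^ s| ≤ |a - b| ^ s := by
  wlog h : a ≤ b generalizing a b
  · rw [abs_sub_comm, abs_sub_comm a b]
    exact this hb ha (le_of_not_ge h)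
  have h1 : a ^ s ≤ b ^ s := Real.rpow_le_rpow ha h hs0.le
  have h2 := Real.rpow_add_le_add_rpow (sub_nonneg.2 h) ha hs0.le hs1.le
  rw [sub_add_cancel] at h2
  rw [abs_of_nonpos (by linarith), abs_of_nonpos (by linarith), neg_sub, neg_sub]
  linarith

/-- Comparison of `d^s` with the solution `ℓ₊^s` in the tangent half-space. -/
theorem abs_distCompl_rpow_sub_le {n : ℕ} (hn : 1 ≤ n) {Ω : Set (Eucl n)}
    (hbdd : Bornology.IsBounded Ω) {R : ℝ} {x ν : Eucl n} (hν : ‖ν‖ = 1)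
    (hδ : 0 < distCompl Ω x) (hδR : distCompl Ω x ≤ R / 2)
    (h1 : Metric.ball (x + (R - distCompl Ω x) • ν) R ⊆ Ω)
    (h2 : Metric.ball (x - (R + distCompl Ω x) • ν) R ⊆ Ωᶜ) {s : ℝ} (hs0 : 0 < s) (hs1 : s < 1)
    {z : Eucl n} (hz : distCompl Ω x + inner ℝ ν z ≠ 0) :
    |distCompl Ω (x + z) ^ s - max 0 (distCompl Ω x + inner ℝ ν z) ^ s|
      ≤ 1 / R * (‖z‖ ^ 2 * |distCompl Ω x + inner ℝ ν z| ^ (s - 1)) := by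
  obtain ⟨hl, hu⟩ := distCompl_expansion hn hbdd hν hδ hδR h1 h2 z
  have hR : 0 < R := by linarith
  set b := distCompl Ω x + inner ℝ ν z with hb
  have hd := distCompl_nonneg Ω (x + z)
  set a := distCompl Ω (x + z) with ha
  have hq : 0 ≤ ‖z‖ ^ 2 / R := by positivity
  have hgoal : 1 / R * (‖z‖ ^ 2 * |b| ^ (s - 1)) = ‖z‖ ^ 2 / R * |b| ^ (s - 1) := by ring
  rw [hgoal]
  -- On the negative side the model vanishes and `a + |b| ≤ ‖z‖² / R`; whether `a` or `|b|` is
  -- larger decides which power is estimated. The case `b = 0` is excluded because `0 ^ (s - 1)`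
  -- evaluates to 0 and the bound would be lost.
  rcases hz.lt_or_gt with hneg | hpos
  · rw [max_eq_left hneg.le, Real.zero_rpow hs0.ne', sub_zero, abs_of_nonneg (by positivity)]
    rcases hd.eq_or_lt with h0 | h0
    · rw [← h0, Real.zero_rpow hs0.ne']; positivity
    · have hab : a - b ≤ ‖z‖ ^ 2 / R := by
        rcases le_max_iff.1 hu with h | h <;> linarith
      refine le_trans ?_ (mul_le_mul_of_nonneg_right hab (by positivity))
      have hb' : 0 < -b := by linarith
      rw [abs_of_neg hneg]
      have e1 : a ^ s = a * a ^ (s - 1) := by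
        rw [← Real.rpow_one_add' h0.le (by linarith)]; congr 1; ring
      have e2 : (-b) ^ s = (-b) * (-b) ^ (s - 1) := by
        rw [← Real.rpow_one_add' hb'.le (by linarith)]; congr 1; ring
      rcases le_total a (-b) with h | h
      · have e3 : a ^ s ≤ (-b) ^ s := Real.rpow_le_rpow h0.le h hs0.le
        have : 0 ≤ a * (-b) ^ (s - 1) := by positivity
        rw [e2] at e3
        linarith
      · have e3 : a ^ (s - 1) ≤ (-b) ^ (s - 1) := Real.rpow_le_rpow_of_nonpos hb' h (by linarith)
        rw [e1]
        refine (mul_le_mul_of_nonneg_left e3 h0.le).trans ?_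
        exact mul_le_mul_of_nonneg_right (by linarith) (by positivity)
  · rw [max_eq_right hpos.le, abs_of_pos hpos]
    refine (abs_rpow_sub_rpow_le hs0 hs1 hd hpos).trans
      (mul_le_mul_of_nonneg_right ?_ (by positivity))
    rw [abs_le]
    constructor
    · linarith
    · rcases le_max_iff.1 hu with h | h <;> linarith

/-! ### The one-dimensional half-line solution -/

theorem abs_div_rpow_le_one {s τ b : ℝ} (hs0 : 0 < s) (hs1 : s < 1) (hτ : 0 < τ) (hb : 0 ≤ b)
    (h : |1 - b| ≤ τ) : |(1 - b ^ s) / τ ^ s| ≤ 1 := by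
  have h1 := abs_rpow_sub_rpow_le_rpow hs0 hs1 zero_le_one hb
  rw [Real.one_rpow] at h1
  rw [abs_div, abs_of_pos (Real.rpow_pos_of_pos hτ s), div_le_one (Real.rpow_pos_of_pos hτ s)]
  exact h1.trans (Real.rpow_le_rpow (abs_nonneg _) h hs0.le)

theorem abs_one_sub_max_le {τ : ℝ} (σ : ℝ) (hτ : |σ| ≤ τ) : |1 - max 0 (1 + σ)| ≤ τ := by
  rw [abs_le] at *
  rcases max_cases 0 (1 + σ) with ⟨h, h'⟩ | ⟨h, h'⟩ <;> rw [h] <;> constructor <;> linarith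

theorem abs_apply_le_of_odd {g : ℝ → ℝ} (hmono : Monotone g) (hodd : ∀ t, g (-t) = -g t) {a : ℝ}
    (ha : |a| ≤ 1) : |g a| ≤ g 1 := by
  rw [abs_le] at ha ⊢
  exact ⟨by rw [← hodd]; exact hmono ha.1, hmono ha.2⟩

/-- The quotient `(1 - (1 - σ)^s) / σ^s` of the half-line solution. -/
def halfLineQuot (s σ : ℝ) : ℝ := (1 - (1 - σ) ^ s) / σ ^ s

/-- The derivative is `s` times the difference of the two weights that occur on the right and on the
left of the point 1. This coincidence is what makes `x₊^s` a solution for every `g`. -/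
theorem hasDerivAt_halfLineQuot {s σ : ℝ} (h0 : 0 < σ) (h1 : σ < 1) :
    HasDerivAt (halfLineQuot s) (s * (σ ^ (-1 - s) * ((1 - σ) ^ (s - 1) - 1))) σ := by
  have h1' : 0 < 1 - σ := by linarith
  have e1 : HasDerivAt (fun σ : ℝ => 1 - (1 - σ) ^ s) (s * (1 - σ) ^ (s - 1)) σ := by
    have := ((hasDerivAt_id σ).const_sub 1).rpow_const (p := s) (Or.inl h1'.ne')
    have := this.const_sub 1
    simp only [id] at this
    refine this.congr_deriv ?_
    ring
  have e2 : HasDerivAt (fun σ : ℝ => σ ^ s) (s * σ ^ (s - 1)) σ :=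
    Real.hasDerivAt_rpow_const (Or.inl h0.ne')
  have hp : σ ^ s ≠ 0 := (Real.rpow_pos_of_pos h0 s).ne'
  have e3 := e1.div e2 hp
  have e3' : HasDerivAt (halfLineQuot s) _ σ := e3
  refine e3'.congr_deriv ?_
  have r1 : σ ^ (-1 - s) = 1 / (σ * σ ^ s) := by
    rw [show -1 - s = -(1 + s) by ring, Real.rpow_neg h0.le, Real.rpow_add h0, Real.rpow_one,
      one_div]
  have r2 : σ ^ (s - 1) = σ ^ s / σ := by rw [Real.rpow_sub h0, Real.rpow_one]
  have r3 : (1 - σ) ^ (s - 1) = (1 - σ) ^ s / (1 - σ) := by rw [Real.rpow_sub h1', Real.rpow_one]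
  rw [r1, r2, r3]
  field_simp
  ring

/-- The bound by `σ^(1-s)` comes from `(1-σ)^s ≥ 1-σ`; the bound by 1 is Hölder continuity. -/
theorem halfLineQuot_le {s σ : ℝ} (hs0 : 0 < s) (hs1 : s < 1) (h0 : 0 < σ) (h1 : σ ≤ 1) :
    0 ≤ halfLineQuot s σ ∧ halfLineQuot s σ ≤ σ ^ (1 - s) ∧ halfLineQuot s σ ≤ 1 := by
  have hp := Real.rpow_pos_of_pos h0 s
  have e1 : (1 - σ) ^ s ≤ 1 := Real.rpow_le_one (by linarith) (by linarith) hs0.le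
  have e2 : 1 - σ ≤ (1 - σ) ^ s := by
    have := Real.rpow_le_rpow_of_exponent_ge' (x := 1 - σ) (by linarith) (by linarith) hs0.le hs1.le
    rwa [Real.rpow_one] at this
  refine ⟨div_nonneg (by linarith) hp.le, ?_, ?_⟩
  · rw [halfLineQuot, div_le_iff₀ hp, ← Real.rpow_add h0]
    simp; linarith
  · have := abs_div_rpow_le_one hs0 hs1 h0 (b := 1 - σ) (by linarith)
      (by rw [sub_sub_cancel, abs_of_pos h0])
    exact (le_abs_self _).trans this

theorem continuousOn_halfLineQuot {s : ℝ} (hs0 : 0 < s) : ContinuousOn (halfLineQuot s) (Ioi 0) := by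
  intro σ hσ
  have : ContinuousAt (fun σ : ℝ => (1 - (1 - σ) ^ s) / σ ^ s) σ := by
    refine ContinuousAt.div ?_ ?_ (Real.rpow_pos_of_pos hσ s).ne'
    · exact continuousAt_const.sub
        ((continuousAt_const.sub continuousAt_id).rpow_const (Or.inr hs0.le))
    · exact continuousAt_id.rpow_const (Or.inr hs0.le)
  exact this.continuousWithinAt

theorem image_div_one_sub {η : ℝ} (hη : 0 < η) :
    (fun σ : ℝ => σ / (1 - σ)) '' Ioo (η / (1 + η)) 1 = Ioi η := by
  ext τ
  simp only [mem_image, mem_Ioo, mem_Ioi]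
  constructor
  · rintro ⟨σ, ⟨h1, h2⟩, rfl⟩
    rw [div_lt_iff₀ (by linarith)] at h1
    rw [lt_div_iff₀ (by linarith)]
    linarith
  · intro h
    have h' : 0 < 1 + τ := by linarith
    refine ⟨τ / (1 + τ), ⟨?_, ?_⟩, ?_⟩
    · rw [div_lt_div_iff₀ (by linarith) h']; linarith
    · rw [div_lt_one h']; linarith
    · field_simp; ring

/-- With `τ = σ/(1-σ)` one has `1 + τ = 1/(1-σ)`, and the quotient to the right of 1 becomes minus
the quotient to the left. The price is a new weight and a cutoff moved from `η` to `η/(1+η)`. -/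
theorem integral_Ioi_right {g : ℝ → ℝ} (hodd : ∀ t, g (-t) = -g t) {s η : ℝ}
    (hη : 0 < η) :
    ∫ τ in Ioi η, g ((1 - (1 + τ) ^ s) / τ ^ s) * τ ^ (-1 - s)
      = -∫ σ in Ioo (η / (1 + η)) 1,
          g (halfLineQuot s σ) * σ ^ (-1 - s) * (1 - σ) ^ (s - 1) := by
  rw [← image_div_one_sub hη, integral_image_eq_integral_abs_deriv_smul
    (f' := fun σ => 1 / (1 - σ) ^ 2) measurableSet_Ioo, ← integral_neg]
  · refine setIntegral_congr_fun measurableSet_Ioo fun σ hσ => ?_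
    have h0 : 0 < σ := lt_trans (by positivity) hσ.1
    have h1 : 0 < 1 - σ := by linarith [hσ.2]
    have e0 : 1 + σ / (1 - σ) = (1 - σ)⁻¹ := by field_simp; ring
    have hA : 0 < σ ^ s := Real.rpow_pos_of_pos h0 s
    have hB : 0 < (1 - σ) ^ s := Real.rpow_pos_of_pos h1 s
    have e1 : (1 - (1 + σ / (1 - σ)) ^ s) / (σ / (1 - σ)) ^ s = -halfLineQuot s σ := by
      rw [e0, Real.inv_rpow h1.le, Real.div_rpow h0.le h1.le, halfLineQuot]
      field_simp; ring
    have e2 : (σ / (1 - σ)) ^ (-1 - s) = σ ^ (-1 - s) * (1 - σ) ^ (s - 1) * (1 - σ) ^ 2 := by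
      rw [Real.div_rpow h0.le h1.le, ← Real.rpow_natCast, mul_assoc, ← Real.rpow_add h1,
        div_eq_mul_inv, ← Real.rpow_neg h1.le]
      congr 2; push_cast; ring
    simp only [smul_eq_mul]
    rw [e1, hodd, e2, abs_of_pos (by positivity)]
    field_simp
  · intro σ hσ
    have h1 : 1 - σ ≠ 0 := by linarith [hσ.2]
    have := (hasDerivAt_id σ).div ((hasDerivAt_id σ).const_sub 1) h1
    refine (this.congr_deriv ?_).hasDerivWithinAt
    simp only [id]
    ring
  · intro a ha b hb hab
    have h1 : 1 - a ≠ 0 := by linarith [ha.2]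
    have h2 : 1 - b ≠ 0 := by linarith [hb.2]
    simp only at hab
    rw [div_eq_div_iff h1 h2] at hab
    linarith

/-- Beyond distance one to the left of the point 1 the function `x₊^s` vanishes, and the integrand
is an exact derivative in `τ^(-s)`. -/
theorem integral_Ioi_one_rpow {g : ℝ → ℝ} (hg : Continuous g) (hmono : Monotone g)
    (hodd : ∀ t, g (-t) = -g t) {s : ℝ} (hs0 : 0 < s) :
    ∫ τ in Ioi (1 : ℝ), g (τ ^ (-s)) * τ ^ (-1 - s) = (1 / s) * ∫ t in (0 : ℝ)..1, g t := by
  set P : ℝ → ℝ := fun x => ∫ t in (0 : ℝ)..x, g t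
  have hP : ∀ x, HasDerivAt P (g x) x := fun x => hg.integral_hasStrictDerivAt 0 x |>.hasDerivAt
  have hd : ∀ τ ∈ Ici (1 : ℝ), HasDerivAt (fun τ => -(1 / s) * P (τ ^ (-s)))
      (g (τ ^ (-s)) * τ ^ (-1 - s)) τ := by
    intro τ hτ
    have h0 : (0 : ℝ) < τ := lt_of_lt_of_le one_pos hτ
    have := ((hP (τ ^ (-s))).comp τ
      (Real.hasDerivAt_rpow_const (p := -s) (Or.inl h0.ne'))).const_mul (-(1 / s))
    refine this.congr_deriv ?_
    rw [show -s - 1 = -1 - s by ring]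
    field_simp
  have hg0 : ∀ t, 0 ≤ t → 0 ≤ g t := by
    intro t ht
    have h1 := hmono ht
    have h2 := hodd 0
    rw [neg_zero] at h2
    linarith
  have htend : Tendsto (fun τ : ℝ => -(1 / s) * P (τ ^ (-s))) atTop (𝓝 0) := by
    have h1 : Tendsto P (𝓝 0) (𝓝 0) := by
      have := (hP 0).continuousAt.tendsto
      simpa [P] using this
    have := (h1.comp (tendsto_rpow_neg_atTop hs0)).const_mul (-(1 / s))
    simpa using this
  rw [integral_Ioi_of_hasDerivAt_of_nonneg' hd ?_ htend]
  · simp [P]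
  · intro τ hτ
    have h0 : (0 : ℝ) < τ := lt_trans one_pos hτ
    exact mul_nonneg (hg0 _ (by positivity)) (by positivity)

/-- The contribution `P(1)/s` of the region where `x₊^s = 0` cancels the upper boundary term of the
exact derivative on `(η, 1)`. There remain the lower boundary term and the strip created by the
shifted cutoff. -/
theorem integral_halfLine_eq {g : ℝ → ℝ} (hg : Continuous g) (hmono : Monotone g)
    (hodd : ∀ t, g (-t) = -g t) {s : ℝ} (hs0 : 0 < s) (hs1 : s < 1) {η : ℝ} (hη : 0 < η)
    (hη2 : η ≤ 1 / 2)
    (hi1 : IntegrableOn (fun τ => g ((1 - max 0 (1 + τ) ^ s) / τ ^ s) * τ ^ (-1 - s)) (Ioi η))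
    (hi2 : IntegrableOn (fun τ => g ((1 - max 0 (1 + -τ) ^ s) / τ ^ s) * τ ^ (-1 - s)) (Ioi η)) :
    ∫ τ in Ioi η, (g ((1 - max 0 (1 + τ) ^ s) / τ ^ s) + g ((1 - max 0 (1 + -τ) ^ s) / τ ^ s))
      * τ ^ (-1 - s) = (1 / s) * (∫ t in (0 : ℝ)..halfLineQuot s η, g t)
        - ∫ σ in (η / (1 + η))..η, g (halfLineQuot s σ) * σ ^ (-1 - s) * (1 - σ) ^ (s - 1) := by
  set P : ℝ → ℝ := fun x => ∫ t in (0 : ℝ)..x, g t with hPdef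
  have hP : ∀ x, HasDerivAt P (g x) x := fun x => hg.integral_hasStrictDerivAt 0 x |>.hasDerivAt
  set a := η / (1 + η) with ha
  have ha0 : 0 < a := by positivity
  have haη : a ≤ η := div_le_self hη.le (by linarith)
  set h1 : ℝ → ℝ := fun σ => g (halfLineQuot s σ) * σ ^ (-1 - s) with hh1
  set h2 : ℝ → ℝ := fun σ => g (halfLineQuot s σ) * σ ^ (-1 - s) * (1 - σ) ^ (s - 1) with hh2
  have hc1 : ContinuousOn h1 (Ioi 0) :=
    (hg.comp_continuousOn (continuousOn_halfLineQuot hs0)).mul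
      (continuousOn_id.rpow_const fun x hx => Or.inl (ne_of_gt hx))
  have hI1 : ∀ u v, 0 < u → 0 < v → IntervalIntegrable h1 volume u v := fun u v hu hv =>
    (hc1.mono fun x hx => lt_of_lt_of_le (lt_min hu hv) hx.1).intervalIntegrable
  have hr : ∀ u v : ℝ, IntervalIntegrable (fun σ : ℝ => (1 - σ) ^ (s - 1)) volume u v := by
    intro u v
    have := (intervalIntegral.intervalIntegrable_rpow' (a := 1 - u) (b := 1 - v)
      (by linarith : -1 < s - 1)).comp_sub_left 1
    simpa using this
  have hI2 : ∀ u v, 0 < u → 0 < v → IntervalIntegrable h2 volume u v := fun u v hu hv =>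
    (hr u v).continuousOn_mul (hc1.mono fun x hx => lt_of_lt_of_le (lt_min hu hv) hx.1)
  have t1 : ∫ τ in Ioi η, g ((1 - max 0 (1 + τ) ^ s) / τ ^ s) * τ ^ (-1 - s)
      = -∫ σ in a..1, h2 σ := by
    rw [intervalIntegral.integral_of_le (by linarith), ← integral_Ioc_eq_integral_Ioo.symm,
      ← integral_Ioi_right hodd hη]
    refine setIntegral_congr_fun measurableSet_Ioi fun τ hτ => ?_
    have : 0 < τ := lt_trans hη hτ
    rw [max_eq_right (by linarith)]
  have t2 : ∫ τ in Ioi η, g ((1 - max 0 (1 + -τ) ^ s) / τ ^ s) * τ ^ (-1 - s)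
      = (∫ σ in η..1, h1 σ) + (1 / s) * P 1 := by
    rw [← Ioc_union_Ioi_eq_Ioi (show η ≤ 1 by linarith),
      setIntegral_union (Ioc_disjoint_Ioi le_rfl) measurableSet_Ioi
        (hi2.mono_set Ioc_subset_Ioi_self) (hi2.mono_set (Ioi_subset_Ioi (by linarith))),
      intervalIntegral.integral_of_le (by linarith)]
    congr 1
    · refine setIntegral_congr_fun measurableSet_Ioc fun τ hτ => ?_
      simp only [hh1, halfLineQuot]
      rw [max_eq_right (by linarith [hτ.2]), ← sub_eq_add_neg]
    · rw [hPdef, ← integral_Ioi_one_rpow hg hmono hodd hs0]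
      refine setIntegral_congr_fun measurableSet_Ioi fun τ hτ => ?_
      have hτ' : 1 < τ := hτ
      rw [max_eq_left (by linarith), Real.zero_rpow hs0.ne', sub_zero, one_div,
        Real.rpow_neg (by linarith)]
  -- The difference of weights integrates exactly by the chain rule. The derivative is only needed
  -- inside the interval, so the singularity of `(1-σ)^(s-1)` at 1 is harmless.
  have t3 : ∫ σ in η..1, (h2 σ - h1 σ) = (1 / s) * P 1 - (1 / s) * P (halfLineQuot s η) := by
    have hW1 : halfLineQuot s 1 = 1 := by simp [halfLineQuot, Real.zero_rpow hs0.ne']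
    have := intervalIntegral.integral_eq_sub_of_hasDerivAt_of_le (a := η) (b := 1)
      (f := fun σ => (1 / s) * P (halfLineQuot s σ)) (f' := fun σ => h2 σ - h1 σ) (by linarith)
      ?_ ?_ ((hI2 η 1 hη one_pos).sub (hI1 η 1 hη one_pos))
    · rw [this, hW1]
    · refine continuousOn_const.mul ?_
      have hPc : Continuous P := continuous_iff_continuousAt.2 fun x => (hP x).continuousAt
      exact hPc.comp_continuousOn
        ((continuousOn_halfLineQuot hs0).mono fun x hx => lt_of_lt_of_le hη hx.1)
    · intro σ hσ
      have hσ0 : 0 < σ := lt_trans hη hσ.1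
      have := ((hP (halfLineQuot s σ)).comp σ (hasDerivAt_halfLineQuot hσ0 hσ.2)).const_mul (1 / s)
      refine this.congr_deriv ?_
      simp only [hh1, hh2]
      field_simp
  have t4 : ∫ σ in a..1, h2 σ = (∫ σ in a..η, h2 σ) + ∫ σ in η..1, h2 σ :=
    (intervalIntegral.integral_add_adjacent_intervals (hI2 a η ha0 hη) (hI2 η 1 hη one_pos)).symm
  rw [intervalIntegral.integral_sub (hI2 η 1 hη one_pos) (hI1 η 1 hη one_pos)] at t3
  simp only [add_mul]
  rw [integral_add hi1 hi2, t1, t2, t4]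
  linarith

theorem integrableOn_halfLine {g : ℝ → ℝ} (hg : Continuous g) (hmono : Monotone g)
    (hodd : ∀ t, g (-t) = -g t) {s : ℝ} (hs0 : 0 < s) (hs1 : s < 1) {η : ℝ} (hη : 0 < η)
    {κ : ℝ} (hκ : |κ| ≤ 1) :
    IntegrableOn (fun τ => g ((1 - max 0 (1 + κ * τ) ^ s) / τ ^ s) * τ ^ (-1 - s)) (Ioi η) := by
  refine Integrable.mono' ((integrableOn_Ioi_rpow_of_lt (a := -1 - s) (by linarith) hη).const_mul
    (g 1)) ?_ ?_
  · apply Measurable.aestronglyMeasurable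
    have := hg.measurable
    fun_prop
  · refine (ae_restrict_iff' measurableSet_Ioi).2 (Eventually.of_forall fun τ hτ => ?_)
    have hτ0 : 0 < τ := lt_trans hη hτ
    rw [norm_mul, Real.norm_eq_abs, Real.norm_of_nonneg (by positivity)]
    refine mul_le_mul_of_nonneg_right (abs_apply_le_of_odd hmono hodd ?_) (by positivity)
    refine abs_div_rpow_le_one hs0 hs1 hτ0 (le_max_left _ _) (abs_one_sub_max_le _ ?_)
    rw [abs_mul, abs_of_pos hτ0]
    exact mul_le_of_le_one_left hτ0.le hκ

/-- On the half-line the truncated operator applied to `x₊^s` at `x = 1` is small. -/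
theorem abs_integral_halfLine_le {g : ℝ → ℝ} (hg : Continuous g) (hmono : Monotone g)
    (hodd : ∀ t, g (-t) = -g t) {s : ℝ} (hs0 : 0 < s) (hs1 : s < 1) {η : ℝ} (hη : 0 < η) :
    |∫ τ in Ioi η, (g ((1 - max 0 (1 + τ) ^ s) / τ ^ s) + g ((1 - max 0 (1 + -τ) ^ s) / τ ^ s))
      * τ ^ (-1 - s)| ≤ (4 / s + 4) * g 1 * min 1 (η ^ (1 - s)) := by
  have hg1 : 0 ≤ g 1 := by
    have h1 := hmono (zero_le_one' ℝ)
    have h2 := hodd 0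
    rw [neg_zero] at h2
    linarith
  have hi1 : IntegrableOn (fun τ => g ((1 - max 0 (1 + τ) ^ s) / τ ^ s) * τ ^ (-1 - s)) (Ioi η) := by
    simpa using integrableOn_halfLine hg hmono hodd hs0 hs1 hη (κ := 1) (by simp)
  have hi2 : IntegrableOn (fun τ => g ((1 - max 0 (1 + -τ) ^ s) / τ ^ s) * τ ^ (-1 - s))
      (Ioi η) := by
    simpa using integrableOn_halfLine hg hmono hodd hs0 hs1 hη (κ := -1) (by simp)
  have hηp : 0 < η ^ (1 - s) := by positivity
  -- For small `η` the exact formula shows the cancellation. For `η ≥ 1/2` none is needed: the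
  -- integral of `τ^(-1-s)` over the tail suffices.
  rcases le_total η (1 / 2) with hη2 | hη2
  · have hmin : min 1 (η ^ (1 - s)) = η ^ (1 - s) :=
      min_eq_right (Real.rpow_le_one hη.le (by linarith) (by linarith))
    rw [hmin, integral_halfLine_eq hg hmono hodd hs0 hs1 hη hη2 hi1 hi2]
    obtain ⟨w0, w1, w2⟩ := halfLineQuot_le hs0 hs1 hη (by linarith)
    have b1 : |(1 / s) * ∫ t in (0 : ℝ)..halfLineQuot s η, g t| ≤ 1 / s * (g 1 * η ^ (1 - s)) := by
      rw [abs_mul, abs_of_pos (by positivity : 0 < 1 / s)]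
      refine mul_le_mul_of_nonneg_left ?_ (by positivity)
      have := intervalIntegral.norm_integral_le_of_norm_le_const (a := 0) (b := halfLineQuot s η)
        (f := g) (C := g 1) (fun x hx => by
          rw [uIoc_of_le w0] at hx
          refine abs_apply_le_of_odd hmono hodd ?_
          rw [abs_of_pos hx.1]; exact hx.2.trans w2)
      rw [Real.norm_eq_abs, sub_zero, abs_of_nonneg w0] at this
      exact this.trans (mul_le_mul_of_nonneg_left w1 hg1)
    have b2 : |∫ σ in (η / (1 + η))..η, g (halfLineQuot s σ) * σ ^ (-1 - s) * (1 - σ) ^ (s - 1)|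
        ≤ 4 * g 1 * η ^ (1 - s) := by
      set a := η / (1 + η) with ha
      have ha0 : 0 < a := by positivity
      have haη : a ≤ η := div_le_self hη.le (by linarith)
      have h2a : η / 2 ≤ a := div_le_div_of_nonneg_left hη.le (by linarith) (by linarith)
      have := intervalIntegral.norm_integral_le_of_norm_le_const (a := a) (b := η)
        (f := fun σ => g (halfLineQuot s σ) * σ ^ (-1 - s) * (1 - σ) ^ (s - 1))
        (C := g 1 * a ^ (-1 - s) * 2) (fun x hx => by
          rw [uIoc_of_le haη] at hx
          have hx0 : 0 < x := ha0.trans hx.1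
          have hx1 : 0 < 1 - x := by linarith [hx.2]
          obtain ⟨v0, v1, v2⟩ := halfLineQuot_le hs0 hs1 hx0 (by linarith)
          rw [norm_mul, norm_mul, Real.norm_of_nonneg (Real.rpow_nonneg hx0.le _),
            Real.norm_of_nonneg (Real.rpow_nonneg hx1.le _), Real.norm_eq_abs]
          have c1 : |g (halfLineQuot s x)| ≤ g 1 :=
            abs_apply_le_of_odd hmono hodd (by rwa [abs_of_nonneg v0])
          have c2 : x ^ (-1 - s) ≤ a ^ (-1 - s) :=
            Real.rpow_le_rpow_of_nonpos ha0 hx.1.le (by linarith)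
          have c3 : (1 - x) ^ (s - 1) ≤ 2 := by
            calc (1 - x) ^ (s - 1) ≤ (1 / 2 : ℝ) ^ (s - 1) :=
                  Real.rpow_le_rpow_of_nonpos (by norm_num) (by linarith [hx.2]) (by linarith)
              _ ≤ (1 / 2 : ℝ) ^ (-1 : ℝ) :=
                  Real.rpow_le_rpow_of_exponent_ge (by norm_num) (by norm_num) (by linarith)
              _ = 2 := by rw [Real.rpow_neg_one]; norm_num
          gcongr)
      rw [Real.norm_eq_abs] at this
      refine this.trans ?_
      -- The strip has length `η a`, of second order in `η`, which offsets the weight `a^(-1-s)` and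
      -- leaves `η^(1-s)`.
      have d1 : |η - a| = η * a := by
        rw [abs_of_nonneg (by linarith), ha]; field_simp; ring
      have d2 : a * a ^ (-1 - s) = a ^ (-s) := by
        rw [← Real.rpow_one_add' ha0.le (by linarith)]; congr 1; ring
      have d3 : a ^ (-s) ≤ 2 * η ^ (-s) := by
        calc a ^ (-s) ≤ (η / 2) ^ (-s) :=
              Real.rpow_le_rpow_of_nonpos (by positivity) h2a (by linarith)
          _ = η ^ (-s) * (2 : ℝ) ^ s := by
              rw [Real.div_rpow hη.le (by norm_num), Real.rpow_neg (by norm_num : (0 : ℝ) ≤ 2),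
                div_inv_eq_mul]
          _ ≤ η ^ (-s) * 2 := by
              refine mul_le_mul_of_nonneg_left ?_ (by positivity)
              calc (2 : ℝ) ^ s ≤ 2 ^ (1 : ℝ) :=
                    Real.rpow_le_rpow_of_exponent_le (by norm_num) hs1.le
                _ = 2 := Real.rpow_one 2
          _ = 2 * η ^ (-s) := mul_comm _ _
      have d4 : η * η ^ (-s) = η ^ (1 - s) := by
        rw [← Real.rpow_one_add' hη.le (by linarith)]; congr 1
      calc g 1 * a ^ (-1 - s) * 2 * |η - a| = 2 * g 1 * η * (a * a ^ (-1 - s)) := by rw [d1]; ring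
        _ ≤ 2 * g 1 * η * (2 * η ^ (-s)) := by
            rw [d2]; exact mul_le_mul_of_nonneg_left d3 (by positivity)
        _ = 4 * g 1 * (η * η ^ (-s)) := by ring
        _ = 4 * g 1 * η ^ (1 - s) := by rw [d4]
    calc _ ≤ _ := abs_sub _ _
      _ ≤ 1 / s * (g 1 * η ^ (1 - s)) + 4 * g 1 * η ^ (1 - s) := add_le_add b1 b2
      _ ≤ (4 / s + 4) * g 1 * η ^ (1 - s) := by
          have : 0 ≤ 1 / s * (g 1 * η ^ (1 - s)) := by positivity
          have e : 4 / s = 4 * (1 / s) := by ring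
          rw [e]
          nlinarith
  · have hA : |∫ τ in Ioi η, (g ((1 - max 0 (1 + τ) ^ s) / τ ^ s)
        + g ((1 - max 0 (1 + -τ) ^ s) / τ ^ s)) * τ ^ (-1 - s)| ≤ 2 * g 1 * (η ^ (-s) / s) := by
      have hint := (integrableOn_Ioi_rpow_of_lt (a := -1 - s) (by linarith) hη).const_mul (2 * g 1)
      have := norm_integral_le_of_norm_le (μ := volume.restrict (Ioi η)) (f := fun τ =>
        (g ((1 - max 0 (1 + τ) ^ s) / τ ^ s)
        + g ((1 - max 0 (1 + -τ) ^ s) / τ ^ s)) * τ ^ (-1 - s)) hint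
        ((ae_restrict_iff' measurableSet_Ioi).2 (Eventually.of_forall fun τ hτ => by
          have hτ0 : 0 < τ := lt_trans hη hτ
          rw [norm_mul, Real.norm_of_nonneg (Real.rpow_nonneg hτ0.le _)]
          refine mul_le_mul_of_nonneg_right ?_ (by positivity)
          refine (norm_add_le _ _).trans ?_
          rw [two_mul]
          refine add_le_add ?_ ?_
          · exact abs_apply_le_of_odd hmono hodd (abs_div_rpow_le_one hs0 hs1 hτ0 (le_max_left _ _)
              (abs_one_sub_max_le _ (abs_of_pos hτ0).le))
          · exact abs_apply_le_of_odd hmono hodd (abs_div_rpow_le_one hs0 hs1 hτ0 (le_max_left _ _)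
              (abs_one_sub_max_le _ (by rw [abs_neg, abs_of_pos hτ0])))))
      rw [integral_const_mul, integral_Ioi_rpow_of_lt (by linarith) hη] at this
      rw [Real.norm_eq_abs] at this
      refine this.trans (le_of_eq ?_)
      rw [show -1 - s + 1 = -s by ring]
      congr 1
      field_simp
    refine hA.trans ?_
    have e1 : η ^ (-s) ≤ 2 := by
      calc η ^ (-s) ≤ (1 / 2 : ℝ) ^ (-s) :=
            Real.rpow_le_rpow_of_nonpos (by norm_num) hη2 (by linarith)
        _ ≤ (1 / 2 : ℝ) ^ (-1 : ℝ) :=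
            Real.rpow_le_rpow_of_exponent_ge (by norm_num) (by norm_num) (by linarith)
        _ = 2 := by rw [Real.rpow_neg_one]; norm_num
    have e2 : η ^ (-s) ≤ 2 * η ^ (1 - s) := by
      have : η ^ (1 - s) = η * η ^ (-s) := by
        rw [← Real.rpow_one_add' hη.le (by linarith)]; congr 1
      rw [this]
      have h0 : 0 < η ^ (-s) := by positivity
      nlinarith
    have e3 : η ^ (-s) ≤ 2 * min 1 (η ^ (1 - s)) := by
      rcases min_cases 1 (η ^ (1 - s)) with ⟨h, -⟩ | ⟨h, -⟩ <;> rw [h] <;> linarith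
    have hm : 0 ≤ min 1 (η ^ (1 - s)) := le_min zero_le_one hηp.le
    calc 2 * g 1 * (η ^ (-s) / s) ≤ 2 * g 1 * (2 * min 1 (η ^ (1 - s)) / s) := by gcongr
      _ = 4 / s * g 1 * min 1 (η ^ (1 - s)) := by ring
      _ ≤ (4 / s + 4) * g 1 * min 1 (η ^ (1 - s)) := by
          gcongr; linarith

/-! ### The half-space solution -/

/-- Scaling to the half-line along a direction making an angle with cosine `c` to the normal. Both
directions on the line are summed, so the sign of `c` is immaterial, and for `c = 0` the integrand
vanishes. -/
theorem abs_integral_line_le {g : ℝ → ℝ} (hg : Continuous g) (hmono : Monotone g)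
    (hodd : ∀ t, g (-t) = -g t) {s : ℝ} (hs0 : 0 < s) (hs1 : s < 1) {δ ε c : ℝ} (hδ : 0 < δ)
    (hε : 0 < ε) (hc : |c| ≤ 1) :
    |∫ r in Ioi ε, (g ((δ ^ s - max 0 (δ + r * c) ^ s) / r ^ s)
      + g ((δ ^ s - max 0 (δ + -(r * c)) ^ s) / r ^ s)) * r ^ (-1 - s)|
      ≤ (4 / s + 4) * g 1 * (δ ^ (-s) * min 1 ((ε / δ) ^ (1 - s))) := by
  have hg0 : g 0 = 0 := by have := hodd 0; rw [neg_zero] at this; linarith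
  have hg1 : 0 ≤ g 1 := hg0 ▸ hmono (zero_le_one' ℝ)
  wlog hc0 : 0 ≤ c generalizing c
  · have := this (c := -c) (by rwa [abs_neg]) (by linarith)
    simpa [add_comm] using this
  rcases hc0.eq_or_lt with rfl | hc0
  · have : ∀ r : ℝ, (g ((δ ^ s - max 0 (δ + r * 0) ^ s) / r ^ s)
      + g ((δ ^ s - max 0 (δ + -(r * 0)) ^ s) / r ^ s)) * r ^ (-1 - s) = 0 := by
      intro r
      simp [max_eq_right hδ.le, hg0]
    simp only [this, integral_zero, abs_zero]
    positivity
  rw [abs_of_pos hc0] at hc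
  set b := c / δ with hb
  have hb0 : 0 < b := by positivity
  have hcs0 : 0 < c ^ s := by positivity
  have hcs : c ^ s ≤ 1 := Real.rpow_le_one hc0.le hc hs0.le
  -- Scaling leaves a factor `c^s` inside `g`. Since `t ↦ g(c^s t)` is again continuous, monotone
  -- and odd, the half-line estimates apply to it, with `G 1 ≤ g 1`.
  set G : ℝ → ℝ := fun t => g (c ^ s * t) with hG
  have hGc : Continuous G := hg.comp (continuous_const.mul continuous_id)
  have hGm : Monotone G := fun x y h => hmono (mul_le_mul_of_nonneg_left h hcs0.le)
  have hGo : ∀ t, G (-t) = -G t := fun t => by simp only [hG, mul_neg, hodd]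
  set Q : ℝ → ℝ := fun τ => (G ((1 - max 0 (1 + τ) ^ s) / τ ^ s)
    + G ((1 - max 0 (1 + -τ) ^ s) / τ ^ s)) * τ ^ (-1 - s) with hQ
  have e1 : ∫ r in Ioi ε, (g ((δ ^ s - max 0 (δ + r * c) ^ s) / r ^ s)
      + g ((δ ^ s - max 0 (δ + -(r * c)) ^ s) / r ^ s)) * r ^ (-1 - s)
      = ∫ r in Ioi ε, b ^ (1 + s) * Q (b * r) := by
    refine setIntegral_congr_fun measurableSet_Ioi fun r hr => ?_
    have hr0 : 0 < r := lt_trans hε hr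
    have hm : ∀ x, (δ ^ s - max 0 (δ + x * c) ^ s) / r ^ s
        = c ^ s * ((1 - max 0 (1 + b * x) ^ s) / (b * r) ^ s) := by
      intro x
      have h1 : max 0 (δ + x * c) = δ * max 0 (1 + b * x) := by
        rw [mul_max_of_nonneg _ _ hδ.le, mul_zero]
        congr 1
        rw [hb]; field_simp
      rw [h1, Real.mul_rpow hδ.le (le_max_left _ _), Real.mul_rpow hb0.le hr0.le, hb,
        Real.div_rpow hc0.le hδ.le]
      have := Real.rpow_pos_of_pos hδ s
      have := Real.rpow_pos_of_pos hr0 s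
      field_simp
    have h2 : r ^ (-1 - s) = b ^ (1 + s) * (b * r) ^ (-1 - s) := by
      rw [Real.mul_rpow hb0.le hr0.le, ← mul_assoc, ← Real.rpow_add hb0]
      simp
    have hm2 := hm (-r)
    rw [neg_mul, mul_neg] at hm2
    simp only [hQ, hG]
    rw [hm r, hm2, h2]
    ring
  rw [e1, integral_const_mul, integral_comp_mul_left_Ioi (fun x => Q x) ε hb0, smul_eq_mul,
    ← mul_assoc, ← Real.rpow_neg_one b, ← Real.rpow_add hb0, abs_mul,
    abs_of_pos (by positivity)]
  have h3 := abs_integral_halfLine_le hGc hGm hGo hs0 hs1 (η := b * ε) (by positivity)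
  have h4 : b ^ (1 + s + -1) ≤ δ ^ (-s) := by
    rw [show 1 + s + -1 = s by ring, hb, Real.div_rpow hc0.le hδ.le, Real.rpow_neg hδ.le]
    rw [div_eq_mul_inv]
    exact mul_le_of_le_one_left (by positivity) hcs
  have h5 : G 1 ≤ g 1 := hmono (by simpa using hcs)
  have h5' : 0 ≤ G 1 := by rw [← hg0]; exact hmono (by positivity)
  have h6 : min 1 ((b * ε) ^ (1 - s)) ≤ min 1 ((ε / δ) ^ (1 - s)) := by
    refine min_le_min_left _ (Real.rpow_le_rpow (by positivity) ?_ (by linarith))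
    rw [hb, div_mul_eq_mul_div]
    gcongr
    exact mul_le_of_le_one_left hε.le hc
  have h7 : 0 ≤ min 1 ((b * ε) ^ (1 - s)) := le_min zero_le_one (by positivity)
  calc _ ≤ δ ^ (-s) * ((4 / s + 4) * G 1 * min 1 ((b * ε) ^ (1 - s))) := by gcongr
    _ ≤ δ ^ (-s) * ((4 / s + 4) * g 1 * min 1 ((ε / δ) ^ (1 - s))) := by gcongr
    _ = _ := by ring

/-- The kernel `|z|^{-n-s}`. -/
def kern {n : ℕ} (s : ℝ) (z : Eucl n) : ℝ := ‖z‖ ^ (-(n : ℝ) - s)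

theorem kern_nonneg {n : ℕ} (s : ℝ) (z : Eucl n) : 0 ≤ kern s z := Real.rpow_nonneg (norm_nonneg _) _

@[fun_prop]
theorem measurable_kern {n : ℕ} (s : ℝ) : Measurable (kern (n := n) s) :=
  measurable_norm.pow_const _

theorem nontrivial_eucl {n : ℕ} (hn : 1 ≤ n) : Nontrivial (Eucl n) := by
  have : Nonempty (Fin n) := ⟨⟨0, hn⟩⟩
  infer_instance

theorem integrableOn_kern {n : ℕ} (hn : 1 ≤ n) {s ε : ℝ} (hs : 0 < s) (hε : 0 < ε) :
    IntegrableOn (kern (n := n) s) {z | ε < ‖z‖} := by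
  have := nontrivial_eucl hn
  have hm : MeasurableSet {z : Eucl n | ε < ‖z‖} := measurableSet_lt measurable_const measurable_norm
  rw [← integrable_indicator_iff hm]
  have h := (integrable_fun_norm_addHaar (volume : Measure (Eucl n))
    (f := (Ioi ε).indicator fun r => r ^ (-(n : ℝ) - s))).2 ?_
  · exact h
  · have h1 := (integrableOn_Ioi_rpow_of_lt (a := -1 - s) (by linarith) hε).integrable_indicator
      measurableSet_Ioi
    refine h1.integrableOn.congr_fun (fun r hr => ?_) measurableSet_Ioi
    have hr0 : (0 : ℝ) < r := hr
    by_cases h : r ∈ Ioi ε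
    · simp only [indicator_of_mem h, finrank_euclideanSpace, Fintype.card_fin, smul_eq_mul]
      rw [← Real.rpow_natCast, ← Real.rpow_add hr0]
      congr 1
      push_cast [Nat.cast_sub hn]; ring
    · simp [indicator_of_notMem h]

/-- Polar coordinates for signed integrands: the radial integral is bounded with its cancellation
before the sphere is integrated. -/
theorem abs_integral_le_of_polar {n : ℕ} (hn : 1 ≤ n) {F : Eucl n → ℝ} (hF : Integrable F) {M : ℝ}
    (h : ∀ ω : Eucl n, ‖ω‖ = 1 → |∫ r in Ioi (0 : ℝ), r ^ (n - 1) * F (r • ω)| ≤ M) :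
    |∫ z, F z| ≤ M * (volume : Measure (Eucl n)).toSphere.real univ := by
  have := nontrivial_eucl hn
  set μ := (volume : Measure (Eucl n))
  have hmp := μ.measurePreserving_homeomorphUnitSphereProd
  have hemb := Homeomorph.measurableEmbedding (homeomorphUnitSphereProd (Eucl n))
  have hd : Module.finrank ℝ (Eucl n) - 1 = n - 1 := by simp
  set H : Metric.sphere (0 : Eucl n) 1 × Ioi (0 : ℝ) → ℝ := fun p => F (p.2.1 • p.1.1) with hH
  have hcomp : ∀ x : ({0}ᶜ : Set (Eucl n)), H (homeomorphUnitSphereProd _ x) = F x := by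
    intro x
    have hx : ‖(x : Eucl n)‖ ≠ 0 := norm_ne_zero_iff.2 x.2
    simp only [hH, homeomorphUnitSphereProd_apply_snd_coe, homeomorphUnitSphereProd_apply_fst_coe,
      smul_smul, mul_inv_cancel₀ hx, one_smul]
  have e1 : ∫ z, F z ∂μ = ∫ p, H p ∂μ.toSphere.prod (.volumeIoiPow (n - 1)) := by
    calc ∫ z, F z ∂μ = ∫ x : ({(0)}ᶜ : Set (Eucl n)), F x ∂(μ.comap (↑)) := by
          rw [integral_subtype_comap (measurableSet_singleton _).compl fun x ↦ F x,
            restrict_compl_singleton]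
      _ = ∫ x, H (homeomorphUnitSphereProd _ x) ∂(μ.comap (↑)) := by
          exact integral_congr_ae (Eventually.of_forall fun x => (hcomp x).symm)
      _ = _ := by rw [← hd]; exact hmp.integral_comp hemb H
  have hHi : Integrable H (μ.toSphere.prod (.volumeIoiPow (n - 1))) := by
    rw [← hd, ← hmp.integrable_comp_emb hemb]
    have h1 : H ∘ (homeomorphUnitSphereProd (Eucl n)) = F ∘ Subtype.val := funext hcomp
    rw [h1]
    have h2 := (integrableOn_iff_comap_subtypeVal (μ := μ) (f := F)
      (measurableSet_singleton (0 : Eucl n)).compl).1 hF.integrableOn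
    exact h2
  rw [e1, integral_prod _ hHi, ← Real.norm_eq_abs]
  refine (norm_integral_le_of_norm_le_const (C := M) (Eventually.of_forall fun ω => ?_))
  rw [Real.norm_eq_abs]
  have hω : ‖(ω : Eucl n)‖ = 1 := by simp
  refine le_trans (le_of_eq ?_) (h ω hω)
  congr 1
  simp only [Measure.volumeIoiPow, ENNReal.ofReal]
  rw [integral_withDensity_eq_integral_smul,
    integral_subtype_comap measurableSet_Ioi
      fun a ↦ Real.toNNReal (a ^ (n - 1)) • F (a • (ω : Eucl n)),
    setIntegral_congr_fun measurableSet_Ioi fun x hx ↦ ?_]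
  · rw [NNReal.smul_def, Real.coe_toNNReal _ (pow_nonneg hx.out.le _), smul_eq_mul]
  · exact (measurable_subtype_coe.pow_const _).real_toNNReal

/-- The integrand of the operator applied to the half-space solution `(δ + ν · z)₊^s`. -/
def halfSpaceIntegrand {n : ℕ} (g : ℝ → ℝ) (s δ : ℝ) (ν z : Eucl n) : ℝ :=
  g ((δ ^ s - max 0 (δ + inner ℝ ν z) ^ s) / ‖z‖ ^ s) * kern s z

theorem abs_halfSpace_arg_le {n : ℕ} {s δ : ℝ} (hs0 : 0 < s) (hs1 : s < 1) (hδ : 0 ≤ δ)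
    {ν : Eucl n} (hν : ‖ν‖ = 1) (z : Eucl n) :
    |(δ ^ s - max 0 (δ + inner ℝ ν z) ^ s) / ‖z‖ ^ s| ≤ 1 := by
  rw [abs_div, abs_of_nonneg (Real.rpow_nonneg (norm_nonneg z) s)]
  refine div_le_one_of_le₀ ?_ (Real.rpow_nonneg (norm_nonneg z) s)
  refine (abs_rpow_sub_rpow_le_rpow hs0 hs1 hδ (le_max_left _ _)).trans
    (Real.rpow_le_rpow (abs_nonneg _) ?_ hs0.le)
  have h := abs_real_inner_le_norm ν z
  rw [hν, one_mul, abs_le] at h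
  rw [abs_le]
  rcases max_cases 0 (δ + inner ℝ ν z) with ⟨h1, h2⟩ | ⟨h1, h2⟩ <;> rw [h1] <;> constructor <;>
    linarith

theorem measurable_halfSpaceIntegrand {n : ℕ} {g : ℝ → ℝ} (hg : Continuous g) (s δ : ℝ)
    (ν : Eucl n) : Measurable (halfSpaceIntegrand g s δ ν) := by
  have := hg.measurable
  have h2 : Measurable fun z : Eucl n => (inner ℝ ν z : ℝ) :=
    (continuous_const.inner continuous_id).measurable
  unfold halfSpaceIntegrand
  fun_prop

theorem integrableOn_halfSpaceIntegrand {n : ℕ} (hn : 1 ≤ n) {g : ℝ → ℝ} (hg : Continuous g)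
    (hmono : Monotone g) (hodd : ∀ t, g (-t) = -g t) {s δ ε : ℝ} (hs0 : 0 < s) (hs1 : s < 1)
    (hδ : 0 < δ) (hε : 0 < ε) {ν : Eucl n} (hν : ‖ν‖ = 1) :
    IntegrableOn (halfSpaceIntegrand g s δ ν) {z | ε < ‖z‖} := by
  refine Integrable.mono' ((integrableOn_kern hn hs0 hε).const_mul (g 1))
    (measurable_halfSpaceIntegrand hg s δ ν).aestronglyMeasurable (Eventually.of_forall fun z => ?_)
  rw [halfSpaceIntegrand, norm_mul, Real.norm_of_nonneg (kern_nonneg s z)]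
  exact mul_le_mul_of_nonneg_right
    (abs_apply_le_of_odd hmono hodd (abs_halfSpace_arg_le hs0 hs1 hδ.le hν z)) (kern_nonneg s z)

/-- The truncated operator applied to the half-space solution. -/
theorem abs_integral_halfSpace_le {n : ℕ} (hn : 1 ≤ n) {g : ℝ → ℝ} (hg : Continuous g)
    (hmono : Monotone g) (hodd : ∀ t, g (-t) = -g t) {s δ ε : ℝ} (hs0 : 0 < s) (hs1 : s < 1)
    (hδ : 0 < δ) (hε : 0 < ε) {ν : Eucl n} (hν : ‖ν‖ = 1) :
    |∫ z in {z | ε < ‖z‖}, halfSpaceIntegrand g s δ ν z|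
      ≤ (volume : Measure (Eucl n)).toSphere.real univ * ((4 / s + 4) * g 1) *
        (δ ^ (-s) * min 1 ((ε / δ) ^ (1 - s))) := by
  have hm : MeasurableSet {z : Eucl n | ε < ‖z‖} := measurableSet_lt measurable_const measurable_norm
  set k := halfSpaceIntegrand g s δ ν with hk
  set S := {z : Eucl n | ε < ‖z‖} with hS
  have hint := integrableOn_halfSpaceIntegrand hn hg hmono hodd hs0 hs1 hδ hε hν
  set F := S.indicator k with hF
  have hFi : Integrable F := hint.integrable_indicator hm
  have hFn : Integrable fun z => F (-z) := hFi.comp_neg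
  -- Symmetrising in `z ↦ -z` puts opposite rays together, which the one-dimensional cancellation
  -- needs.
  have e1 : ∫ z in S, k z = 1 / 2 * ∫ z, (F z + F (-z)) := by
    rw [integral_add hFi hFn, integral_neg_eq_self, ← integral_indicator hm]
    ring
  have h2 := abs_integral_le_of_polar hn (hFi.add hFn)
    (M := (4 / s + 4) * g 1 * (δ ^ (-s) * min 1 ((ε / δ) ^ (1 - s)))) (fun ω hω => ?_)
  · rw [e1, abs_mul, abs_of_pos (by norm_num : (0 : ℝ) < 1 / 2)]
    have h3 : 0 ≤ |∫ z, (F z + F (-z))| := abs_nonneg _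
    simp only [Pi.add_apply] at h2
    linarith
  · have hcω : |(inner ℝ ν ω : ℝ)| ≤ 1 := by
      have := abs_real_inner_le_norm ν ω
      rwa [hν, hω, one_mul] at this
    refine le_trans (le_of_eq ?_) (abs_integral_line_le hg hmono hodd hs0 hs1 hδ hε hcω)
    congr 1
    rw [← integral_indicator measurableSet_Ioi, ← integral_indicator measurableSet_Ioi]
    refine integral_congr_ae (Eventually.of_forall fun r => ?_)
    by_cases hr : r ∈ Ioi ε
    · have hr0 : 0 < r := lt_trans hε hr
      have hnorm : ‖r • ω‖ = r := by rw [norm_smul, hω, Real.norm_of_nonneg hr0.le, mul_one]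
      have hmem : r • ω ∈ S := by rw [hS, mem_ofPred_eq, hnorm]; exact hr
      have hmem' : -(r • ω) ∈ S := by rw [hS, mem_ofPred_eq, norm_neg, hnorm]; exact hr
      have hp : r ^ (n - 1) * r ^ (-(n : ℝ) - s) = r ^ (-1 - s) := by
        rw [← Real.rpow_natCast, ← Real.rpow_add hr0]
        congr 1
        push_cast [Nat.cast_sub hn]; ring
      simp only [indicator_of_mem hr, indicator_of_mem (show r ∈ Ioi (0 : ℝ) from hr0), Pi.add_apply,
        hF, indicator_of_mem hmem, indicator_of_mem hmem', hk, halfSpaceIntegrand, kern, norm_neg,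
        hnorm, inner_neg_right, inner_smul_right]
      rw [← hp]
      ring
    · simp only [indicator_of_notMem hr]
      by_cases hr0 : r ∈ Ioi (0 : ℝ)
      · have hnorm : ‖r • ω‖ = r := by rw [norm_smul, hω, Real.norm_of_nonneg (le_of_lt hr0), mul_one]
        have hmem : r • ω ∉ S := by rw [hS, mem_ofPred_eq, hnorm]; exact hr
        have hmem' : -(r • ω) ∉ S := by rw [hS, mem_ofPred_eq, norm_neg, hnorm]; exact hr
        simp only [indicator_of_mem hr0, Pi.add_apply, hF, indicator_of_notMem hmem,
          indicator_of_notMem hmem', add_zero, mul_zero]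
      · simp only [indicator_of_notMem hr0]

/-! ### Singular integrals by averaging over translations -/

/-- Where `|a + τ| ≤ t` the integrand is part of one of two integrable singularities; elsewhere it
is at most `t^(s-1)`. The bound does not depend on `a`. -/
theorem lintegral_abs_add_rpow_le {s : ℝ} (hs0 : 0 < s) (hs1 : s < 1) (a : ℝ) {t : ℝ} (ht : 0 < t) :
    ∫⁻ τ in Ioo 0 t, ENNReal.ofReal (|a + τ| ^ (s - 1)) ≤ ENNReal.ofReal ((2 / s + 1) * t ^ s) := by
  set K : ℝ → ℝ≥0∞ := (Ioc 0 t).indicator fun σ => ENNReal.ofReal (σ ^ (s - 1)) with hK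
  have hKm : Measurable K := by
    refine Measurable.indicator ?_ measurableSet_Ioc
    fun_prop
  have hKint : ∫⁻ σ, K σ = ENNReal.ofReal (t ^ s / s) := by
    have hi := (intervalIntegral.intervalIntegrable_rpow' (a := 0) (b := t)
      (by linarith : -1 < s - 1)).1
    rw [hK, lintegral_indicator measurableSet_Ioc, ← ofReal_integral_eq_lintegral_ofReal hi,
      ← intervalIntegral.integral_of_le ht.le, integral_rpow (Or.inl (by linarith)),
      sub_add_cancel, Real.zero_rpow hs0.ne', sub_zero]
    exact (ae_restrict_iff' measurableSet_Ioc).2 (Eventually.of_forall fun σ hσ =>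
      Real.rpow_nonneg hσ.1.le _)
  have hpt : ∀ τ, ENNReal.ofReal (|a + τ| ^ (s - 1))
      ≤ K (a + τ) + K (-(a + τ)) + ENNReal.ofReal (t ^ (s - 1)) := by
    intro τ
    set σ := a + τ
    rcases le_total t |σ| with h | h
    · exact le_add_left (ENNReal.ofReal_le_ofReal
        (Real.rpow_le_rpow_of_nonpos ht h (by linarith)))
    · refine le_add_right ?_
      rcases lt_trichotomy σ 0 with h0 | h0 | h0
      · refine le_add_left (le_of_eq ?_)
        rw [abs_of_neg h0] at h ⊢
        rw [hK, indicator_of_mem (show -σ ∈ Ioc 0 t from ⟨by linarith, h⟩)]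
      · rw [h0, abs_zero, Real.zero_rpow (by linarith)]; simp
      · refine le_add_right (le_of_eq ?_)
        rw [abs_of_pos h0] at h ⊢
        rw [hK, indicator_of_mem (show σ ∈ Ioc 0 t from ⟨h0, h⟩)]
  have m1 : Measurable fun τ => K (a + τ) := hKm.comp (measurable_const_add a)
  have m2 : Measurable fun τ => K (-(a + τ)) := hKm.comp (measurable_const_add a).neg
  calc ∫⁻ τ in Ioo 0 t, ENNReal.ofReal (|a + τ| ^ (s - 1))
      ≤ ∫⁻ τ in Ioo 0 t, (K (a + τ) + K (-(a + τ)) + ENNReal.ofReal (t ^ (s - 1))) :=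
        lintegral_mono hpt
    _ = (∫⁻ τ in Ioo 0 t, K (a + τ)) + (∫⁻ τ in Ioo 0 t, K (-(a + τ)))
        + ∫⁻ τ in Ioo 0 t, ENNReal.ofReal (t ^ (s - 1)) := by
        rw [lintegral_add_right _ measurable_const, lintegral_add_left m1]
    _ ≤ ENNReal.ofReal (t ^ s / s) + ENNReal.ofReal (t ^ s / s) + ENNReal.ofReal (t ^ s) := by
        refine add_le_add (add_le_add ?_ ?_) ?_
        · refine (setLIntegral_le_lintegral _ _).trans ?_
          rw [lintegral_add_left_eq_self K a, hKint]
        · refine (setLIntegral_le_lintegral _ _).trans ?_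
          rw [lintegral_add_left_eq_self (fun σ => K (-σ)) a, lintegral_neg_eq_self, hKint]
        · rw [setLIntegral_const, Real.volume_Ioo, sub_zero, ← ENNReal.ofReal_mul (by positivity)]
          refine ENNReal.ofReal_le_ofReal (le_of_eq ?_)
          rw [mul_comm, ← Real.rpow_one_add' ht.le (by linarith)]; congr 1; ring
    _ = ENNReal.ofReal ((2 / s + 1) * t ^ s) := by
        rw [← ENNReal.ofReal_add (by positivity) (by positivity),
          ← ENNReal.ofReal_add (by positivity) (by positivity)]
        congr 1; ring

/-- Average the integral over translates along `ν` and exchange the integrals: a bound on each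
segment in direction `ν` gives a volume bound without any change of coordinates. -/
theorem lintegral_le_of_translate {n : ℕ} {A B : Set (Eucl n)} (hA : MeasurableSet A)
    (hB : MeasurableSet B) {h : Eucl n → ℝ≥0∞} (hh : Measurable h) (ν : Eucl n) {t : ℝ}
    (hAB : ∀ z ∈ A, ∀ τ ∈ Ioo 0 t, z - τ • ν ∈ B) {M : ℝ≥0∞}
    (hM : ∀ z ∈ B, ∫⁻ τ in Ioo 0 t, A.indicator h (z + τ • ν) ≤ M) :
    ENNReal.ofReal t * ∫⁻ z in A, h z ≤ M * volume B := by
  set H := A.indicator h with hH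
  have hHm : Measurable H := hh.indicator hA
  calc ENNReal.ofReal t * ∫⁻ z in A, h z = ∫⁻ _ in Ioo 0 t, ∫⁻ z, H z := by
        rw [setLIntegral_const, Real.volume_Ioo, sub_zero, mul_comm, hH, lintegral_indicator hA]
    _ = ∫⁻ τ in Ioo 0 t, ∫⁻ z in B, H (z + τ • ν) := by
        refine setLIntegral_congr_fun measurableSet_Ioo fun τ hτ => ?_
        rw [← lintegral_add_right_eq_self H (τ • ν), ← lintegral_indicator hB]
        refine lintegral_congr fun z => ?_
        by_cases hz : z ∈ B
        · rw [indicator_of_mem hz]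
        · rw [indicator_of_notMem hz, hH, indicator_of_notMem]
          intro hz'
          have := hAB _ hz' τ hτ
          rw [add_sub_cancel_right] at this
          exact hz this
    _ = ∫⁻ z in B, ∫⁻ τ in Ioo 0 t, H (z + τ • ν) := by
        rw [lintegral_lintegral_swap]
        apply Measurable.aemeasurable
        exact hHm.comp (by fun_prop)
    _ ≤ ∫⁻ _ in B, M := setLIntegral_mono measurable_const hM
    _ = M * volume B := setLIntegral_const _ _

/-- Translation by `τ ν` shifts `δ + ν·z` by `τ`, so each segment falls under the one-dimensional
bound; translates of the ball stay in the ball of twice the radius. -/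
theorem exists_lintegral_ball_le (n : ℕ) (hn : 1 ≤ n) {s : ℝ} (hs0 : 0 < s) (hs1 : s < 1) :
    ∃ C : ℝ≥0∞, C ≠ ⊤ ∧ ∀ (ν : Eucl n) (δ t : ℝ), ‖ν‖ = 1 → 0 < t →
      ∫⁻ z in Metric.ball (0 : Eucl n) t, ENNReal.ofReal (|δ + inner ℝ ν z| ^ (s - 1))
        ≤ C * ENNReal.ofReal (t ^ ((n : ℝ) - 1 + s)) := by
  have := nontrivial_eucl hn
  refine ⟨ENNReal.ofReal (2 / s + 1) * (ENNReal.ofReal (2 ^ n) *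
    volume (Metric.ball (0 : Eucl n) 1)), ?_, fun ν δ t hν ht => ?_⟩
  · exact ENNReal.mul_ne_top ENNReal.ofReal_ne_top
      (ENNReal.mul_ne_top ENNReal.ofReal_ne_top measure_ball_lt_top.ne)
  have hνν : inner ℝ ν ν = (1 : ℝ) := by rw [real_inner_self_eq_norm_sq, hν, one_pow]
  have hmeas : Measurable fun z : Eucl n => ENNReal.ofReal (|δ + inner ℝ ν z| ^ (s - 1)) := by
    have h2 : Measurable fun z : Eucl n => (inner ℝ ν z : ℝ) :=
      (continuous_const.inner continuous_id).measurable
    have h3 : Measurable fun z : Eucl n => |δ + inner ℝ ν z| := (h2.const_add δ).abs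
    fun_prop
  have key := lintegral_le_of_translate (A := Metric.ball (0 : Eucl n) t)
    (B := Metric.ball (0 : Eucl n) (2 * t)) measurableSet_ball measurableSet_ball hmeas ν (t := t)
    (fun z hz τ hτ => by
      rw [mem_ball_zero_iff] at hz ⊢
      calc ‖z - τ • ν‖ ≤ ‖z‖ + ‖τ • ν‖ := norm_sub_le _ _
        _ < t + t := by
            rw [norm_smul, hν, Real.norm_of_nonneg hτ.1.le, mul_one]
            exact add_lt_add hz hτ.2
        _ = 2 * t := by ring)
    (M := ENNReal.ofReal ((2 / s + 1) * t ^ s)) (fun z _ => by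
      refine le_trans (lintegral_mono fun τ => indicator_le_self _ _ _) ?_
      simp only [inner_add_right, inner_smul_right, hνν, mul_one, ← add_assoc]
      exact lintegral_abs_add_rpow_le hs0 hs1 _ ht)
  rw [Measure.addHaar_ball volume 0 (r := 2 * t) (by positivity), finrank_euclideanSpace,
    Fintype.card_fin] at key
  have h1 : ENNReal.ofReal t⁻¹ * ENNReal.ofReal t = 1 := by
    rw [← ENNReal.ofReal_mul (by positivity), inv_mul_cancel₀ ht.ne', ENNReal.ofReal_one]
  set I := ∫⁻ z in Metric.ball (0 : Eucl n) t, ENNReal.ofReal (|δ + inner ℝ ν z| ^ (s - 1))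
  set V := volume (Metric.ball (0 : Eucl n) 1)
  calc I = ENNReal.ofReal t⁻¹ * (ENNReal.ofReal t * I) := by rw [← mul_assoc, h1, one_mul]
    _ ≤ ENNReal.ofReal t⁻¹ * (ENNReal.ofReal ((2 / s + 1) * t ^ s) *
        (ENNReal.ofReal ((2 * t) ^ n) * V)) := by gcongr
    _ = ENNReal.ofReal (t⁻¹ * ((2 / s + 1) * t ^ s) * (2 * t) ^ n) * V := by
        rw [ENNReal.ofReal_mul (p := t⁻¹ * ((2 / s + 1) * t ^ s)) (by positivity),
          ENNReal.ofReal_mul (p := t⁻¹) (by positivity)]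
        simp only [mul_assoc]
    _ = ENNReal.ofReal ((2 / s + 1) * (2 ^ n * t ^ ((n : ℝ) - 1 + s))) * V := by
        congr 2
        rw [mul_pow, Real.rpow_add ht, Real.rpow_sub ht, Real.rpow_natCast, Real.rpow_one]
        field_simp
    _ = _ := by
        rw [ENNReal.ofReal_mul (by positivity), ENNReal.ofReal_mul (by positivity)]; ring

theorem lintegral_Ioi_rpow_eq {α a : ℝ} (hα : 0 < α) (ha : 0 < a) :
    ∫⁻ t in Ioi a, ENNReal.ofReal (α * t ^ (-α - 1)) = ENNReal.ofReal (a ^ (-α)) := by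
  have hi := (integrableOn_Ioi_rpow_of_lt (a := -α - 1) (by linarith) ha).const_mul α
  rw [← ofReal_integral_eq_lintegral_ofReal hi, integral_const_mul,
    integral_Ioi_rpow_of_lt (by linarith) ha, sub_add_cancel]
  · congr 1; field_simp
  · exact (ae_restrict_iff' measurableSet_Ioi).2 (Eventually.of_forall fun σ hσ =>
      mul_nonneg hα.le (Real.rpow_nonneg (ha.trans hσ).le _))

/-- The power of `‖z‖` is written as the integral of `α t^(-α-1)` over `t > ‖z‖`. After exchanging
integrals only the integral of the other factor over balls of radius `min t 1` is needed. -/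
theorem exists_lintegral_singular_le (n : ℕ) (hn : 1 ≤ n) {s : ℝ} (hs0 : 0 < s) (hs1 : s < 1) :
    ∃ C : ℝ≥0∞, C ≠ ⊤ ∧ ∀ (ν : Eucl n) (δ : ℝ), ‖ν‖ = 1 →
      ∫⁻ z in Metric.ball (0 : Eucl n) 1,
        ENNReal.ofReal (‖z‖ ^ (2 - 2 * s - n) * |δ + inner ℝ ν z| ^ (s - 1)) ≤ C := by
  have := nontrivial_eucl hn
  obtain ⟨C, hC, hball⟩ := exists_lintegral_ball_le n hn hs0 hs1
  have hn' : (1 : ℝ) ≤ n := by exact_mod_cast hn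
  -- This exponent satisfies `2 - 2s - n = -α + (1-s)² ≥ -α`, and `β - α = s - s² > 0` gives
  -- convergence at `t = 0`. It is positive even for `n = 1`, where `n - 2 + 2s` may fail to be.
  set α : ℝ := n - 1 + s ^ 2 with hα
  have hα0 : 0 < α := by have : 0 < s ^ 2 := by positivity
                         linarith
  set β : ℝ := n - 1 + s with hβ
  have hβ0 : 0 < β := by linarith
  set J : ℝ≥0∞ := (∫⁻ t in Ioc (0 : ℝ) 1, ENNReal.ofReal (α * t ^ (s - s ^ 2 - 1)))
    + ∫⁻ t in Ioi (1 : ℝ), ENNReal.ofReal (α * t ^ (-α - 1)) with hJ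
  have hJtop : J ≠ ⊤ := by
    refine ENNReal.add_ne_top.2 ⟨?_, ?_⟩
    · have hi := ((intervalIntegral.intervalIntegrable_rpow' (a := 0) (b := 1)
        (by nlinarith : -1 < s - s ^ 2 - 1)).1.const_mul α)
      exact hi.lintegral_lt_top.ne
    · rw [lintegral_Ioi_rpow_eq hα0 one_pos]; exact ENNReal.ofReal_ne_top
  refine ⟨C * J, ENNReal.mul_ne_top hC hJtop, fun ν δ hν => ?_⟩
  set h : Eucl n → ℝ≥0∞ := fun z => ENNReal.ofReal (|δ + inner ℝ ν z| ^ (s - 1)) with hh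
  have hmeas : Measurable h := by
    have h2 : Measurable fun z : Eucl n => (inner ℝ ν z : ℝ) :=
      (continuous_const.inner continuous_id).measurable
    have h3 : Measurable fun z : Eucl n => |δ + inner ℝ ν z| := (h2.const_add δ).abs
    fun_prop
  set B := Metric.ball (0 : Eucl n) 1
  set k : ℝ → ℝ≥0∞ := fun t => ENNReal.ofReal (α * t ^ (-α - 1)) with hk
  have hkm : Measurable k := by fun_prop
  have hset : MeasurableSet {p : Eucl n × ℝ | ‖p.1‖ < p.2} :=
    measurableSet_lt measurable_fst.norm measurable_snd
  calc ∫⁻ z in B, ENNReal.ofReal (‖z‖ ^ (2 - 2 * s - n) * |δ + inner ℝ ν z| ^ (s - 1))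
      ≤ ∫⁻ z in B, ∫⁻ t in Ioi (0 : ℝ), {p : Eucl n × ℝ | ‖p.1‖ < p.2}.indicator
          (fun p => k p.2 * h p.1) (z, t) := by
        refine lintegral_mono_ae ?_
        have h0 : ∀ᵐ z ∂(volume.restrict B), z ≠ 0 :=
          ae_restrict_of_ae (compl_mem_ae_iff.2 (measure_singleton 0))
        filter_upwards [h0, ae_restrict_mem measurableSet_ball] with z hz hzB
        have hz0 : 0 < ‖z‖ := norm_pos_iff.2 hz
        rw [mem_ball_zero_iff] at hzB
        have e1 : ∫⁻ t in Ioi (0 : ℝ), {p : Eucl n × ℝ | ‖p.1‖ < p.2}.indicator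
            (fun p => k p.2 * h p.1) (z, t) = (∫⁻ t in Ioi ‖z‖, k t) * h z := by
          rw [← lintegral_mul_const _ hkm, ← lintegral_indicator measurableSet_Ioi,
            ← lintegral_indicator measurableSet_Ioi]
          refine lintegral_congr fun t => ?_
          by_cases ht : ‖z‖ < t
          · rw [indicator_of_mem (show t ∈ Ioi (0 : ℝ) from hz0.trans ht),
              indicator_of_mem (show t ∈ Ioi ‖z‖ from ht), indicator_of_mem]
            exact ht
          · rw [indicator_of_notMem (show t ∉ Ioi ‖z‖ from ht)]
            refine indicator_apply_eq_zero.2 fun _ => indicator_of_notMem ?_ _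
            exact ht
        rw [e1, hk, lintegral_Ioi_rpow_eq hα0 hz0, hh, ← ENNReal.ofReal_mul (by positivity)]
        refine ENNReal.ofReal_le_ofReal (mul_le_mul_of_nonneg_right ?_ (by positivity))
        exact Real.rpow_le_rpow_of_exponent_ge hz0 hzB.le (by nlinarith [sq_nonneg (1 - s)])
    _ = ∫⁻ t in Ioi (0 : ℝ), ∫⁻ z in B, {p : Eucl n × ℝ | ‖p.1‖ < p.2}.indicator
          (fun p => k p.2 * h p.1) (z, t) := by
        rw [lintegral_lintegral_swap]
        apply Measurable.aemeasurable
        exact ((hkm.comp measurable_snd).mul (hmeas.comp measurable_fst)).indicator hset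
    _ ≤ ∫⁻ t in Ioi (0 : ℝ), k t * (C * ENNReal.ofReal (min t 1 ^ β)) := by
        refine setLIntegral_mono' measurableSet_Ioi fun t ht => ?_
        have ht0 : (0 : ℝ) < t := ht
        calc ∫⁻ z in B, {p : Eucl n × ℝ | ‖p.1‖ < p.2}.indicator (fun p => k p.2 * h p.1) (z, t)
            ≤ ∫⁻ z in Metric.ball (0 : Eucl n) (min t 1), k t * h z := by
              rw [← lintegral_indicator measurableSet_ball, ← lintegral_indicator measurableSet_ball]
              refine lintegral_mono fun z => ?_
              by_cases h1 : z ∈ B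
              · rw [indicator_of_mem h1]
                by_cases h2 : ‖z‖ < t
                · rw [indicator_of_mem (show (z, t) ∈ {p : Eucl n × ℝ | ‖p.1‖ < p.2} from h2),
                    indicator_of_mem]
                  rw [mem_ball_zero_iff] at h1 ⊢
                  exact lt_min h2 h1
                · rw [indicator_of_notMem (show (z, t) ∉ {p : Eucl n × ℝ | ‖p.1‖ < p.2} from h2)]
                  exact zero_le
              · rw [indicator_of_notMem h1]; exact zero_le
          _ = k t * ∫⁻ z in Metric.ball (0 : Eucl n) (min t 1), h z := lintegral_const_mul _ hmeas
          _ ≤ k t * (C * ENNReal.ofReal (min t 1 ^ β)) := by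
              gcongr
              exact hball ν δ _ hν (lt_min ht0 one_pos)
    _ = C * ∫⁻ t in Ioi (0 : ℝ), k t * ENNReal.ofReal (min t 1 ^ β) := by
        rw [← lintegral_const_mul' _ _ hC]
        refine lintegral_congr fun t => ?_
        ring
    _ ≤ C * J := by
        gcongr
        rw [← Ioc_union_Ioi_eq_Ioi (zero_le_one' ℝ), hJ]
        refine (lintegral_union_le _ _ _).trans (add_le_add ?_ ?_)
        · refine setLIntegral_mono' measurableSet_Ioc fun t ht => ?_
          rw [min_eq_left ht.2, hk, ← ENNReal.ofReal_mul (mul_nonneg hα0.le (Real.rpow_nonneg ht.1.le _)),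
            mul_assoc, ← Real.rpow_add ht.1]
          refine ENNReal.ofReal_le_ofReal (le_of_eq ?_)
          congr 2
          rw [hα, hβ]; ring
        · refine setLIntegral_mono' measurableSet_Ioi fun t ht => ?_
          rw [min_eq_right (le_of_lt ht), Real.one_rpow, ENNReal.ofReal_one, mul_one]

/-! ### Integrability of negative powers of the distance function -/

theorem continuous_distCompl {n : ℕ} (Ω : Set (Eucl n)) : Continuous (distCompl Ω) :=
  Metric.continuous_infDist_pt _

/-- Near the boundary `d` is bounded below by a multiple of a defining function that grows at unit
speed along `e`, so averaging over translations applies; compactness of the closure does the rest.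
-/
theorem lintegral_distCompl_rpow_lt_top {n : ℕ} (hn : 1 ≤ n) {Ω : Set (Eucl n)} (hΩ : IsOpen Ω)
    (hbdd : Bornology.IsBounded Ω) (hC : HasC11Boundary Ω) {s : ℝ} (hs0 : 0 < s) (hs1 : s < 1) :
    ∫⁻ x in Ω, ENNReal.ofReal (distCompl Ω x ^ (s - 1)) < ⊤ := by
  have hcomp : IsCompact (closure Ω) :=
    Metric.isCompact_of_isClosed_isBounded isClosed_closure hbdd.closure
  set h : Eucl n → ℝ≥0∞ := fun x => ENNReal.ofReal (distCompl Ω x ^ (s - 1)) with hh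
  have hmeas : Measurable h := by
    have := (continuous_distCompl Ω).measurable
    fun_prop
  suffices H : ∫⁻ x in Ω ∩ closure Ω, h x < ⊤ by
    rwa [inter_eq_left.2 subset_closure] at H
  refine hcomp.induction_on (p := fun S => ∫⁻ x in Ω ∩ S, h x < ⊤) (by simp) ?_ ?_ ?_
  · intro S T hST hT
    exact (lintegral_mono_set (inter_subset_inter_right _ hST)).trans_lt hT
  · intro S T hS hT
    rw [inter_union_distrib_left]
    exact (lintegral_union_le _ _ _).trans_lt (ENNReal.add_lt_top.2 ⟨hS, hT⟩)
  · intro x₀ hx₀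
    by_cases hx : x₀ ∈ Ω
    · have hd := distCompl_pos hn hΩ hbdd hx
      set δ := distCompl Ω x₀
      refine ⟨Metric.ball x₀ (δ / 2), mem_nhdsWithin_of_mem_nhds (Metric.ball_mem_nhds _ (by positivity)), ?_⟩
      refine (lintegral_mono_set inter_subset_right).trans_lt ?_
      refine (setLIntegral_mono (g := fun _ => ENNReal.ofReal ((δ / 2) ^ (s - 1))) measurable_const
        fun y hy => ?_).trans_lt ?_
      · refine ENNReal.ofReal_le_ofReal (Real.rpow_le_rpow_of_nonpos (by positivity) ?_ (by linarith))
        have h1 : δ ≤ distCompl Ω y + dist x₀ y := Metric.infDist_le_infDist_add_dist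
        rw [Metric.mem_ball, dist_comm] at hy
        linarith
      · rw [setLIntegral_const]
        exact ENNReal.mul_lt_top ENNReal.ofReal_lt_top measure_ball_lt_top
    · have hxf : x₀ ∈ frontier Ω := ⟨hx₀, by rwa [hΩ.interior_eq]⟩
      obtain ⟨e, r, K, Φ, he, hr, hK, hΦ, -, hT, hloc⟩ := hC.exists_defining hxf
      obtain ⟨L, t, ht, hL⟩ := (hΦ.contDiffAt (x := x₀)).exists_lipschitzOnWith
      obtain ⟨r', hr', hball⟩ := Metric.mem_nhds_iff.1 ht
      set r₁ := min r r' with hr₁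
      have hr₁0 : 0 < r₁ := lt_min hr hr'
      refine ⟨Metric.ball x₀ (r₁ / 2), mem_nhdsWithin_of_mem_nhds (Metric.ball_mem_nhds _ (by positivity)), ?_⟩
      set A := Ω ∩ Metric.ball x₀ (r₁ / 2) with hA
      have hAm : MeasurableSet A := hΩ.measurableSet.inter measurableSet_ball
      -- The nearest complement point `w` is still in the larger ball, because `d(y) ≤ dist y x₀`.
      -- There `Φ w ≤ 0`, and the Lipschitz bound gives `Φ y ≤ L d(y)`.
      have hdA : ∀ y ∈ A, 0 < Φ y ∧ Φ y ≤ (L + 1) * distCompl Ω y := by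
        rintro y ⟨hy1, hy2⟩
        obtain ⟨w, hw, hwd⟩ := hΩ.isClosed_compl.exists_infDist_eq_dist
          (compl_nonempty_of_isBounded hn hbdd) y
        change distCompl Ω y = dist y w at hwd
        have h1 : distCompl Ω y ≤ dist y x₀ := Metric.infDist_le_dist_of_mem hx
        rw [Metric.mem_ball] at hy2
        have h2 : dist w x₀ < r₁ := by
          have := dist_triangle_left w x₀ y
          linarith
        have h3 : dist y x₀ < r₁ := by linarith
        have hΦw : Φ w ≤ 0 := by
          by_contra! hpos
          exact hw ((hloc w (Metric.mem_ball.2 (h2.trans_le (min_le_left _ _)))).2 hpos)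
        have hΦy : 0 < Φ y := (hloc y (Metric.mem_ball.2 (h3.trans_le (min_le_left _ _)))).1 hy1
        have h4 := hL.dist_le_mul y (hball (Metric.mem_ball.2 (h3.trans_le (min_le_right _ _)))) w
          (hball (Metric.mem_ball.2 (h2.trans_le (min_le_right _ _))))
        rw [← hwd, Real.dist_eq] at h4
        have h5 := le_abs_self (Φ y - Φ w)
        have h6 := distCompl_nonneg Ω y
        exact ⟨hΦy, by linarith⟩
      have hM : ∀ z ∈ Metric.ball x₀ (r₁ / 2 + 1), ∫⁻ τ in Ioo (0 : ℝ) 1, A.indicator h (z + τ • e)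
          ≤ ENNReal.ofReal (((L : ℝ) + 1) ^ (1 - s)) * ENNReal.ofReal ((2 / s + 1) * 1 ^ s) := by
        intro z _
        refine le_trans ?_ (mul_le_mul_right (lintegral_abs_add_rpow_le hs0 hs1 (Φ z) one_pos) _)
        rw [← lintegral_const_mul' _ _ ENNReal.ofReal_ne_top]
        refine lintegral_mono fun τ => ?_
        refine indicator_apply_le' (fun hmem => ?_) (fun _ => zero_le)
        obtain ⟨h1, h2⟩ := hdA _ hmem
        rw [hT] at h1 h2
        have hL1 : (0 : ℝ) < L + 1 := by positivity
        rw [hh, ← ENNReal.ofReal_mul (by positivity), abs_of_pos h1]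
        refine ENNReal.ofReal_le_ofReal ?_
        have h3 : (Φ z + τ) / (L + 1) ≤ distCompl Ω (z + τ • e) := by
          rw [div_le_iff₀ hL1]; linarith
        refine (Real.rpow_le_rpow_of_nonpos (by positivity) h3 (by linarith)).trans (le_of_eq ?_)
        rw [Real.div_rpow h1.le hL1.le, div_eq_mul_inv, ← Real.rpow_neg hL1.le, mul_comm]
        congr 2; ring
      have key := lintegral_le_of_translate hAm measurableSet_ball hmeas e (t := 1)
        (B := Metric.ball x₀ (r₁ / 2 + 1)) (fun z hz τ hτ => by
          have h1 := hz.2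
          rw [Metric.mem_ball, dist_eq_norm] at h1 ⊢
          calc ‖z - τ • e - x₀‖ = ‖(z - x₀) - τ • e‖ := by congr 1; abel
            _ ≤ ‖z - x₀‖ + ‖τ • e‖ := norm_sub_le _ _
            _ < r₁ / 2 + 1 := by
              rw [norm_smul, he, Real.norm_of_nonneg hτ.1.le, mul_one]
              exact add_lt_add h1 hτ.2) hM
      rw [ENNReal.ofReal_one, one_mul] at key
      refine key.trans_lt ?_
      exact ENNReal.mul_lt_top (ENNReal.mul_lt_top ENNReal.ofReal_lt_top ENNReal.ofReal_lt_top)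
        measure_ball_lt_top

/-! ### The truncated operator applied to `d^s` -/

/-- The exceptional set is a translated hyperplane; the half-space comparison excludes it. -/
theorem ae_inner_add_ne_zero {n : ℕ} {ν : Eucl n} (hν : ‖ν‖ = 1) (δ : ℝ) :
    ∀ᵐ z : Eucl n, δ + inner ℝ ν z ≠ 0 := by
  have hνν : inner ℝ ν ν = (1 : ℝ) := by rw [real_inner_self_eq_norm_sq, hν, one_pow]
  have hK : (ℝ ∙ ν)ᗮ ≠ ⊤ := by
    intro h
    have : ν ∈ (ℝ ∙ ν)ᗮ := h ▸ Submodule.mem_top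
    rw [Submodule.mem_orthogonal_singleton_iff_inner_right, hνν] at this
    exact one_ne_zero this
  have h0 := Measure.addHaar_submodule (volume : Measure (Eucl n)) _ hK
  have h1 : {z : Eucl n | ¬ δ + inner ℝ ν z ≠ 0} = (fun z => z + δ • ν) ⁻¹' ((ℝ ∙ ν)ᗮ : Set _) := by
    ext z
    simp only [ne_eq, not_not, mem_ofPred_eq, mem_preimage, SetLike.mem_coe,
      Submodule.mem_orthogonal_singleton_iff_inner_right, inner_add_right, inner_smul_right, hνν,
      mul_one]
    rw [add_comm]
  rw [ae_iff, h1, measure_preimage_add_right]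
  exact h0

theorem abs_distCompl_sub_le {n : ℕ} (Ω : Set (Eucl n)) (x y : Eucl n) :
    |distCompl Ω x - distCompl Ω y| ≤ ‖x - y‖ := by
  have := (Metric.lipschitz_infDist_pt Ωᶜ).dist_le_mul x y
  rwa [NNReal.coe_one, one_mul, Real.dist_eq, dist_eq_norm] at this

theorem abs_holderQuot_le_one {n : ℕ} (Ω : Set (Eucl n)) {s : ℝ} (hs0 : 0 < s) (hs1 : s < 1)
    (p : Eucl n × Eucl n) : |holderQuot s (fun x => distCompl Ω x ^ s) p| ≤ 1 := by
  rw [holderQuot, abs_div, abs_of_nonneg (Real.rpow_nonneg (norm_nonneg _) s)]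
  refine div_le_one_of_le₀ ?_ (Real.rpow_nonneg (norm_nonneg _) s)
  exact (abs_rpow_sub_rpow_le_rpow hs0 hs1 (distCompl_nonneg _ _) (distCompl_nonneg _ _)).trans
    (Real.rpow_le_rpow (abs_nonneg _) (abs_distCompl_sub_le _ _ _) hs0.le)

theorem measurable_holderQuot {n : ℕ} (s : ℝ) {u : Eucl n → ℝ} (hu : Measurable u) :
    Measurable (holderQuot s u) := by
  unfold holderQuot
  fun_prop

theorem measurable_distCompl_rpow {n : ℕ} (Ω : Set (Eucl n)) (s : ℝ) :
    Measurable fun x => distCompl Ω x ^ s :=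
  (continuous_distCompl Ω).measurable.pow_const s

/-- The integrand of the operator applied to `d^s`. -/
def operatorIntegrand {n : ℕ} (g : ℝ → ℝ) (s : ℝ) (Ω : Set (Eucl n)) (x y : Eucl n) : ℝ :=
  g (holderQuot s (fun x => distCompl Ω x ^ s) (x, y)) * kern s (x - y)

theorem kern_neg {n : ℕ} (s : ℝ) (z : Eucl n) : kern s (-z) = kern s z := by simp [kern]

theorem operatorIntegrand_add {n : ℕ} (g : ℝ → ℝ) (s : ℝ) (Ω : Set (Eucl n)) (x z : Eucl n) :
    operatorIntegrand g s Ω x (x + z)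
      = g ((distCompl Ω x ^ s - distCompl Ω (x + z) ^ s) / ‖z‖ ^ s) * kern s z := by
  simp only [operatorIntegrand, holderQuot, sub_add_cancel_left, kern_neg, norm_neg]

theorem measurable_operatorIntegrand {n : ℕ} {g : ℝ → ℝ} (hg : Continuous g) (s : ℝ)
    (Ω : Set (Eucl n)) : Measurable fun p : Eucl n × Eucl n => operatorIntegrand g s Ω p.1 p.2 := by
  have h1 := hg.measurable.comp (measurable_holderQuot s (measurable_distCompl_rpow Ω s))
  exact h1.mul ((measurable_kern s).comp (measurable_fst.sub measurable_snd))

theorem abs_operatorIntegrand_le {n : ℕ} {g : ℝ → ℝ} {lam Lam : ℝ} (hg : IsAdmissible g lam Lam)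
    (Ω : Set (Eucl n)) {s : ℝ} (hs0 : 0 < s) (hs1 : s < 1) (x y : Eucl n) :
    |operatorIntegrand g s Ω x y| ≤ g 1 * kern s (x - y) := by
  rw [operatorIntegrand, abs_mul, abs_of_nonneg (kern_nonneg _ _)]
  exact mul_le_mul_of_nonneg_right (hg.abs_le (abs_holderQuot_le_one Ω hs0 hs1 _)) (kern_nonneg _ _)

/-- Near `z = 0` the half-space comparison and the Lipschitz bound on `g` produce the singular
kernel; far away each term is at most `g 1` times the kernel. All constants are independent of `x`.
-/
theorem exists_lintegral_diff_le {n : ℕ} (hn : 1 ≤ n) {Ω : Set (Eucl n)} (hΩ : IsOpen Ω)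
    (hbdd : Bornology.IsBounded Ω) {R : ℝ} (hR : 0 < R) {g : ℝ → ℝ} {lam Lam : ℝ}
    (hg : IsAdmissible g lam Lam) {s : ℝ} (hs0 : 0 < s) (hs1 : s < 1) :
    ∃ C : ℝ≥0∞, C ≠ ⊤ ∧ ∀ x ∈ Ω, distCompl Ω x ≤ R / 2 → ∀ ν : Eucl n, ‖ν‖ = 1 →
      Metric.ball (x + (R - distCompl Ω x) • ν) R ⊆ Ω →
      Metric.ball (x - (R + distCompl Ω x) • ν) R ⊆ Ωᶜ →
      ∫⁻ z, ‖operatorIntegrand g s Ω x (x + z) - halfSpaceIntegrand g s (distCompl Ω x) ν z‖ₑ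
        ≤ C := by
  obtain ⟨C₁, hC₁, hsing⟩ := exists_lintegral_singular_le n hn hs0 hs1
  obtain ⟨L, hL, hLip⟩ := hg.exists_lipschitz
  have hg1 := hg.pos 1 one_pos
  have hkern : ∫⁻ z in {z : Eucl n | 1 / 2 < ‖z‖}, ENNReal.ofReal (2 * g 1 * kern s z) < ⊤ :=
    ((integrableOn_kern hn hs0 (by norm_num : (0 : ℝ) < 1 / 2)).const_mul (2 * g 1)).lintegral_lt_top
  refine ⟨ENNReal.ofReal (L * (1 / R)) * C₁ + _,
    ENNReal.add_ne_top.2 ⟨ENNReal.mul_ne_top ENNReal.ofReal_ne_top hC₁, hkern.ne⟩, ?_⟩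
  intro x hx hxR ν hν hb1 hb2
  have hδ := distCompl_pos hn hΩ hbdd hx
  set δ := distCompl Ω x with hδdef
  set D : Eucl n → ℝ := fun z =>
    operatorIntegrand g s Ω x (x + z) - halfSpaceIntegrand g s δ ν z with hD
  have harg : ∀ z, |(δ ^ s - distCompl Ω (x + z) ^ s) / ‖z‖ ^ s| ≤ 1 := by
    intro z
    have := abs_holderQuot_le_one Ω hs0 hs1 (x, x + z)
    simpa [holderQuot] using this
  have hnear : ∀ᵐ z, ‖D z‖ₑ ≤ ENNReal.ofReal (L * (1 / R)) *
      ENNReal.ofReal (‖z‖ ^ (2 - 2 * s - n) * |δ + inner ℝ ν z| ^ (s - 1)) := by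
    have := nontrivial_eucl hn
    have h0 : ∀ᵐ z : Eucl n, z ≠ 0 := compl_mem_ae_iff.2 (measure_singleton 0)
    filter_upwards [ae_inner_add_ne_zero hν δ, h0] with z hz hz0
    have hzn : 0 < ‖z‖ := norm_pos_iff.2 hz0
    rw [← ENNReal.ofReal_mul (by positivity), ← ofReal_norm, Real.norm_eq_abs]
    refine ENNReal.ofReal_le_ofReal ?_
    rw [hD]
    simp only
    rw [operatorIntegrand_add, halfSpaceIntegrand, ← sub_mul, abs_mul, abs_of_nonneg (kern_nonneg _ _)]
    have h1 := hLip _ _ (harg z) (abs_halfSpace_arg_le hs0 hs1 hδ.le hν z)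
    rw [← sub_div, sub_sub_sub_cancel_left, abs_div,
      abs_of_nonneg (Real.rpow_nonneg (norm_nonneg z) s), abs_sub_comm (max _ _ ^ s)] at h1
    have h2 := abs_distCompl_rpow_sub_le hn hbdd hν hδ hxR hb1 hb2 hs0 hs1 hz
    have hp : 0 < ‖z‖ ^ s := Real.rpow_pos_of_pos hzn s
    calc _ ≤ L * (1 / R * (‖z‖ ^ 2 * |δ + inner ℝ ν z| ^ (s - 1)) / ‖z‖ ^ s) * kern s z := by
          refine mul_le_mul_of_nonneg_right (h1.trans ?_) (kern_nonneg _ _)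
          gcongr
      _ = L * (1 / R) * ((‖z‖ ^ 2 * (‖z‖ ^ s)⁻¹ * kern s z) * |δ + inner ℝ ν z| ^ (s - 1)) := by ring
      _ = _ := by
          congr 2
          rw [kern, ← Real.rpow_neg hzn.le, ← Real.rpow_natCast, ← Real.rpow_add hzn,
            ← Real.rpow_add hzn]
          congr 1; push_cast; ring
  have hfar : ∀ z, ‖D z‖ₑ ≤ ENNReal.ofReal (2 * g 1 * kern s z) := by
    intro z
    rw [← ofReal_norm, Real.norm_eq_abs]
    refine ENNReal.ofReal_le_ofReal ?_
    rw [hD]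
    simp only
    rw [operatorIntegrand_add, halfSpaceIntegrand, ← sub_mul, abs_mul, abs_of_nonneg (kern_nonneg _ _)]
    refine mul_le_mul_of_nonneg_right ?_ (kern_nonneg _ _)
    have h1 := hg.abs_le (harg z)
    have h2 := hg.abs_le (abs_halfSpace_arg_le hs0 hs1 hδ.le hν z)
    exact (abs_sub _ _).trans (by linarith)
  calc ∫⁻ z, ‖D z‖ₑ ≤ ∫⁻ z in Metric.ball (0 : Eucl n) 1 ∪ {z : Eucl n | 1 / 2 < ‖z‖}, ‖D z‖ₑ := by
        have : Metric.ball (0 : Eucl n) 1 ∪ {z : Eucl n | 1 / 2 < ‖z‖} = univ := by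
          refine eq_univ_of_forall fun z => ?_
          rcases lt_or_ge ‖z‖ 1 with h | h
          · exact Or.inl (mem_ball_zero_iff.2 h)
          · exact Or.inr (show 1 / 2 < ‖z‖ by linarith)
        rw [this, Measure.restrict_univ]
    _ ≤ _ := lintegral_union_le _ _ _
    _ ≤ _ := by
        refine add_le_add ?_ (lintegral_mono hfar)
        refine (lintegral_mono_ae (ae_restrict_of_ae hnear)).trans ?_
        rw [lintegral_const_mul' _ _ ENNReal.ofReal_ne_top]
        gcongr
        exact hsing ν δ hν

theorem measurableSet_norm_gt {n : ℕ} (ε : ℝ) : MeasurableSet {z : Eucl n | ε < ‖z‖} :=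
  measurableSet_lt measurable_const measurable_norm

/-- The point `z = 0` is in no truncated set; `D 0 = 0` gives convergence there too. -/
theorem tendsto_setIntegral_norm_gt {n : ℕ} {D : Eucl n → ℝ} (hD : Integrable D) (h0 : D 0 = 0) :
    Tendsto (fun ε : ℝ => ∫ z in {z : Eucl n | ε < ‖z‖}, D z) (𝓝[>] 0) (𝓝 (∫ z, D z)) := by
  simp_rw [← integral_indicator (measurableSet_norm_gt _)]
  refine tendsto_integral_filter_of_dominated_convergence (fun z => ‖D z‖)
    (Eventually.of_forall fun ε => hD.aestronglyMeasurable.indicator (measurableSet_norm_gt ε))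
    (Eventually.of_forall fun ε => Eventually.of_forall fun z => norm_indicator_le_norm_self _ _)
    hD.norm (Eventually.of_forall fun z => ?_)
  by_cases hz : z = 0
  · subst hz
    refine tendsto_const_nhds.congr fun ε => ?_
    rw [indicator_apply]; split_ifs <;> simp [h0]
  · refine tendsto_const_nhds.congr' ?_
    filter_upwards [Ioo_mem_nhdsGT (norm_pos_iff.2 hz)] with ε hε
    rw [indicator_of_mem]
    exact hε.2

theorem measurable_prodMk_add {n : ℕ} (x : Eucl n) :
    Measurable fun z : Eucl n => ((x, x + z) : Eucl n × Eucl n) := by fun_prop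

theorem measurable_operatorIntegrand_add {n : ℕ} {g : ℝ → ℝ} (hg : Continuous g) (s : ℝ)
    (Ω : Set (Eucl n)) (x : Eucl n) : Measurable fun z => operatorIntegrand g s Ω x (x + z) := by
  have h := (measurable_operatorIntegrand hg s Ω).comp (measurable_prodMk_add x)
  exact h

/-- The truncated operators applied to `d^s` converge pointwise in the collar to a bounded limit,
with an error that is controlled by `d^{-s}`. -/
theorem exists_operator_limit {n : ℕ} (hn : 1 ≤ n) {Ω : Set (Eucl n)} (hΩ : IsOpen Ω)
    (hbdd : Bornology.IsBounded Ω) {R : ℝ} (hR : 0 < R)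
    (hballs : ∀ x ∈ frontier Ω, ∃ ν : Eucl n, ‖ν‖ = 1 ∧
      Metric.ball (x + R • ν) R ⊆ Ω ∧ Metric.ball (x - R • ν) R ⊆ Ωᶜ)
    {g : ℝ → ℝ} {lam Lam : ℝ} (hg : IsAdmissible g lam Lam) {s : ℝ} (hs0 : 0 < s) (hs1 : s < 1) :
    ∃ C : ℝ, 0 ≤ C ∧ ∀ x ∈ Ω, distCompl Ω x ≤ R / 2 → ∃ F : ℝ, |F| ≤ C ∧
      Tendsto (fun ε : ℝ => ∫ z in {z : Eucl n | ε < ‖z‖}, operatorIntegrand g s Ω x (x + z))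
        (𝓝[>] 0) (𝓝 F) ∧
      ∀ ε : ℝ, 0 < ε → |∫ z in {z : Eucl n | ε < ‖z‖}, operatorIntegrand g s Ω x (x + z)|
        ≤ C + C * distCompl Ω x ^ (-s) := by
  obtain ⟨C₁, hC₁, hdiff⟩ := exists_lintegral_diff_le hn hΩ hbdd hR hg hs0 hs1
  have hg1 := hg.pos 1 one_pos
  set A := (volume : Measure (Eucl n)).toSphere.real univ * ((4 / s + 4) * g 1) with hA
  have hA0 : 0 ≤ A := by positivity
  refine ⟨max C₁.toReal A, le_max_of_le_right hA0, fun x hx hxR => ?_⟩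
  obtain ⟨ν, hν, hb1, hb2⟩ := exists_normal hn hΩ hbdd hR hballs hx
  have hδ := distCompl_pos hn hΩ hbdd hx
  have hlint := hdiff x hx hxR ν hν hb1 hb2
  set δ := distCompl Ω x with hδdef
  set k := halfSpaceIntegrand g s δ ν with hk
  set D : Eucl n → ℝ := fun z => operatorIntegrand g s Ω x (x + z) - k z with hD
  have hDm : Measurable D :=
    (measurable_operatorIntegrand_add hg.continuous s Ω x).sub
      (measurable_halfSpaceIntegrand hg.continuous s δ ν)
  have hDi : Integrable D := ⟨hDm.aestronglyMeasurable, hlint.trans_lt hC₁.lt_top⟩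
  have hDnorm : ∫ z, ‖D z‖ ≤ C₁.toReal := by
    rw [integral_norm_eq_lintegral_enorm hDm.aestronglyMeasurable]
    exact ENNReal.toReal_mono hC₁ hlint
  have hkern0 : kern s (0 : Eucl n) = 0 := by
    have : (0 : ℝ) < n := by exact_mod_cast hn
    rw [kern, norm_zero, Real.zero_rpow (by linarith)]
  have hD0 : D 0 = 0 := by
    simp only [hD, hk, operatorIntegrand_add, halfSpaceIntegrand, hkern0, mul_zero, sub_zero]
  have hsplit : ∀ ε : ℝ, 0 < ε → ∫ z in {z : Eucl n | ε < ‖z‖}, operatorIntegrand g s Ω x (x + z)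
      = (∫ z in {z : Eucl n | ε < ‖z‖}, D z) + ∫ z in {z : Eucl n | ε < ‖z‖}, k z := by
    intro ε hε
    rw [← integral_add hDi.integrableOn
      (integrableOn_halfSpaceIntegrand hn hg.continuous hg.mono hg.odd hs0 hs1 hδ hε hν)]
    refine integral_congr_ae (Eventually.of_forall fun z => ?_)
    simp only [hD, hk, sub_add_cancel]
  have hkb : ∀ ε : ℝ, 0 < ε → |∫ z in {z : Eucl n | ε < ‖z‖}, k z|
      ≤ A * (δ ^ (-s) * min 1 ((ε / δ) ^ (1 - s))) := fun ε hε =>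
    abs_integral_halfSpace_le hn hg.continuous hg.mono hg.odd hs0 hs1 hδ hε hν
  -- The half-space part disappears in the limit, so the limit is the absolutely convergent integral
  -- of the difference.
  refine ⟨∫ z, D z, ?_, ?_, fun ε hε => ?_⟩
  · exact (norm_integral_le_integral_norm _).trans (hDnorm.trans (le_max_left _ _))
  · have t1 := tendsto_setIntegral_norm_gt hDi hD0
    have t2 : Tendsto (fun ε : ℝ => ∫ z in {z : Eucl n | ε < ‖z‖}, k z) (𝓝[>] 0) (𝓝 0) := by
      have t3 : Tendsto (fun ε : ℝ => A * (δ ^ (-s) * (ε / δ) ^ (1 - s))) (𝓝[>] 0) (𝓝 0) := by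
        have hc : Continuous fun ε : ℝ => A * (δ ^ (-s) * (ε / δ) ^ (1 - s)) :=
          continuous_const.mul (continuous_const.mul
            ((continuous_id.div_const δ).rpow_const fun _ => Or.inr (by linarith)))
        have := (hc.tendsto 0).mono_left (nhdsWithin_le_nhds (s := Ioi 0))
        simpa [Real.zero_rpow (by linarith : 1 - s ≠ 0)] using this
      refine squeeze_zero_norm' ?_ t3
      filter_upwards [self_mem_nhdsWithin] with ε hε
      refine (hkb ε hε).trans ?_
      gcongr
      exact min_le_right _ _
    have t4 := t1.add t2
    rw [add_zero] at t4
    refine t4.congr' ?_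
    filter_upwards [self_mem_nhdsWithin] with ε hε using (hsplit ε hε).symm
  · rw [hsplit ε hε]
    refine (abs_add_le _ _).trans (add_le_add ?_ ?_)
    · calc |∫ z in {z : Eucl n | ε < ‖z‖}, D z| ≤ ∫ z in {z : Eucl n | ε < ‖z‖}, ‖D z‖ :=
            (Real.norm_eq_abs _).symm.le.trans (norm_integral_le_integral_norm _)
        _ ≤ ∫ z, ‖D z‖ := setIntegral_le_integral hDi.norm (Eventually.of_forall fun z => norm_nonneg _)
        _ ≤ C₁.toReal := hDnorm
        _ ≤ _ := le_max_left _ _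
    · refine (hkb ε hε).trans ?_
      have hp : 0 ≤ δ ^ (-s) := by positivity
      calc A * (δ ^ (-s) * min 1 ((ε / δ) ^ (1 - s))) ≤ A * (δ ^ (-s) * 1) := by
            gcongr; exact min_le_left _ _
        _ = A * δ ^ (-s) := by rw [mul_one]
        _ ≤ _ := by gcongr; exact le_max_right _ _

/-! ### Integrability on the product space -/

theorem integrableOn_ball_rpow {n : ℕ} (hn : 1 ≤ n) {s : ℝ} (hs1 : s < 1) :
    IntegrableOn (fun z : Eucl n => ‖z‖ ^ (1 - s - (n : ℝ))) (Metric.ball 0 1) := by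
  have := nontrivial_eucl hn
  refine (integrableOn_fun_norm_addHaar (volume : Measure (Eucl n))
    (f := fun r => r ^ (1 - s - (n : ℝ)))).2 ?_
  have h := (intervalIntegral.intervalIntegrable_rpow' (a := 0) (b := 1)
    (by linarith : -1 < -s)).1.mono_set Ioo_subset_Ioc_self
  refine h.congr_fun (fun r hr => ?_) measurableSet_Ioo
  simp only [finrank_euclideanSpace, Fintype.card_fin, smul_eq_mul]
  rw [← Real.rpow_natCast, ← Real.rpow_add hr.1]
  congr 1
  push_cast [Nat.cast_sub hn]; ring

/-- The second integrand is that of a convolution; the first follows by exchanging the variables, as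
`κ` is even. -/
theorem integrable_mul_sub {n : ℕ} {a κ : Eucl n → ℝ} (ha : Integrable a) (hκ : Integrable κ)
    (heven : ∀ z, κ (-z) = κ z) :
    Integrable (fun p : Eucl n × Eucl n => a p.1 * κ (p.1 - p.2)) ∧
      Integrable (fun p : Eucl n × Eucl n => a p.2 * κ (p.1 - p.2)) := by
  have h : Integrable (fun p : Eucl n × Eucl n => a p.2 * κ (p.1 - p.2)) :=
    Integrable.convolution_integrand (ContinuousLinearMap.mul ℝ ℝ) ha hκ
  refine ⟨?_, h⟩
  refine (Integrable.swap (μ := volume) (ν := volume) h).congr (Eventually.of_forall fun p => ?_)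
  simp only [Function.comp_apply, Prod.fst_swap, Prod.snd_swap]
  rw [← neg_sub, heven]

theorem measurable_muWeight (n : ℕ) :
    Measurable fun p : Eucl n × Eucl n => ENNReal.ofReal (1 / ‖p.1 - p.2‖ ^ n) := by
  fun_prop

theorem toReal_muWeight {n : ℕ} (p : Eucl n × Eucl n) :
    (ENNReal.ofReal (1 / ‖p.1 - p.2‖ ^ n)).toReal = 1 / ‖p.1 - p.2‖ ^ n :=
  ENNReal.toReal_ofReal (by positivity)

theorem integrable_muMeasure_iff {n : ℕ} {F : Eucl n × Eucl n → ℝ} :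
    Integrable F (muMeasure n) ↔ Integrable fun p => 1 / ‖p.1 - p.2‖ ^ n * F p := by
  rw [muMeasure, integrable_withDensity_iff_integrable_smul' (measurable_muWeight n)
    (Eventually.of_forall fun _ => ENNReal.ofReal_lt_top)]
  simp only [toReal_muWeight, smul_eq_mul]

theorem integral_muMeasure {n : ℕ} (F : Eucl n × Eucl n → ℝ) :
    ∫ p, F p ∂muMeasure n = ∫ p, 1 / ‖p.1 - p.2‖ ^ n * F p := by
  rw [muMeasure, integral_withDensity_eq_integral_toReal_smul (measurable_muWeight n)
    (Eventually.of_forall fun _ => ENNReal.ofReal_lt_top)]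
  simp only [toReal_muWeight, smul_eq_mul]

theorem weight_mul_eq_kern {n : ℕ} (hn : 1 ≤ n) {s : ℝ} (hs0 : 0 < s) (z : Eucl n) :
    1 / ‖z‖ ^ n * (1 / ‖z‖ ^ s) = kern s z := by
  have hn' : (0 : ℝ) < n := by exact_mod_cast hn
  rcases (norm_nonneg z).eq_or_lt with h | h
  · rw [kern, ← h, Real.zero_rpow (show -(n : ℝ) - s ≠ 0 by linarith), zero_pow (by omega)]; simp
  · rw [kern, Real.rpow_sub h, Real.rpow_neg h.le, Real.rpow_natCast]
    field_simp

/-- The kernel `|z|^{-n-s}` truncated at `|z| = ε`. -/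
def truncKern {n : ℕ} (s ε : ℝ) : Eucl n → ℝ := {z | ε < ‖z‖}.indicator (kern s)

theorem truncKern_neg {n : ℕ} (s ε : ℝ) (z : Eucl n) : truncKern s ε (-z) = truncKern s ε z := by
  simp [truncKern, indicator_apply, kern_neg]

theorem integrable_truncKern {n : ℕ} (hn : 1 ≤ n) {s ε : ℝ} (hs : 0 < s) (hε : 0 < ε) :
    Integrable (truncKern (n := n) s ε) :=
  (integrableOn_kern hn hs hε).integrable_indicator (measurableSet_norm_gt ε)

theorem truncKern_nonneg {n : ℕ} (s ε : ℝ) (z : Eucl n) : 0 ≤ truncKern s ε z :=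
  indicator_nonneg (fun z _ => kern_nonneg s z) z

/-! ### Membership of `d^s` in the solution space -/

section DistanceFunction

variable {n : ℕ} {Ω : Set (Eucl n)} {s : ℝ}

theorem continuous_distCompl_rpow (hs0 : 0 < s) : Continuous fun x => distCompl Ω x ^ s :=
  (continuous_distCompl Ω).rpow_const fun _ => Or.inr hs0.le

theorem integrable_comp_distCompl_rpow (hbdd : Bornology.IsBounded Ω) (hs0 : 0 < s) {h : ℝ → ℝ}
    (hh : Continuous h) (h0 : h 0 = 0) : Integrable fun x => h (distCompl Ω x ^ s) := by
  refine (hh.comp (continuous_distCompl_rpow hs0)).integrable_of_hasCompactSupport ?_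
  refine HasCompactSupport.of_support_subset_isCompact (K := closure Ω)
    (Metric.isCompact_of_isClosed_isBounded isClosed_closure hbdd.closure) fun x hx => ?_
  by_contra hx'
  refine hx ?_
  rw [Function.comp_apply, distCompl_eq_zero fun h => hx' (subset_closure h),
    Real.zero_rpow hs0.ne', h0]

/-- The function `1_Ω d^{s-1}`. -/
def distWeight (Ω : Set (Eucl n)) (s : ℝ) : Eucl n → ℝ :=
  Ω.indicator fun x => distCompl Ω x ^ (s - 1)

theorem distWeight_nonneg (x : Eucl n) : 0 ≤ distWeight Ω s x :=
  indicator_nonneg (fun x _ => Real.rpow_nonneg (distCompl_nonneg Ω x) _) x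

theorem integrable_distWeight (hn : 1 ≤ n) (hΩ : IsOpen Ω) (hbdd : Bornology.IsBounded Ω)
    (hC : HasC11Boundary Ω) (hs0 : 0 < s) (hs1 : s < 1) : Integrable (distWeight Ω s) := by
  refine IntegrableOn.integrable_indicator ⟨?_, ?_⟩ hΩ.measurableSet
  · exact (measurable_distCompl_rpow Ω (s - 1)).aestronglyMeasurable
  · refine lt_of_le_of_lt (le_of_eq ?_)
      (lintegral_distCompl_rpow_lt_top hn hΩ hbdd hC hs0 hs1)
    refine lintegral_congr fun x => ?_
    rw [← ofReal_norm, Real.norm_of_nonneg (Real.rpow_nonneg (distCompl_nonneg Ω x) _)]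

/-- The power inequality is applied at whichever point lies in `Ω`. It gains a full power of `‖x -
y‖` at the cost of the integrable weight `d^(s-1)`. -/
theorem abs_distCompl_rpow_sub_le_weight (hn : 1 ≤ n) (hΩ : IsOpen Ω)
    (hbdd : Bornology.IsBounded Ω) (hs0 : 0 < s) (hs1 : s < 1) (x y : Eucl n) :
    |distCompl Ω x ^ s - distCompl Ω y ^ s|
      ≤ ‖x - y‖ * (distWeight Ω s x + distWeight Ω s y) := by
  have key : ∀ x y, x ∈ Ω → |distCompl Ω y ^ s - distCompl Ω x ^ s|
      ≤ ‖x - y‖ * (distWeight Ω s x + distWeight Ω s y) := by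
    intro x y hx
    have hd := distCompl_pos hn hΩ hbdd hx
    refine (abs_rpow_sub_rpow_le hs0 hs1 (distCompl_nonneg Ω y) hd).trans ?_
    have h1 : distWeight Ω s x = distCompl Ω x ^ (s - 1) := indicator_of_mem hx _
    have h2 := distWeight_nonneg (Ω := Ω) (s := s) y
    rw [← h1]
    have h3 := abs_distCompl_sub_le Ω y x
    rw [norm_sub_rev] at h3
    exact mul_le_mul h3 (by linarith) (distWeight_nonneg x) (norm_nonneg _)
  by_cases hx : x ∈ Ω
  · rw [abs_sub_comm]; exact key x y hx
  · by_cases hy : y ∈ Ω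
    · rw [norm_sub_rev, add_comm]; exact key y x hy
    · rw [distCompl_eq_zero hx, distCompl_eq_zero hy, sub_self, abs_zero]
      exact mul_nonneg (norm_nonneg _) (add_nonneg (distWeight_nonneg x) (distWeight_nonneg y))

/-- Close to the diagonal the gain leaves the integrable kernel `‖z‖^(1-s-n)`; away from it `d^s` is
integrable and the kernel is truncated. Cutting at `1/2` rather than 1 covers the sphere `‖z‖ = 1`
despite the strict inequality. -/
theorem integrable_holderQuot_distCompl (hn : 1 ≤ n) (hΩ : IsOpen Ω)
    (hbdd : Bornology.IsBounded Ω) (hC : HasC11Boundary Ω) (hs0 : 0 < s) (hs1 : s < 1) :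
    Integrable (holderQuot s fun x => distCompl Ω x ^ s) (muMeasure n) := by
  rw [integrable_muMeasure_iff]
  set u : Eucl n → ℝ := fun x => distCompl Ω x ^ s with hu
  set κ : Eucl n → ℝ := (Metric.ball 0 1).indicator fun z => ‖z‖ ^ (1 - s - (n : ℝ)) with hκ
  have hκi : Integrable κ := (integrableOn_ball_rpow hn hs1).integrable_indicator measurableSet_ball
  have hκe : ∀ z, κ (-z) = κ z := fun z => by simp [hκ, Set.indicator]
  have hκ0 : ∀ z, 0 ≤ κ z := fun z =>
    indicator_nonneg (fun z _ => Real.rpow_nonneg (norm_nonneg z) _) z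
  have hui : Integrable u := integrable_comp_distCompl_rpow hbdd hs0 continuous_id rfl
  have hu0 : ∀ x, 0 ≤ u x := fun x => Real.rpow_nonneg (distCompl_nonneg Ω x) _
  obtain ⟨i1, i2⟩ := integrable_mul_sub (integrable_distWeight hn hΩ hbdd hC hs0 hs1) hκi hκe
  obtain ⟨i3, i4⟩ := integrable_mul_sub hui (integrable_truncKern hn hs0 (ε := 1 / 2) (by norm_num))
    (truncKern_neg s _)
  refine Integrable.mono' ((i1.add i2).add (i3.add i4)) ?_ (Eventually.of_forall fun p => ?_)
  · have := measurable_holderQuot s (measurable_distCompl_rpow Ω s)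
    exact (Measurable.mul (by fun_prop) this).aestronglyMeasurable
  · have e : 1 / ‖p.1 - p.2‖ ^ n * holderQuot s u p = kern s (p.1 - p.2) * (u p.1 - u p.2) := by
      rw [← weight_mul_eq_kern hn hs0, holderQuot]; ring
    rw [e, norm_mul, Real.norm_of_nonneg (kern_nonneg _ _), Real.norm_eq_abs]
    simp only [Pi.add_apply]
    have n1 := mul_nonneg (distWeight_nonneg (Ω := Ω) (s := s) p.1) (hκ0 (p.1 - p.2))
    have n2 := mul_nonneg (distWeight_nonneg (Ω := Ω) (s := s) p.2) (hκ0 (p.1 - p.2))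
    have n3 := mul_nonneg (hu0 p.1) (truncKern_nonneg s (1 / 2) (p.1 - p.2))
    have n4 := mul_nonneg (hu0 p.2) (truncKern_nonneg s (1 / 2) (p.1 - p.2))
    rcases lt_or_ge ‖p.1 - p.2‖ 1 with h | h
    · have hk : κ (p.1 - p.2) = ‖p.1 - p.2‖ ^ (1 - s - (n : ℝ)) :=
        indicator_of_mem (mem_ball_zero_iff.2 h) _
      have h1 := mul_le_mul_of_nonneg_left
        (abs_distCompl_rpow_sub_le_weight hn hΩ hbdd hs0 hs1 p.1 p.2) (kern_nonneg s (p.1 - p.2))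
      have h2 : kern s (p.1 - p.2) * ‖p.1 - p.2‖ ≤ κ (p.1 - p.2) := by
        rcases (norm_nonneg (p.1 - p.2)).eq_or_lt with h0 | h0
        · rw [← h0, mul_zero]; exact hκ0 _
        · rw [hk, kern]
          refine le_of_eq ?_
          rw [← Real.rpow_add_one h0.ne']
          congr 1; ring
      have h3 := mul_le_mul_of_nonneg_right h2
        (add_nonneg (distWeight_nonneg (Ω := Ω) (s := s) p.1)
          (distWeight_nonneg (Ω := Ω) (s := s) p.2))
      calc _ ≤ _ := h1
        _ = kern s (p.1 - p.2) * ‖p.1 - p.2‖ * (distWeight Ω s p.1 + distWeight Ω s p.2) := by ring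
        _ ≤ _ := h3
        _ ≤ _ := by linarith
    · have hk : truncKern s (1 / 2) (p.1 - p.2) = kern s (p.1 - p.2) :=
        indicator_of_mem (show p.1 - p.2 ∈ {z : Eucl n | 1 / 2 < ‖z‖} from
          lt_of_lt_of_le (by norm_num) h) _
      have h1 : |u p.1 - u p.2| ≤ u p.1 + u p.2 := by
        refine (abs_sub _ _).trans ?_
        rw [abs_of_nonneg (hu0 _), abs_of_nonneg (hu0 _)]
      have h2 := mul_le_mul_of_nonneg_left h1 (kern_nonneg s (p.1 - p.2))
      rw [hk]
      rw [hk] at n3 n4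
      linarith

/-- The open set can be the whole space. As the quotient is at most 1, `G(D_s d^s)` is controlled
linearly, so its `L¹(μ)` bound suffices. -/
theorem memWtilde_distCompl (hn : 1 ≤ n) (hΩ : IsOpen Ω) (hbdd : Bornology.IsBounded Ω)
    (hC : HasC11Boundary Ω) (hs0 : 0 < s) (hs1 : s < 1) {g : ℝ → ℝ} {lam Lam : ℝ}
    (hg : IsAdmissible g lam Lam) (ρ : ℝ) :
    MemWtilde g s (collar Ω ρ) fun x => distCompl Ω x ^ s := by
  have hGi := integrable_comp_distCompl_rpow (Ω := Ω) hbdd hs0 hg.youngG_continuous (youngG_zero g)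
  refine ⟨fun K _ => ⟨(measurable_distCompl_rpow Ω s).aemeasurable, ?_⟩, univ, isOpen_univ,
    Metric.isCompact_of_isClosed_isBounded isClosed_closure
      (hbdd.subset fun x hx => hx.1).closure, subset_univ _, ?_⟩
  · exact hGi.integrableOn.lintegral_lt_top
  · refine ENNReal.add_lt_top.2 ⟨ENNReal.add_lt_top.2 ⟨luxemburg_lt_top hg ?_,
      luxemburg_lt_top hg ?_⟩, ?_⟩
    · exact hGi.integrableOn.lintegral_lt_top
    · rw [univ_prod_univ, Measure.restrict_univ]
      have hi := ((integrable_holderQuot_distCompl hn hΩ hbdd hC hs0 hs1).abs.const_mul (g 1))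
      refine lt_of_le_of_lt (lintegral_mono fun p => ?_) hi.lintegral_lt_top
      exact ENNReal.ofReal_le_ofReal (hg.youngG_le_mul (abs_holderQuot_le_one Ω hs0 hs1 p))
    · have hgi := integrable_comp_distCompl_rpow (Ω := Ω) hbdd hs0 hg.continuous hg.zero
      refine lt_of_le_of_lt (lintegral_mono fun x => ?_) hgi.lintegral_lt_top
      refine ENNReal.ofReal_le_ofReal ?_
      have hu0 : 0 ≤ distCompl Ω x ^ s := Real.rpow_nonneg (distCompl_nonneg Ω x) _
      rw [abs_of_nonneg hu0]
      have h1 : 1 ≤ 1 + ‖x‖ := by linarith [norm_nonneg x]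
      have h2 : 1 ≤ (1 + ‖x‖) ^ s := Real.one_le_rpow h1 hs0.le
      have h3 : 1 ≤ (1 + ‖x‖) ^ ((n : ℝ) + s) := Real.one_le_rpow h1 (by positivity)
      exact (div_le_self (hg.nonneg (by positivity)) h3).trans (hg.mono (div_le_self hu0 h2))

theorem isOpen_collar (hΩ : IsOpen Ω) (ρ : ℝ) : IsOpen (collar Ω ρ) :=
  hΩ.inter (isOpen_lt (continuous_distCompl Ω) continuous_const)

theorem volume_collar_lt_top (hbdd : Bornology.IsBounded Ω) (ρ : ℝ) :
    volume (collar Ω ρ) < ⊤ :=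
  (hbdd.subset fun _ hx => hx.1).measure_lt_top

end DistanceFunction

/-! ### Test functions -/

section TestFunctions

variable {n : ℕ} {g : ℝ → ℝ} {lam Lam s : ℝ}

theorem muMeasure_absolutelyContinuous (n : ℕ) :
    muMeasure n ≪ (volume : Measure (Eucl n × Eucl n)) :=
  withDensity_absolutelyContinuous _ _

theorem holderQuot_congr_ae {φ ψ : Eucl n → ℝ} (h : φ =ᵐ[volume] ψ) :
    holderQuot s φ =ᵐ[muMeasure n] holderQuot s ψ := by
  have h1 : ∀ᵐ p : Eucl n × Eucl n, φ p.1 = ψ p.1 :=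
    Measure.quasiMeasurePreserving_fst.ae h
  have h2 : ∀ᵐ p : Eucl n × Eucl n, φ p.2 = ψ p.2 :=
    Measure.quasiMeasurePreserving_snd.ae h
  filter_upwards [(muMeasure_absolutelyContinuous n).ae_le h1,
    (muMeasure_absolutelyContinuous n).ae_le h2] with p hp1 hp2
  rw [holderQuot, holderQuot, hp1, hp2]

/-- Every test function has a measurable representative that vanishes outside `V`. -/
theorem MemW0.exists_measurable {V : Set (Eucl n)} (hV : MeasurableSet V) {φ : Eucl n → ℝ}
    (hφ : MemW0 g s V φ) :
    ∃ ψ : Eucl n → ℝ, Measurable ψ ∧ φ =ᵐ[volume] ψ ∧ (∀ x ∉ V, ψ x = 0) ∧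
      ∫⁻ x, ENNReal.ofReal (youngG g (ψ x)) < ⊤ ∧
      ∫⁻ p, ENNReal.ofReal (youngG g (holderQuot s ψ p)) ∂muMeasure n < ⊤ := by
  obtain ⟨⟨⟨hm, hG⟩, -, hD⟩, h0⟩ := hφ
  rw [univ_prod_univ, Measure.restrict_univ] at hD
  rw [Measure.restrict_univ] at hm hG
  have hae : φ =ᵐ[volume] V.indicator (hm.mk φ) := by
    filter_upwards [hm.ae_eq_mk, h0] with x hx hx0
    by_cases hxV : x ∈ V
    · rw [indicator_of_mem hxV, hx]
    · rw [indicator_of_notMem hxV, hx0 hxV]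
  refine ⟨V.indicator (hm.mk φ), hm.measurable_mk.indicator hV, hae,
    fun x hx => indicator_of_notMem hx _, ?_, ?_⟩
  · refine lt_of_le_of_lt (le_of_eq (lintegral_congr_ae ?_)) hG
    filter_upwards [hae] with x hx
    rw [hx]
  · refine lt_of_le_of_lt (le_of_eq (lintegral_congr_ae ?_)) hD
    filter_upwards [holderQuot_congr_ae (s := s) hae] with p hp
    rw [hp]

theorem integrable_of_youngG (hg : IsAdmissible g lam Lam) {V : Set (Eucl n)}
    (hV : MeasurableSet V) (hVfin : volume V < ⊤) {ψ : Eucl n → ℝ} (hψ : Measurable ψ)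
    (h0 : ∀ x ∉ V, ψ x = 0) (hG : ∫⁻ x, ENNReal.ofReal (youngG g (ψ x)) < ⊤) : Integrable ψ := by
  have hGi : Integrable fun x => youngG g (ψ x) := by
    refine ⟨(hg.youngG_continuous.measurable.comp hψ).aestronglyMeasurable, ?_⟩
    rw [hasFiniteIntegral_iff_ofReal (Eventually.of_forall fun x => hg.youngG_nonneg _)]
    exact hG
  have hone : Integrable (V.indicator fun _ => (1 : ℝ)) :=
    (integrable_indicator_iff hV).2 (integrableOn_const hVfin.ne)
  refine Integrable.mono' (hone.add (hGi.div_const (g 1))) hψ.aestronglyMeasurable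
    (Eventually.of_forall fun x => ?_)
  rw [Real.norm_eq_abs, Pi.add_apply]
  by_cases hx : x ∈ V
  · rw [indicator_of_mem hx]; exact hg.le_one_add_youngG _
  · rw [indicator_of_notMem hx, h0 x hx, abs_zero, youngG_zero, zero_div, add_zero]

/-- For each admissible `c`, integrate `|φ/c| ≤ 1 + G(φ/c)/g(1)` over `V` and then take the infimum
over `c`. -/
theorem lintegral_abs_le_luxemburg (hg : IsAdmissible g lam Lam) {V : Set (Eucl n)}
    (hVfin : volume V < ⊤) (φ : Eucl n → ℝ) :
    ∫⁻ x in V, ENNReal.ofReal |φ x| ≤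
      (volume V + ENNReal.ofReal (1 / g 1)) * luxemburg g (volume.restrict univ) φ := by
  have hg1 := hg.pos 1 one_pos
  set K := volume V + ENNReal.ofReal (1 / g 1) with hK
  have hK0 : K ≠ 0 := by
    have : ENNReal.ofReal (1 / g 1) ≠ 0 := by
      rw [ENNReal.ofReal_ne_zero_iff]; positivity
    exact fun h => this (add_eq_zero.1 h).2
  have hKtop : K ≠ ⊤ := ENNReal.add_ne_top.2 ⟨hVfin.ne, ENNReal.ofReal_ne_top⟩
  rw [mul_comm, ← ENNReal.div_le_iff_le_mul (Or.inl hK0) (Or.inl hKtop)]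
  refine le_iInf fun c => le_iInf fun hc => le_iInf fun hmod => ?_
  refine ENNReal.div_le_of_le_mul ?_
  rw [modular, Measure.restrict_univ] at hmod
  calc ∫⁻ x in V, ENNReal.ofReal |φ x|
      ≤ ∫⁻ x in V, ENNReal.ofReal c * (1 + ENNReal.ofReal (1 / g 1)
          * ENNReal.ofReal (youngG g (φ x / c))) := by
        refine lintegral_mono fun x => ?_
        have h1 := hg.le_one_add_youngG (φ x / c)
        have h2 := hg.youngG_nonneg (φ x / c)
        rw [abs_div, abs_of_pos hc, div_le_iff₀ hc] at h1
        rw [← ENNReal.ofReal_mul (by positivity), ← ENNReal.ofReal_one,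
          ← ENNReal.ofReal_add zero_le_one (by positivity), ← ENNReal.ofReal_mul hc.le]
        refine ENNReal.ofReal_le_ofReal (h1.trans (le_of_eq ?_))
        ring
    _ = ENNReal.ofReal c * (volume V + ENNReal.ofReal (1 / g 1)
          * ∫⁻ x in V, ENNReal.ofReal (youngG g (φ x / c))) := by
        rw [lintegral_const_mul' _ _ ENNReal.ofReal_ne_top, lintegral_add_left measurable_const,
          lintegral_const_mul' _ _ ENNReal.ofReal_ne_top, setLIntegral_const, one_mul]
    _ ≤ ENNReal.ofReal c * (volume V + ENNReal.ofReal (1 / g 1) * 1) := by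
        gcongr
        exact (setLIntegral_le_lintegral _ _).trans hmod
    _ = ENNReal.ofReal c * K := by rw [mul_one]

theorem memDual_of_bounded (hg : IsAdmissible g lam Lam) {V : Set (Eucl n)}
    (hV : MeasurableSet V) (hVfin : volume V < ⊤) {f : Eucl n → ℝ} {M : ℝ} (hM : 0 ≤ M)
    (hf : AEStronglyMeasurable f (volume.restrict V)) (hfM : ∀ x ∈ V, |f x| ≤ M) :
    MemDual g s V f := by
  have hint : ∀ φ : Eucl n → ℝ, MemW0 g s V φ → IntegrableOn φ V := by
    intro φ hφ
    obtain ⟨ψ, hψ, hae, h0, hG, -⟩ := hφ.exists_measurable hV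
    exact ((integrable_of_youngG hg hV hVfin hψ h0 hG).congr hae.symm).integrableOn
  have hfM' : ∀ᵐ x ∂volume.restrict V, ‖f x‖ ≤ M :=
    (ae_restrict_iff' hV).2 (Eventually.of_forall hfM)
  have hfφ : ∀ φ : Eucl n → ℝ, MemW0 g s V φ → IntegrableOn (fun x => f x * φ x) V :=
    fun φ hφ => (hint φ hφ).bdd_mul hf hfM'
  have hKtop : ENNReal.ofReal M * (volume V + ENNReal.ofReal (1 / g 1)) ≠ ⊤ :=
    ENNReal.mul_ne_top ENNReal.ofReal_ne_top
      (ENNReal.add_ne_top.2 ⟨hVfin.ne, ENNReal.ofReal_ne_top⟩)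
  refine ⟨hfφ, (ENNReal.ofReal M * (volume V + ENNReal.ofReal (1 / g 1))).toNNReal,
    fun φ hφ => ?_⟩
  rw [ENNReal.coe_toNNReal hKtop]
  calc ENNReal.ofReal |∫ x in V, f x * φ x| = ‖∫ x in V, f x * φ x‖ₑ := by
        rw [← ofReal_norm, Real.norm_eq_abs]
    _ ≤ ∫⁻ x in V, ‖f x * φ x‖ₑ := enorm_integral_le_lintegral_enorm _
    _ ≤ ∫⁻ x in V, ENNReal.ofReal M * ENNReal.ofReal |φ x| := by
        refine setLIntegral_mono' hV fun x hx => ?_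
        rw [← ENNReal.ofReal_mul hM, ← ofReal_norm, norm_mul]
        exact ENNReal.ofReal_le_ofReal (mul_le_mul_of_nonneg_right (hfM x hx) (abs_nonneg _))
    _ = ENNReal.ofReal M * ∫⁻ x in V, ENNReal.ofReal |φ x| :=
        lintegral_const_mul' _ _ ENNReal.ofReal_ne_top
    _ ≤ ENNReal.ofReal M * ((volume V + ENNReal.ofReal (1 / g 1)) *
          luxemburg g (volume.restrict univ) φ) := by
        gcongr
        exact lintegral_abs_le_luxemburg hg hVfin φ
    _ ≤ _ := by
        rw [← mul_assoc]
        gcongr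
        exact le_self_add

end TestFunctions

/-! ### The weak formulation -/

section WeakFormulation

variable {n : ℕ} {Ω : Set (Eucl n)} {g : ℝ → ℝ} {lam Lam s : ℝ}

/-- The operator applied to `d^s`, truncated at `|x - y| = ε`. -/
def truncOperator (g : ℝ → ℝ) (s : ℝ) (Ω : Set (Eucl n)) (ε : ℝ) (x : Eucl n) : ℝ :=
  ∫ z in {z : Eucl n | ε < ‖z‖}, operatorIntegrand g s Ω x (x + z)

/-- The truncated integrand as an antisymmetric function on the product space. -/
def truncIntegrand (g : ℝ → ℝ) (s : ℝ) (Ω : Set (Eucl n)) (ε : ℝ) (p : Eucl n × Eucl n) : ℝ :=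
  {z : Eucl n | ε < ‖z‖}.indicator (fun _ => operatorIntegrand g s Ω p.1 p.2) (p.1 - p.2)

theorem measurable_truncIntegrand (hg : Continuous g) (s : ℝ) (Ω : Set (Eucl n)) (ε : ℝ) :
    Measurable (truncIntegrand g s Ω ε) := by
  have h : truncIntegrand g s Ω ε = {p : Eucl n × Eucl n | ε < ‖p.1 - p.2‖}.indicator
      fun p => operatorIntegrand g s Ω p.1 p.2 := rfl
  rw [h]
  exact (measurable_operatorIntegrand hg s Ω).indicator
    (measurableSet_lt measurable_const (measurable_fst.sub measurable_snd).norm)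

theorem abs_truncIntegrand_le (hg : IsAdmissible g lam Lam) (hs0 : 0 < s) (hs1 : s < 1) (ε : ℝ)
    (p : Eucl n × Eucl n) :
    |truncIntegrand g s Ω ε p| ≤ g 1 * truncKern s ε (p.1 - p.2) := by
  by_cases h : ε < ‖p.1 - p.2‖
  · rw [truncIntegrand, truncKern,
      indicator_of_mem (show p.1 - p.2 ∈ {z : Eucl n | ε < ‖z‖} from h),
      indicator_of_mem (show p.1 - p.2 ∈ {z : Eucl n | ε < ‖z‖} from h)]
    exact abs_operatorIntegrand_le hg Ω hs0 hs1 _ _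
  · rw [truncIntegrand, truncKern,
      indicator_of_notMem (show p.1 - p.2 ∉ {z : Eucl n | ε < ‖z‖} from h),
      indicator_of_notMem (show p.1 - p.2 ∉ {z : Eucl n | ε < ‖z‖} from h)]
    simp

theorem truncIntegrand_swap (hodd : ∀ t, g (-t) = -g t) (ε : ℝ) (p : Eucl n × Eucl n) :
    truncIntegrand g s Ω ε p.swap = -truncIntegrand g s Ω ε p := by
  have h1 : operatorIntegrand g s Ω p.2 p.1 = -operatorIntegrand g s Ω p.1 p.2 := by
    have h2 : holderQuot s (fun x => distCompl Ω x ^ s) (p.2, p.1)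
        = -holderQuot s (fun x => distCompl Ω x ^ s) (p.1, p.2) := by
      simp only [holderQuot]
      rw [norm_sub_rev, ← neg_div, neg_sub]
    rw [operatorIntegrand, operatorIntegrand, h2, hodd, ← neg_sub p.1 p.2, kern_neg, neg_mul]
  by_cases h : ε < ‖p.1 - p.2‖
  · have h' : ε < ‖p.2 - p.1‖ := by rwa [norm_sub_rev]
    rw [truncIntegrand, truncIntegrand, Prod.fst_swap, Prod.snd_swap,
      indicator_of_mem (show p.1 - p.2 ∈ {z : Eucl n | ε < ‖z‖} from h),
      indicator_of_mem (show p.2 - p.1 ∈ {z : Eucl n | ε < ‖z‖} from h'), h1]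
  · have h' : ¬ ε < ‖p.2 - p.1‖ := by rwa [norm_sub_rev]
    rw [truncIntegrand, truncIntegrand, Prod.fst_swap, Prod.snd_swap,
      indicator_of_notMem (show p.1 - p.2 ∉ {z : Eucl n | ε < ‖z‖} from h),
      indicator_of_notMem (show p.2 - p.1 ∉ {z : Eucl n | ε < ‖z‖} from h'), neg_zero]

theorem truncOperator_eq (ε : ℝ) (x : Eucl n) :
    truncOperator g s Ω ε x = ∫ y, truncIntegrand g s Ω ε (x, y) := by
  rw [← integral_add_left_eq_self _ x, truncOperator, ← integral_indicator (measurableSet_norm_gt ε)]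
  refine integral_congr_ae (Eventually.of_forall fun z => ?_)
  simp only [truncIntegrand, sub_add_cancel_left]
  by_cases h : ε < ‖z‖
  · rw [indicator_of_mem (show z ∈ {z : Eucl n | ε < ‖z‖} from h), indicator_of_mem]
    rw [mem_ofPred_eq, norm_neg]; exact h
  · rw [indicator_of_notMem (show z ∉ {z : Eucl n | ε < ‖z‖} from h), indicator_of_notMem]
    rw [mem_ofPred_eq, norm_neg]; exact h

theorem stronglyMeasurable_truncOperator (hg : Continuous g) (ε : ℝ) :
    StronglyMeasurable (truncOperator g s Ω ε) := by
  have h := (measurable_truncIntegrand hg s Ω ε).stronglyMeasurable.integral_prod_right'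
    (ν := (volume : Measure (Eucl n)))
  have e : truncOperator g s Ω ε = fun x => ∫ y, truncIntegrand g s Ω ε (x, y) :=
    funext fun x => truncOperator_eq ε x
  rw [e]
  exact h

/-- The truncated weak form, by antisymmetry of the truncated integrand. -/
theorem integral_trunc_eq (hn : 1 ≤ n) (hg : IsAdmissible g lam Lam) (hs0 : 0 < s) (hs1 : s < 1)
    {ψ : Eucl n → ℝ} (hψm : Measurable ψ) (hψ : Integrable ψ) {ε : ℝ} (hε : 0 < ε) :
    ∫ p : Eucl n × Eucl n, {p : Eucl n × Eucl n | ε < ‖p.1 - p.2‖}.indicator (fun p =>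
      1 / ‖p.1 - p.2‖ ^ n * (g (holderQuot s (fun x => distCompl Ω x ^ s) p) * holderQuot s ψ p)) p
      = 2 * ∫ x, ψ x * truncOperator g s Ω ε x := by
  set A := truncIntegrand g s Ω ε with hA
  have hAm := measurable_truncIntegrand hg.continuous s Ω ε
  obtain ⟨i1, i2⟩ := integrable_mul_sub (hψ.norm.mul_const (g 1)) (integrable_truncKern hn hs0 hε)
    (truncKern_neg s ε)
  have j1 : Integrable fun p : Eucl n × Eucl n => ψ p.1 * A p := by
    refine Integrable.mono' i1 ((hψm.comp measurable_fst).mul hAm).aestronglyMeasurable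
      (Eventually.of_forall fun p => ?_)
    rw [norm_mul, mul_assoc]
    exact mul_le_mul_of_nonneg_left (abs_truncIntegrand_le hg hs0 hs1 ε p) (norm_nonneg _)
  have j2 : Integrable fun p : Eucl n × Eucl n => ψ p.2 * A p := by
    refine Integrable.mono' i2 ((hψm.comp measurable_snd).mul hAm).aestronglyMeasurable
      (Eventually.of_forall fun p => ?_)
    rw [norm_mul, mul_assoc]
    exact mul_le_mul_of_nonneg_left (abs_truncIntegrand_le hg hs0 hs1 ε p) (norm_nonneg _)
  have e1 : ∀ p : Eucl n × Eucl n, {p : Eucl n × Eucl n | ε < ‖p.1 - p.2‖}.indicator (fun p =>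
      1 / ‖p.1 - p.2‖ ^ n * (g (holderQuot s (fun x => distCompl Ω x ^ s) p) * holderQuot s ψ p)) p
      = ψ p.1 * A p - ψ p.2 * A p := by
    intro p
    by_cases h : ε < ‖p.1 - p.2‖
    · rw [indicator_of_mem (show p ∈ {p : Eucl n × Eucl n | ε < ‖p.1 - p.2‖} from h), hA,
        truncIntegrand, indicator_of_mem (show p.1 - p.2 ∈ {z : Eucl n | ε < ‖z‖} from h),
        operatorIntegrand, ← weight_mul_eq_kern hn hs0]
      simp only [holderQuot]
      ring
    · rw [indicator_of_notMem (show p ∉ {p : Eucl n × Eucl n | ε < ‖p.1 - p.2‖} from h), hA,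
        truncIntegrand, indicator_of_notMem (show p.1 - p.2 ∉ {z : Eucl n | ε < ‖z‖} from h)]
      simp
  -- Exchanging the variables changes the sign of the truncated integrand, so the two halves of `D_s
  -- ψ` contribute equally. The truncation is what makes each half integrable separately.
  have e2 : ∫ p : Eucl n × Eucl n, ψ p.2 * A p = -∫ p : Eucl n × Eucl n, ψ p.1 * A p := by
    rw [← integral_neg]
    have := integral_prod_swap (μ := (volume : Measure (Eucl n))) (ν := (volume : Measure (Eucl n)))
      (fun p : Eucl n × Eucl n => ψ p.2 * A p)
    rw [Measure.volume_eq_prod, ← this]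
    refine integral_congr_ae (Eventually.of_forall fun p => ?_)
    simp only [Prod.snd_swap, hA, truncIntegrand_swap hg.odd, mul_neg]
  have e3 : ∫ p : Eucl n × Eucl n, ψ p.1 * A p = ∫ x, ψ x * truncOperator g s Ω ε x := by
    rw [Measure.volume_eq_prod, integral_prod _ j1]
    refine integral_congr_ae (Eventually.of_forall fun x => ?_)
    simp only [integral_const_mul, truncOperator_eq, hA]
  rw [integral_congr_ae (Eventually.of_forall e1), integral_sub j1 j2, e2, e3]
  ring

/-- A Hardy inequality: it follows from `φ = 0` in the exterior tangent balls. -/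
theorem integrableOn_mul_distCompl_rpow (hn : 1 ≤ n) (hΩ : IsOpen Ω)
    (hbdd : Bornology.IsBounded Ω) {R : ℝ} (hR : 0 < R)
    (hballs : ∀ x ∈ frontier Ω, ∃ ν : Eucl n, ‖ν‖ = 1 ∧
      Metric.ball (x + R • ν) R ⊆ Ω ∧ Metric.ball (x - R • ν) R ⊆ Ωᶜ)
    (hg : IsAdmissible g lam Lam) (hs0 : 0 < s)
    {ψ : Eucl n → ℝ} (hψm : Measurable ψ) (h0 : ∀ x ∉ collar Ω (R / 2), ψ x = 0)
    (hD : ∫⁻ p, ENNReal.ofReal (youngG g (holderQuot s ψ p)) ∂muMeasure n < ⊤) :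
    IntegrableOn (fun x => ψ x * distCompl Ω x ^ (-s)) (collar Ω (R / 2)) := by
  have hg1 := hg.pos 1 one_pos
  set V := collar Ω (R / 2) with hV
  have hVm : MeasurableSet V := (isOpen_collar hΩ _).measurableSet
  set w : Eucl n × Eucl n → ℝ≥0∞ := fun p => ENNReal.ofReal (1 / ‖p.1 - p.2‖ ^ n) *
    ENNReal.ofReal (youngG g (holderQuot s ψ p)) with hw
  have hGm : Measurable fun p => ENNReal.ofReal (youngG g (holderQuot s ψ p)) :=
    (hg.youngG_continuous.measurable.comp (measurable_holderQuot s hψm)).ennreal_ofReal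
  have hwm : Measurable w := (measurable_muWeight n).mul hGm
  have hwint : ∫⁻ x, ∫⁻ y, w (x, y) < ⊤ := by
    rw [← lintegral_prod _ hwm.aemeasurable, ← Measure.volume_eq_prod]
    rw [muMeasure, lintegral_withDensity_eq_lintegral_mul _ (measurable_muWeight n) hGm] at hD
    exact hD
  set v := volume (Metric.ball (0 : Eucl n) 1) with hv
  have hv0 : v ≠ 0 := (Metric.measure_ball_pos _ _ one_pos).ne'
  have hvtop : v ≠ ⊤ := measure_ball_lt_top.ne
  set c : ℝ≥0∞ := ENNReal.ofReal (3 ^ s * 3 ^ n / g 1) with hc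
  have key : ∀ x ∈ V, ENNReal.ofReal |ψ x * distCompl Ω x ^ (-s)|
      ≤ ENNReal.ofReal (3 ^ s) + c * v⁻¹ * ∫⁻ y, w (x, y) := by
    rintro x ⟨hx, hxR⟩
    obtain ⟨ν, hν, -, hb⟩ := exists_normal hn hΩ hbdd hR hballs hx
    have hδ := distCompl_pos hn hΩ hbdd hx
    set δ := distCompl Ω x with hδdef
    -- A ball of radius `δ` inside the exterior tangent ball, at distance at most `3δ` from `x`.
    -- There `ψ = 0`, so `D_s ψ(x, y)` is at least `ψ(x)/(3δ)^s` in modulus, and the volume `δ^n` of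
    -- the ball balances the weight `‖x - y‖^(-n)`.
    set Y := Metric.ball (x - (2 * δ) • ν) δ with hY
    have hYsub : ∀ y ∈ Y, y ∉ Ω := by
      intro y hy
      refine hb ?_
      rw [hY, Metric.mem_ball, dist_eq_norm] at hy
      rw [Metric.mem_ball, dist_eq_norm]
      have e : y - (x - (R + δ) • ν) = (y - (x - (2 * δ) • ν)) + (R - δ) • ν := by module
      rw [e]
      refine (norm_add_le _ _).trans_lt ?_
      rw [norm_smul, hν, Real.norm_of_nonneg (by linarith), mul_one]
      linarith
    have hYdist : ∀ y ∈ Y, 0 < ‖x - y‖ ∧ ‖x - y‖ ≤ 3 * δ := by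
      intro y hy
      refine ⟨norm_pos_iff.2 (sub_ne_zero.2 fun h => hYsub y hy (h ▸ hx)), ?_⟩
      rw [hY, Metric.mem_ball, dist_eq_norm] at hy
      have e : x - y = (2 * δ) • ν - (y - (x - (2 * δ) • ν)) := by module
      rw [e]
      refine (norm_sub_le _ _).trans ?_
      rw [norm_smul, hν, Real.norm_of_nonneg (by linarith), mul_one]
      linarith
    set a := ψ x / (3 * δ) ^ s with ha
    have hG0 := hg.youngG_nonneg a
    have h3δ : 0 < 3 * δ := by linarith
    have hlow : ENNReal.ofReal (youngG g a / 3 ^ n) * v ≤ ∫⁻ y, w (x, y) := by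
      calc ENNReal.ofReal (youngG g a / 3 ^ n) * v
          = ENNReal.ofReal (1 / (3 * δ) ^ n * youngG g a) * volume Y := by
            have := nontrivial_eucl hn
            rw [hY, Measure.addHaar_ball volume _ hδ.le, finrank_euclideanSpace, Fintype.card_fin,
              ← mul_assoc, ← ENNReal.ofReal_mul (by positivity)]
            congr 2
            rw [mul_pow]; field_simp
        _ = ∫⁻ _ in Y, ENNReal.ofReal (1 / (3 * δ) ^ n * youngG g a) :=
            (setLIntegral_const _ _).symm
        _ ≤ ∫⁻ y in Y, w (x, y) := by
            refine setLIntegral_mono' measurableSet_ball fun y hy => ?_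
            obtain ⟨d1, d2⟩ := hYdist y hy
            have hψy : ψ y = 0 := h0 y fun hy' => hYsub y hy hy'.1
            rw [hw]
            simp only
            rw [← ENNReal.ofReal_mul (by positivity)]
            refine ENNReal.ofReal_le_ofReal ?_
            refine mul_le_mul ?_ (hg.youngG_mono ?_) hG0 (by positivity)
            · gcongr
            · rw [holderQuot, hψy, sub_zero, ha, abs_div, abs_div,
                abs_of_pos (Real.rpow_pos_of_pos h3δ s), abs_of_pos (Real.rpow_pos_of_pos d1 s)]
              gcongr
        _ ≤ ∫⁻ y, w (x, y) := setLIntegral_le_lintegral _ _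
    have hup : |ψ x * δ ^ (-s)| ≤ 3 ^ s + 3 ^ s * 3 ^ n / g 1 * (youngG g a / 3 ^ n) := by
      have e : ψ x * δ ^ (-s) = 3 ^ s * a := by
        rw [ha, Real.mul_rpow (by norm_num) hδ.le, Real.rpow_neg hδ.le]
        have := Real.rpow_pos_of_pos hδ s
        have : (0 : ℝ) < 3 ^ s := by positivity
        field_simp
      rw [e, abs_mul, abs_of_pos (by positivity : (0 : ℝ) < 3 ^ s)]
      calc (3 : ℝ) ^ s * |a| ≤ 3 ^ s * (1 + youngG g a / g 1) := by
            gcongr; exact hg.le_one_add_youngG a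
        _ = _ := by field_simp
    calc ENNReal.ofReal |ψ x * δ ^ (-s)|
        ≤ ENNReal.ofReal (3 ^ s + 3 ^ s * 3 ^ n / g 1 * (youngG g a / 3 ^ n)) :=
          ENNReal.ofReal_le_ofReal hup
      _ = ENNReal.ofReal (3 ^ s) + c * ENNReal.ofReal (youngG g a / 3 ^ n) := by
          rw [ENNReal.ofReal_add (by positivity) (by positivity), hc,
            ← ENNReal.ofReal_mul (by positivity)]
      _ = ENNReal.ofReal (3 ^ s) + c * v⁻¹ * (ENNReal.ofReal (youngG g a / 3 ^ n) * v) := by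
          congr 1
          rw [mul_assoc, mul_comm _ v, ← mul_assoc v⁻¹, ENNReal.inv_mul_cancel hv0 hvtop, one_mul]
      _ ≤ _ := by gcongr
  refine ⟨(hψm.mul (measurable_distCompl_rpow Ω (-s))).aestronglyMeasurable, ?_⟩
  have hctop : c * v⁻¹ ≠ ⊤ := ENNReal.mul_ne_top ENNReal.ofReal_ne_top (ENNReal.inv_ne_top.2 hv0)
  calc ∫⁻ x in V, ‖ψ x * distCompl Ω x ^ (-s)‖ₑ
      = ∫⁻ x in V, ENNReal.ofReal |ψ x * distCompl Ω x ^ (-s)| := by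
        refine lintegral_congr fun x => ?_
        rw [← ofReal_norm, Real.norm_eq_abs]
    _ ≤ ∫⁻ x in V, (ENNReal.ofReal (3 ^ s) + c * v⁻¹ * ∫⁻ y, w (x, y)) :=
        setLIntegral_mono' hVm key
    _ = ENNReal.ofReal (3 ^ s) * volume V + c * v⁻¹ * ∫⁻ x in V, ∫⁻ y, w (x, y) := by
        rw [lintegral_add_left measurable_const, lintegral_const_mul' _ _ hctop, setLIntegral_const]
    _ < ⊤ := by
        refine ENNReal.add_lt_top.2 ⟨ENNReal.mul_lt_top ENNReal.ofReal_lt_top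
          (volume_collar_lt_top hbdd _), ENNReal.mul_lt_top hctop.lt_top ?_⟩
        exact (setLIntegral_le_lintegral _ _).trans_lt hwint

/-- Young's inequality splits the product into `G(D_s ψ)` and `g(1) |D_s d^s|`, both integrable for
`μ`. -/
theorem integrable_weak_form (hn : 1 ≤ n) (hΩ : IsOpen Ω)
    (hbdd : Bornology.IsBounded Ω) (hC : HasC11Boundary Ω) (hg : IsAdmissible g lam Lam)
    (hs0 : 0 < s) (hs1 : s < 1) {ψ : Eucl n → ℝ} (hψm : Measurable ψ)
    (hD : ∫⁻ p, ENNReal.ofReal (youngG g (holderQuot s ψ p)) ∂muMeasure n < ⊤) :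
    Integrable (fun p => g (holderQuot s (fun x => distCompl Ω x ^ s) p) * holderQuot s ψ p)
      (muMeasure n) := by
  have hGm := hg.youngG_continuous.measurable.comp (measurable_holderQuot s hψm)
  have hGi : Integrable (fun p => youngG g (holderQuot s ψ p)) (muMeasure n) := by
    refine ⟨hGm.aestronglyMeasurable, ?_⟩
    rw [hasFiniteIntegral_iff_ofReal (Eventually.of_forall fun x => hg.youngG_nonneg _)]
    exact hD
  refine Integrable.mono' (hGi.add
    ((integrable_holderQuot_distCompl hn hΩ hbdd hC hs0 hs1).abs.const_mul (g 1))) ?_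
    (Eventually.of_forall fun p => hg.young_inequality (abs_holderQuot_le_one Ω hs0 hs1 p))
  exact ((hg.continuous.measurable.comp (measurable_holderQuot s (measurable_distCompl_rpow Ω s))).mul
    (measurable_holderQuot s hψm)).aestronglyMeasurable

theorem tendsto_integral_trunc {H : Eucl n × Eucl n → ℝ} (hH : Integrable H)
    (hdiag : ∀ p : Eucl n × Eucl n, p.1 = p.2 → H p = 0) :
    Tendsto (fun ε : ℝ => ∫ p, {p : Eucl n × Eucl n | ε < ‖p.1 - p.2‖}.indicator H p)
      (𝓝[>] 0) (𝓝 (∫ p, H p)) := by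
  have hset : ∀ ε : ℝ, MeasurableSet {p : Eucl n × Eucl n | ε < ‖p.1 - p.2‖} := fun ε =>
    measurableSet_lt measurable_const (measurable_fst.sub measurable_snd).norm
  refine tendsto_integral_filter_of_dominated_convergence (fun p => ‖H p‖)
    (Eventually.of_forall fun ε => hH.aestronglyMeasurable.indicator (hset ε))
    (Eventually.of_forall fun ε => Eventually.of_forall fun p => norm_indicator_le_norm_self _ _)
    hH.norm (Eventually.of_forall fun p => ?_)
  by_cases hp : p.1 = p.2
  · refine tendsto_const_nhds.congr fun ε => ?_
    rw [indicator_apply]; split_ifs <;> simp [hdiag p hp]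
  · refine tendsto_const_nhds.congr' ?_
    filter_upwards [Ioo_mem_nhdsGT (norm_pos_iff.2 (sub_ne_zero.2 hp))] with ε hε
    rw [indicator_of_mem]
    exact hε.2

/-- Both sides of the truncated identity pass to the limit by dominated convergence, the right one
with the Hardy bound on `ψ d^(-s)` as majorant. -/
theorem weak_form_eq_of_limit (hn : 1 ≤ n) (hΩ : IsOpen Ω) (hbdd : Bornology.IsBounded Ω)
    (hC : HasC11Boundary Ω) {R : ℝ} (hR : 0 < R)
    (hballs : ∀ x ∈ frontier Ω, ∃ ν : Eucl n, ‖ν‖ = 1 ∧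
      Metric.ball (x + R • ν) R ⊆ Ω ∧ Metric.ball (x - R • ν) R ⊆ Ωᶜ)
    (hg : IsAdmissible g lam Lam) (hs0 : 0 < s) (hs1 : s < 1) {C : ℝ} {F : Eucl n → ℝ}
    (hlim : ∀ x ∈ collar Ω (R / 2), Tendsto (fun ε => truncOperator g s Ω ε x) (𝓝[>] 0) (𝓝 (F x)))
    (hbound : ∀ x ∈ collar Ω (R / 2), ∀ ε : ℝ, 0 < ε →
      |truncOperator g s Ω ε x| ≤ C + C * distCompl Ω x ^ (-s))
    {ψ : Eucl n → ℝ} (hψm : Measurable ψ) (h0 : ∀ x ∉ collar Ω (R / 2), ψ x = 0)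
    (hG : ∫⁻ x, ENNReal.ofReal (youngG g (ψ x)) < ⊤)
    (hD : ∫⁻ p, ENNReal.ofReal (youngG g (holderQuot s ψ p)) ∂muMeasure n < ⊤) :
    ∫ p, g (holderQuot s (fun x => distCompl Ω x ^ s) p) * holderQuot s ψ p ∂muMeasure n
      = ∫ x in collar Ω (R / 2), 2 * F x * ψ x := by
  set V := collar Ω (R / 2) with hV
  have hVm : MeasurableSet V := (isOpen_collar hΩ _).measurableSet
  have hψ := integrable_of_youngG hg hVm (volume_collar_lt_top hbdd _) hψm h0 hG
  have hH := integrable_muMeasure_iff.1 (integrable_weak_form hn hΩ hbdd hC hg hs0 hs1 hψm hD)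
  have hdom := integrableOn_mul_distCompl_rpow hn hΩ hbdd hR hballs hg hs0 hψm h0 hD
  have t1 := tendsto_integral_trunc hH fun p hp => by simp [hp, zero_pow (show n ≠ 0 by omega)]
  have t2 : Tendsto (fun ε => ∫ x in V, ψ x * truncOperator g s Ω ε x) (𝓝[>] 0)
      (𝓝 (∫ x in V, ψ x * F x)) := by
    refine tendsto_integral_filter_of_dominated_convergence
      (fun x => C * ‖ψ x‖ + C * ‖ψ x * distCompl Ω x ^ (-s)‖) ?_ ?_ ?_ ?_
    · exact Eventually.of_forall fun ε => (hψm.aestronglyMeasurable.mul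
        (stronglyMeasurable_truncOperator hg.continuous ε).aestronglyMeasurable)
    · filter_upwards [self_mem_nhdsWithin] with ε hε
      refine (ae_restrict_iff' hVm).2 (Eventually.of_forall fun x hx => ?_)
      rw [norm_mul, norm_mul, Real.norm_of_nonneg (Real.rpow_nonneg (distCompl_nonneg Ω x) _)]
      calc ‖ψ x‖ * ‖truncOperator g s Ω ε x‖ ≤ ‖ψ x‖ * (C + C * distCompl Ω x ^ (-s)) :=
            mul_le_mul_of_nonneg_left (hbound x hx ε hε) (norm_nonneg _)
        _ = _ := by ring
    · exact (hψ.norm.integrableOn.const_mul C).add (hdom.norm.const_mul C)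
    · exact (ae_restrict_iff' hVm).2 (Eventually.of_forall fun x hx => (hlim x hx).const_mul _)
  have t3 := t2.const_mul 2
  have hsupp : ∀ ε, ∫ x, ψ x * truncOperator g s Ω ε x = ∫ x in V, ψ x * truncOperator g s Ω ε x :=
    fun ε => (setIntegral_eq_integral_of_forall_compl_eq_zero fun x hx => by
      rw [h0 x hx, zero_mul]).symm
  rw [integral_muMeasure]
  refine (tendsto_nhds_unique t1 (t3.congr' ?_)).trans ?_
  · filter_upwards [self_mem_nhdsWithin] with ε hε
    rw [integral_trunc_eq hn hg hs0 hs1 hψm hψ hε, hsupp]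
  · rw [← integral_const_mul]
    refine integral_congr_ae (Eventually.of_forall fun x => ?_)
    simp only
    ring

end WeakFormulation

end

theorem proposition4p4 (n : ℕ) (hn : 1 ≤ n) (Ω : Set (Eucl n)) (hΩ : IsOpen Ω)
    (hbdd : Bornology.IsBounded Ω) (hC : HasC11Boundary Ω) :
    ∃ ρ : ℝ, 0 < ρ ∧
      ∀ (s : ℝ), 0 < s → s < 1 →
      ∀ (g : ℝ → ℝ) (lam Lam : ℝ), IsAdmissible g lam Lam →
        ∃ f : Eucl n → ℝ, MemLp f ⊤ (volume.restrict (collar Ω ρ)) ∧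
          IsWeakSolution g s (collar Ω ρ) (fun x => distCompl Ω x ^ s) f := by
  obtain ⟨R, hR, hballs⟩ := hC.exists_balls hΩ hbdd
  -- Half the ball radius is where the two-sided expansion of `d` and the Hardy inequality hold; it
  -- depends on `Ω` alone.
  refine ⟨R / 2, by positivity, fun s hs0 hs1 g lam Lam hg => ?_⟩
  obtain ⟨C, hC0, hop⟩ := exists_operator_limit hn hΩ hbdd hR hballs hg hs0 hs1
  set V := collar Ω (R / 2) with hV
  have hVm : MeasurableSet V := (isOpen_collar hΩ _).measurableSet
  have hVfin : volume V < ⊤ := volume_collar_lt_top hbdd _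
  have hop' : ∀ x ∈ V, ∃ F : ℝ, |F| ≤ C ∧
      Tendsto (fun ε => truncOperator g s Ω ε x) (𝓝[>] 0) (𝓝 F) ∧
      ∀ ε : ℝ, 0 < ε → |truncOperator g s Ω ε x| ≤ C + C * distCompl Ω x ^ (-s) :=
    fun x hx => hop x hx.1 (le_of_lt hx.2)
  choose! F hFC hFlim hFbound using hop'
  -- The limit was chosen pointwise; its measurability comes from that of the truncated operators.
  have hfm : AEStronglyMeasurable F (volume.restrict V) :=
    aestronglyMeasurable_of_tendsto_ae (𝓝[>] (0 : ℝ))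
      (fun ε => (stronglyMeasurable_truncOperator hg.continuous ε).aestronglyMeasurable)
      ((ae_restrict_iff' hVm).2 (Eventually.of_forall hFlim))
  have hf2 : AEStronglyMeasurable (fun x => 2 * F x) (volume.restrict V) := hfm.const_mul 2
  have hf2b : ∀ x ∈ V, |2 * F x| ≤ 2 * C := fun x hx => by
    rw [abs_mul, abs_two]; linarith [hFC x hx]
  refine ⟨fun x => 2 * F x, memLp_top_of_bound hf2 (2 * C)
    ((ae_restrict_iff' hVm).2 (Eventually.of_forall hf2b)),
    memWtilde_distCompl hn hΩ hbdd hC hs0 hs1 hg _,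
    memDual_of_bounded hg hVm hVfin (by positivity) hf2 hf2b, fun φ hφ => ?_⟩
  obtain ⟨ψ, hψm, hae, h0, hG, hD⟩ := hφ.exists_measurable hVm
  have hq : (fun p => g (holderQuot s (fun x => distCompl Ω x ^ s) p) * holderQuot s φ p)
      =ᵐ[muMeasure n]
      fun p => g (holderQuot s (fun x => distCompl Ω x ^ s) p) * holderQuot s ψ p := by
    filter_upwards [holderQuot_congr_ae (s := s) hae] with p hp
    rw [hp]
  refine ⟨(integrable_weak_form hn hΩ hbdd hC hg hs0 hs1 hψm hD).congr hq.symm, ?_⟩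
  rw [integral_congr_ae hq, weak_form_eq_of_limit hn hΩ hbdd hC hR hballs hg hs0 hs1 hFlim hFbound
    hψm h0 hG hD]
  refine integral_congr_ae (ae_restrict_of_ae ?_)
  filter_upwards [hae] with x hx
  rw [hx]
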